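/- **The theory.** Let $\mathsf{EHA}$ be extensional Heyting arithmetic in all finite types. The types are generated from $N$ by $\sigma\times\tau$, $\sigma+\tau$, $\sigma\to\tau$. The terms are built by application from typed variables and the constants $\mathsf k,\mathsf s,\mathsf{pair},\mathsf{fst},\mathsf{snd},\mathsf{inl},\mathsf{inr},\mathsf{case},\mathsf 0,\mathsf{succ}$ and the recursors $\mathsf R_\sigma$. Equality is primitive at every type. The logic is intuitionistic. The axioms are the equality axioms (reflexivity, symmetry, transitivity, congruence of application), the defining equations of the constants, $\mathsf{succ}\,n\neq\mathsf 0$, injectivity of $\mathsf{succ}$, induction for all formulas, and extensionality: $\forall x\,(fx=gx)\to f=g$; $\mathsf{pair}(\mathsf{fst}\,x)(\mathsf{snd}\,x)=x$; and $\exists u\,(x=\mathsf{inl}\,u)\lor\exists v\,(x=\mathsf{inr}\,v)$ for $x$ of sum type. Write $0:=N$ and $n+1:=n\to N$. Consider further * $\mathsf{CE}_0$: $\exists X\,\forall\Phi^{2}\,\forall f^1,g^1\,(\Phi f\neq\Phi g\to f(X\Phi fg)\neq g(X\Phi fg))$, with $X$ of type $2\to1\to1\to0$; * $\mathsf{AC}$: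 $\forall x^\sigma\exists y^\tau A(x,y)\to\exists f^{\sigma\to\tau}\forall x\,A(x,fx)$, for all types $\sigma,\tau$ and formulas $A$; * $\mathsf{IP}$: $(\neg A\to\exists y^\tau B(y))\to\exists y^\tau(\neg A\to B(y))$, for all types $\tau$ and formulas $A,B$ with $y$ not free in $A$. **Modified realizability.** To a formula $A$ assign a type $|A|$ and a formula $r\ \mathsf{mr}\ A$, with $r$ of type $|A|$: * $|A|=N$ and $r\ \mathsf{mr}\ A:\equiv A$ for $A$ an equation or $\bot$; * $|A\land B|=|A|\times|B|$, $|A\lor B|=|A|+|B|$, $|A\to B|=|A|\to|B|$, $|\forall x^\sigma A|=\sigma\to|A|$, $|\exists x^\sigma A|=\sigma\times|A|$; * $r\ \mathsf{mr}\ (A\land B)$ is $(\mathsf{fst}\,r\ \mathsf{mr}\ A)\land(\mathsf{snd}\,r\ \mathsf{mr}\ B)$; * $r\ \mathsf{mr}\ (A\lor B)$ is $\exists u(r=\mathsf{inl}\,u\land u\ \mathsf{mr}\ A)\lor\exists v(r=\mathsf{inr}\,v\land v\ \mathsf{mr}\ B)$; * $r\ \mathsf{mr}\ (A\to B)$ is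 $\forall u\,(u\ \mathsf{mr}\ A\to ru\ \mathsf{mr}\ B)$; * $r\ \mathsf{mr}\ \forall xA(x)$ is $\forall x\,(rx\ \mathsf{mr}\ A(x))$, and $r\ \mathsf{mr}\ \exists xA(x)$ is $\mathsf{snd}\,r\ \mathsf{mr}\ A(\mathsf{fst}\,r)$. Put $A^{\mathsf{mr}}:\equiv\exists x^{|A|}(x\ \mathsf{mr}\ A)$. **The interpretation $\alpha$.** Define types $\sigma^+,\sigma^-$ by $N^+=N^-=N$; $(\sigma\times\tau)^+=\sigma^+\times\tau^+$, $(\sigma\times\tau)^-=\sigma^-+\tau^-$; $(\sigma+\tau)^+=\sigma^++\tau^+$, $(\sigma+\tau)^-=\sigma^-\times\tau^-$; $(\sigma\to\tau)^+=(\sigma^+\to\tau^+)\times(\sigma^+\to\sigma^+\to\tau^-\to\sigma^-)$, $(\sigma\to\tau)^-=\sigma^+\times\tau^-$. Define formulas $\mathrm{dom}_\sigma(x)$ and $\mathrm{app}_\sigma(x,y,z)$, with $x,y:\sigma^+$ and $z:\sigma^-$, by * $\mathrm{dom}_N(x):\equiv x=x$ and $\mathrm{app}_N(x,y,z):\equiv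 x\neq y$; * $\mathrm{dom}_{\sigma\times\tau}(x):\equiv\mathrm{dom}_\sigma(\mathsf{fst}\,x)\land\mathrm{dom}_\tau(\mathsf{snd}\,x)$, and $\mathrm{app}_{\sigma\times\tau}(x,y,z):\equiv[\exists u(z=\mathsf{inl}\,u\land\mathrm{app}_\sigma(\mathsf{fst}\,x,\mathsf{fst}\,y,u))\lor\exists v(z=\mathsf{inr}\,v\land\mathrm{app}_\tau(\mathsf{snd}\,x,\mathsf{snd}\,y,v))]\land\mathrm{dom}_{\sigma\times\tau}(x)\land\mathrm{dom}_{\sigma\times\tau}(y)$; * $\mathrm{dom}_{\sigma+\tau}(x):\equiv\exists u(x=\mathsf{inl}\,u\land\mathrm{dom}_\sigma(u))\lor\exists v(x=\mathsf{inr}\,v\land\mathrm{dom}_\tau(v))$, and $\mathrm{app}_{\sigma+\tau}(x,y,z):\equiv[\exists u,v((x=\mathsf{inl}\,u\land y=\mathsf{inr}\,v)\lor(x=\mathsf{inr}\,v\land y=\mathsf{inl}\,u))\lor\exists u,v(x=\mathsf{inl}\,u\land y=\mathsf{inl}\,v\land\mathrm{app}_\sigma(u,v,\mathsf{fst}\,z))\lor\exists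 u,v(x=\mathsf{inr}\,u\land y=\mathsf{inr}\,v\land\mathrm{app}_\tau(u,v,\mathsf{snd}\,z))]\land\mathrm{dom}_{\sigma+\tau}(x)\land\mathrm{dom}_{\sigma+\tau}(y)$; * $\mathrm{dom}_{\sigma\to\tau}(x):\equiv\forall u(\mathrm{dom}_\sigma(u)\to\mathrm{dom}_\tau((\mathsf{fst}\,x)u))\land\forall u,v,w\,(\mathrm{dom}_\sigma(u)\to\mathrm{dom}_\sigma(v)\to\mathrm{app}_\tau((\mathsf{fst}\,x)u,(\mathsf{fst}\,x)v,w)\to\mathrm{app}_\sigma(u,v,(\mathsf{snd}\,x)uvw))$, and $\mathrm{app}_{\sigma\to\tau}(x,y,z):\equiv\mathrm{dom}_\sigma(\mathsf{fst}\,z)\land\mathrm{app}_\tau((\mathsf{fst}\,x)(\mathsf{fst}\,z),(\mathsf{fst}\,y)(\mathsf{fst}\,z),\mathsf{snd}\,z)\land\mathrm{dom}_{\sigma\to\tau}(x)\land\mathrm{dom}_{\sigma\to\tau}(y)$. A variable of type $\sigma$ is translated to one of type $\sigma^+$, and $(ts)^+:=(\mathsf{fst}\,t^+)s^+$. Each constant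 $c$ of type $\sigma$ is translated to an explicit closed term $c^+$ of type $\sigma^+$: the evident lift of $c$, with $\mathsf 0^+=\mathsf 0$, paired at each function type with an explicit functional that sends evidence that two values are apart to evidence that the arguments are apart. The translation $A^\alpha$ of a formula commutes with $\bot,\land,\lor,\to$, and $$(s=_\sigma t)^\alpha:\equiv\neg\exists z\,\mathrm{app}_\sigma(s^+,t^+,z),\quad(\forall x^\sigma A)^\alpha:\equiv\forall x^{\sigma^+}(\mathrm{dom}_\sigma(x)\to A^\alpha),\quad(\exists x^\sigma A)^\alpha:\equiv\exists x^{\sigma^+}(\mathrm{dom}_\sigma(x)\land A^\alpha).$$ **Theorem.** For every sentence $A$, if $\mathsf{EHA}+\mathsf{CE}_0+\mathsf{AC}+\mathsf{IP}\vdash A$, then $\mathsf{EHA}\vdash(A^{\mathsf{mr}})^\alpha$. Moreover, there is a closed term $t$ of type $|A|^+$ such that $\mathsf{EHA}\vdash\mathrm{dom}_{|A|}(t)$ and $\mathsf{EHA}\vdash(x\ \mathsf{mr}\ A)^\alpha[t/x]$. -/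

import Mathlib

namespace EHA

/-! ### The language: Gödel's T with product and sum types, in combinatory form -/

/-- Finite types over `N`, with binary products, binary sums and function types. -/
inductive Ty : Type
  | N : Ty
  | prod : Ty → Ty → Ty
  | sum : Ty → Ty → Ty
  | arr : Ty → Ty → Ty

infixr:66 " ⇒ " => EHA.Ty.arr
infixr:68 " ⊠ " => EHA.Ty.prod
infixr:67 " ⊞ " => EHA.Ty.sum

/-- `Var Γ σ`: the variables of type `σ` in the typed context `Γ` (de Bruijn indices). -/
inductive Var : List Ty → Ty → Type
  | zero {Γ : List Ty} {σ : Ty} : Var (σ :: Γ) σ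
  | succ {Γ : List Ty} {σ τ : Ty} : Var Γ τ → Var (σ :: Γ) τ

/-- The constants; `iter σ` is the recursor at type `σ`. -/
inductive Con : Ty → Type
  | k (σ τ : Ty) : Con (σ ⇒ τ ⇒ σ)
  | s (σ τ ρ : Ty) : Con ((σ ⇒ τ ⇒ ρ) ⇒ (σ ⇒ τ) ⇒ σ ⇒ ρ)
  | pair (σ τ : Ty) : Con (σ ⇒ τ ⇒ σ ⊠ τ)
  | fst (σ τ : Ty) : Con (σ ⊠ τ ⇒ σ)
  | snd (σ τ : Ty) : Con (σ ⊠ τ ⇒ τ)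
  | inl (σ τ : Ty) : Con (σ ⇒ σ ⊞ τ)
  | inr (σ τ : Ty) : Con (τ ⇒ σ ⊞ τ)
  | case (σ τ ρ : Ty) : Con ((σ ⇒ ρ) ⇒ (τ ⇒ ρ) ⇒ σ ⊞ τ ⇒ ρ)
  | zero : Con Ty.N
  | succ : Con (Ty.N ⇒ Ty.N)
  | iter (σ : Ty) : Con (σ ⇒ (Ty.N ⇒ σ ⇒ σ) ⇒ Ty.N ⇒ σ)

/-- Well-typed terms in a context. -/
inductive Tm (Γ : List Ty) : Ty → Type
  | var {σ : Ty} : Var Γ σ → Tm Γ σ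
  | con {σ : Ty} : Con σ → Tm Γ σ
  | app {σ τ : Ty} : Tm Γ (σ ⇒ τ) → Tm Γ σ → Tm Γ τ

infixl:80 " ⬝ " => EHA.Tm.app

/-- Well-typed formulas in a context; equality is primitive at every type. -/
inductive Fm : List Ty → Type
  | eq {Γ : List Ty} {σ : Ty} : Tm Γ σ → Tm Γ σ → Fm Γ
  | bot {Γ : List Ty} : Fm Γ
  | and {Γ : List Ty} : Fm Γ → Fm Γ → Fm Γ
  | or {Γ : List Ty} : Fm Γ → Fm Γ → Fm Γ
  | imp {Γ : List Ty} : Fm Γ → Fm Γ → Fm Γ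
  | all {Γ : List Ty} (σ : Ty) : Fm (σ :: Γ) → Fm Γ
  | ex {Γ : List Ty} (σ : Ty) : Fm (σ :: Γ) → Fm Γ

infix:60 " ≐ " => EHA.Fm.eq
infixr:55 " ⋏ " => EHA.Fm.and
infixr:54 " ⋎ " => EHA.Fm.or
infixr:53 " ⇛ " => EHA.Fm.imp

def Fm.neg {Γ : List Ty} (A : Fm Γ) : Fm Γ := A ⇛ Fm.bot

/-! ### Substitution -/

/-- A simultaneous substitution of terms over `Δ` for the variables of `Γ`. -/
def Sub (Γ Δ : List Ty) : Type := ∀ σ : Ty, Var Γ σ → Tm Δ σ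

def Tm.subst {Γ Δ : List Ty} (θ : Sub Γ Δ) : {σ : Ty} → Tm Γ σ → Tm Δ σ
  | _, .var x => θ _ x
  | _, .con c => .con c
  | _, .app t s => .app (t.subst θ) (s.subst θ)

def Sub.id (Γ : List Ty) : Sub Γ Γ := fun _ x => .var x

/-- The inclusion of `Γ` in `σ :: Γ`. -/
def Sub.shift (Γ : List Ty) (σ : Ty) : Sub Γ (σ :: Γ) := fun _ x => .var x.succ

/-- Weakening of a term by one variable. -/
def Tm.wk {Γ : List Ty} {τ : Ty} (σ : Ty) (t : Tm Γ τ) : Tm (σ :: Γ) τ :=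
  t.subst (Sub.shift Γ σ)

/-- Extend a substitution by a term for the newest variable. -/
def Sub.cons {Γ Δ : List Ty} {σ : Ty} (θ : Sub Γ Δ) (t : Tm Δ σ) : Sub (σ :: Γ) Δ
  | _, .zero => t
  | _, .succ x => θ _ x

/-- Weaken the codomain of a substitution. -/
def Sub.wk {Γ Δ : List Ty} (σ : Ty) (θ : Sub Γ Δ) : Sub Γ (σ :: Δ) := fun _ x => (θ _ x).wk σ

/-- Carry a substitution under a binder. -/
def Sub.lift {Γ Δ : List Ty} (σ : Ty) (θ : Sub Γ Δ) : Sub (σ :: Γ) (σ :: Δ) :=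
  (θ.wk σ).cons (.var .zero)

def Fm.subst : {Γ Δ : List Ty} → Sub Γ Δ → Fm Γ → Fm Δ
  | _, _, θ, .eq s t => .eq (s.subst θ) (t.subst θ)
  | _, _, _, .bot => .bot
  | _, _, θ, .and A B => .and (A.subst θ) (B.subst θ)
  | _, _, θ, .or A B => .or (A.subst θ) (B.subst θ)
  | _, _, θ, .imp A B => .imp (A.subst θ) (B.subst θ)
  | _, _, θ, .all σ A => .all σ (A.subst (θ.lift σ))
  | _, _, θ, .ex σ A => .ex σ (A.subst (θ.lift σ))

def Fm.wk {Γ : List Ty} (σ : Ty) (A : Fm Γ) : Fm (σ :: Γ) := A.subst (Sub.shift Γ σ)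

/-- `A.inst t` is `A` with `t` substituted for the newest variable. -/
def Fm.inst {Γ : List Ty} {σ : Ty} (A : Fm (σ :: Γ)) (t : Tm Γ σ) : Fm Γ :=
  A.subst ((Sub.id Γ).cons t)

/-! ### Abbreviations for terms -/

section Terms

variable {Γ : List Ty} {α β γ σ τ ρ σ₀ σ₁ σ₂ σ₃ σ₄ σ₅ σ₆ : Ty}

def v0 : Tm (σ :: Γ) σ := .var .zero
def v1 : Tm (σ₀ :: σ :: Γ) σ := .var (.succ .zero)
def v2 : Tm (σ₀ :: σ₁ :: σ :: Γ) σ := .var (.succ (.succ .zero))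
def v3 : Tm (σ₀ :: σ₁ :: σ₂ :: σ :: Γ) σ := .var (.succ (.succ (.succ .zero)))
def v4 : Tm (σ₀ :: σ₁ :: σ₂ :: σ₃ :: σ :: Γ) σ := .var (.succ (.succ (.succ (.succ .zero))))
def v5 : Tm (σ₀ :: σ₁ :: σ₂ :: σ₃ :: σ₄ :: σ :: Γ) σ :=
  .var (.succ (.succ (.succ (.succ (.succ .zero)))))
def v6 : Tm (σ₀ :: σ₁ :: σ₂ :: σ₃ :: σ₄ :: σ₅ :: σ :: Γ) σ :=
  .var (.succ (.succ (.succ (.succ (.succ (.succ .zero))))))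
def v7 : Tm (σ₀ :: σ₁ :: σ₂ :: σ₃ :: σ₄ :: σ₅ :: σ₆ :: σ :: Γ) σ :=
  .var (.succ (.succ (.succ (.succ (.succ (.succ (.succ .zero)))))))

def zro : Tm Γ Ty.N := .con .zero
def suc (t : Tm Γ Ty.N) : Tm Γ Ty.N := .con .succ ⬝ t
def pr (a : Tm Γ σ) (b : Tm Γ τ) : Tm Γ (σ ⊠ τ) := .con (.pair σ τ) ⬝ a ⬝ b
def p1 (x : Tm Γ (σ ⊠ τ)) : Tm Γ σ := .con (.fst σ τ) ⬝ x
def p2 (x : Tm Γ (σ ⊠ τ)) : Tm Γ τ := .con (.snd σ τ) ⬝ x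
def il (a : Tm Γ σ) : Tm Γ (σ ⊞ τ) := .con (.inl σ τ) ⬝ a
def ir (b : Tm Γ τ) : Tm Γ (σ ⊞ τ) := .con (.inr σ τ) ⬝ b
def recN (a : Tm Γ σ) (b : Tm Γ (Ty.N ⇒ σ ⇒ σ)) (n : Tm Γ Ty.N) : Tm Γ σ :=
  .con (.iter σ) ⬝ a ⬝ b ⬝ n

/-- Lambda abstraction over the newest variable, by the usual bracket abstraction. -/
def lam : {τ : Ty} → Tm (σ :: Γ) τ → Tm Γ (σ ⇒ τ)
  | _, .var .zero => .con (.s σ (σ ⇒ σ) σ) ⬝ .con (.k σ (σ ⇒ σ)) ⬝ .con (.k σ σ)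
  | τ, .var (.succ x) => .con (.k τ σ) ⬝ .var x
  | τ, .con c => .con (.k τ σ) ⬝ .con c
  | _, .app t s => .con (.s _ _ _) ⬝ lam t ⬝ lam s

/-- Case distinction with two open branches. -/
def cases (x : Tm Γ (σ ⊞ τ)) (a : Tm (σ :: Γ) ρ) (b : Tm (τ :: Γ) ρ) : Tm Γ ρ :=
  .con (.case σ τ ρ) ⬝ lam a ⬝ lam b ⬝ x

def Sub.nil (Γ : List Ty) : Sub [] Γ := fun _ x => by cases x

/-- A closed term, seen in an arbitrary context. -/
def cl (t : Tm [] σ) : Tm Γ σ := t.subst (Sub.nil Γ)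

/-- A closed term of each type. -/
def dfl : (σ : Ty) → Tm [] σ
  | .N => zro
  | .prod σ τ => pr (dfl σ) (dfl τ)
  | .sum σ _ => il (dfl σ)
  | .arr _ τ => .con (.k _ _) ⬝ dfl τ

end Terms

/-! ### Intuitionistic derivability -/

/-- `Prov T Δ A`: `A` is derivable in many-sorted intuitionistic predicate logic
(natural deduction) from the open assumptions `Δ` and the axioms `T`. -/
inductive Prov (T : ∀ {Γ : List Ty}, Fm Γ → Prop) : {Γ : List Ty} → List (Fm Γ) → Fm Γ → Prop
  | ax {Γ : List Ty} {Δ : List (Fm Γ)} {A : Fm Γ} : T A → Prov T Δ A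
  | hyp {Γ : List Ty} {Δ : List (Fm Γ)} {A : Fm Γ} : A ∈ Δ → Prov T Δ A
  | botE {Γ : List Ty} {Δ : List (Fm Γ)} {A : Fm Γ} : Prov T Δ Fm.bot → Prov T Δ A
  | andI {Γ : List Ty} {Δ : List (Fm Γ)} {A B : Fm Γ} :
      Prov T Δ A → Prov T Δ B → Prov T Δ (A ⋏ B)
  | andE₁ {Γ : List Ty} {Δ : List (Fm Γ)} {A B : Fm Γ} : Prov T Δ (A ⋏ B) → Prov T Δ A
  | andE₂ {Γ : List Ty} {Δ : List (Fm Γ)} {A B : Fm Γ} : Prov T Δ (A ⋏ B) → Prov T Δ B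
  | orI₁ {Γ : List Ty} {Δ : List (Fm Γ)} {A B : Fm Γ} : Prov T Δ A → Prov T Δ (A ⋎ B)
  | orI₂ {Γ : List Ty} {Δ : List (Fm Γ)} {A B : Fm Γ} : Prov T Δ B → Prov T Δ (A ⋎ B)
  | orE {Γ : List Ty} {Δ : List (Fm Γ)} {A B C : Fm Γ} :
      Prov T Δ (A ⋎ B) → Prov T (A :: Δ) C → Prov T (B :: Δ) C → Prov T Δ C
  | impI {Γ : List Ty} {Δ : List (Fm Γ)} {A B : Fm Γ} : Prov T (A :: Δ) B → Prov T Δ (A ⇛ B)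
  | impE {Γ : List Ty} {Δ : List (Fm Γ)} {A B : Fm Γ} :
      Prov T Δ (A ⇛ B) → Prov T Δ A → Prov T Δ B
  | allI {Γ : List Ty} {Δ : List (Fm Γ)} {σ : Ty} {A : Fm (σ :: Γ)} :
      Prov T (Δ.map (Fm.wk σ)) A → Prov T Δ (.all σ A)
  | allE {Γ : List Ty} {Δ : List (Fm Γ)} {σ : Ty} {A : Fm (σ :: Γ)} (t : Tm Γ σ) :
      Prov T Δ (.all σ A) → Prov T Δ (A.inst t)
  | exI {Γ : List Ty} {Δ : List (Fm Γ)} {σ : Ty} {A : Fm (σ :: Γ)} (t : Tm Γ σ) :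
      Prov T Δ (A.inst t) → Prov T Δ (.ex σ A)
  | exE {Γ : List Ty} {Δ : List (Fm Γ)} {σ : Ty} {A : Fm (σ :: Γ)} {C : Fm Γ} :
      Prov T Δ (.ex σ A) → Prov T (A :: Δ.map (Fm.wk σ)) (C.wk σ) → Prov T Δ C

/-! ### The theories -/

/-- Substitute `succ x` for the newest variable `x`. -/
def Fm.substSucc {Γ : List Ty} (A : Fm (Ty.N :: Γ)) : Fm (Ty.N :: Γ) :=
  A.subst ((Sub.shift Γ Ty.N).cons (suc v0))

/-- The nonlogical axioms of extensional Heyting arithmetic in all finite types. -/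
inductive Ax : {Γ : List Ty} → Fm Γ → Prop
  | refl {Γ : List Ty} {σ : Ty} (a : Tm Γ σ) : Ax (a ≐ a)
  | symm {Γ : List Ty} {σ : Ty} (a b : Tm Γ σ) : Ax (a ≐ b ⇛ b ≐ a)
  | trans {Γ : List Ty} {σ : Ty} (a b c : Tm Γ σ) : Ax (a ≐ b ⇛ b ≐ c ⇛ a ≐ c)
  | congr {Γ : List Ty} {σ τ : Ty} (f g : Tm Γ (σ ⇒ τ)) (a b : Tm Γ σ) :
      Ax (f ≐ g ⇛ a ≐ b ⇛ f ⬝ a ≐ g ⬝ b)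
  | k {Γ : List Ty} {σ τ : Ty} (a : Tm Γ σ) (b : Tm Γ τ) : Ax (.con (.k σ τ) ⬝ a ⬝ b ≐ a)
  | s {Γ : List Ty} {σ τ ρ : Ty} (a : Tm Γ (σ ⇒ τ ⇒ ρ)) (b : Tm Γ (σ ⇒ τ)) (c : Tm Γ σ) :
      Ax (.con (.s σ τ ρ) ⬝ a ⬝ b ⬝ c ≐ a ⬝ c ⬝ (b ⬝ c))
  | fst {Γ : List Ty} {σ τ : Ty} (a : Tm Γ σ) (b : Tm Γ τ) : Ax (p1 (pr a b) ≐ a)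
  | snd {Γ : List Ty} {σ τ : Ty} (a : Tm Γ σ) (b : Tm Γ τ) : Ax (p2 (pr a b) ≐ b)
  | caseInl {Γ : List Ty} {σ τ ρ : Ty} (f : Tm Γ (σ ⇒ ρ)) (g : Tm Γ (τ ⇒ ρ)) (a : Tm Γ σ) :
      Ax (.con (.case σ τ ρ) ⬝ f ⬝ g ⬝ il a ≐ f ⬝ a)
  | caseInr {Γ : List Ty} {σ τ ρ : Ty} (f : Tm Γ (σ ⇒ ρ)) (g : Tm Γ (τ ⇒ ρ)) (b : Tm Γ τ) :
      Ax (.con (.case σ τ ρ) ⬝ f ⬝ g ⬝ ir b ≐ g ⬝ b)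
  | recZero {Γ : List Ty} {σ : Ty} (a : Tm Γ σ) (b : Tm Γ (Ty.N ⇒ σ ⇒ σ)) :
      Ax (recN a b zro ≐ a)
  | recSucc {Γ : List Ty} {σ : Ty} (a : Tm Γ σ) (b : Tm Γ (Ty.N ⇒ σ ⇒ σ)) (n : Tm Γ Ty.N) :
      Ax (recN a b (suc n) ≐ b ⬝ n ⬝ recN a b n)
  | succNeZero {Γ : List Ty} (n : Tm Γ Ty.N) : Ax (suc n ≐ zro ⇛ Fm.bot)
  | succInj {Γ : List Ty} (m n : Tm Γ Ty.N) : Ax (suc m ≐ suc n ⇛ m ≐ n)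
  | ind {Γ : List Ty} (A : Fm (Ty.N :: Γ)) :
      Ax (A.inst zro ⇛ .all Ty.N (A ⇛ A.substSucc) ⇛ .all Ty.N A)
  | extArr {Γ : List Ty} {σ τ : Ty} (f g : Tm Γ (σ ⇒ τ)) :
      Ax (.all σ (f.wk σ ⬝ v0 ≐ g.wk σ ⬝ v0) ⇛ f ≐ g)
  | extProd {Γ : List Ty} {σ τ : Ty} (x : Tm Γ (σ ⊠ τ)) : Ax (pr (p1 x) (p2 x) ≐ x)
  | extSum {Γ : List Ty} {σ τ : Ty} (x : Tm Γ (σ ⊞ τ)) :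
      Ax (.ex σ (x.wk σ ≐ il v0) ⋎ .ex τ (x.wk τ ≐ ir v0))

/-- The pure types: `0 = N` and `n + 1 = n → N`. -/
@[reducible] def pure : ℕ → Ty
  | 0 => .N
  | n + 1 => pure n ⇒ .N

/-- Converse extensionality:
`∃ X ∀ Φ ∀ f ∀ g (Φ f ≠ Φ g → f (X Φ f g) ≠ g (X Φ f g))`, where `Φ` has type `n + 2`
and `f`, `g` have type `n + 1`. -/
def CE {Γ : List Ty} (n : ℕ) : Fm Γ :=
  .ex (pure (n + 2) ⇒ pure (n + 1) ⇒ pure (n + 1) ⇒ pure n) <|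
  .all (pure (n + 2)) <| .all (pure (n + 1)) <| .all (pure (n + 1)) <|
    (Fm.neg (v2 ⬝ v1 ≐ v2 ⬝ v0)) ⇛
      (Fm.neg (v1 ⬝ (v3 ⬝ v2 ⬝ v1 ⬝ v0) ≐ v0 ⬝ (v3 ⬝ v2 ⬝ v1 ⬝ v0)))

/-- The axiom of choice `∀ x ∃ y A(x, y) → ∃ f ∀ x A(x, f x)`. -/
def AC {Γ : List Ty} (σ τ : Ty) (A : Fm (τ :: σ :: Γ)) : Fm Γ :=
  .all σ (.ex τ A) ⇛
    .ex (σ ⇒ τ) (.all σ (A.subst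
      ((((Sub.shift Γ (σ ⇒ τ)).wk σ).cons v0).cons (v1 ⬝ v0))))

/-- Independence of premise `(¬ A → ∃ y B(y)) → ∃ y (¬ A → B(y))`, `y` not free in `A`. -/
def IP {Γ : List Ty} (τ : Ty) (A : Fm Γ) (B : Fm (τ :: Γ)) : Fm Γ :=
  (A.neg ⇛ .ex τ B) ⇛ .ex τ ((A.wk τ).neg ⇛ B)

/-- The nonlogical axioms of `EHA + CE₀ + AC + IP`. -/
inductive AxPlus : {Γ : List Ty} → Fm Γ → Prop
  | base {Γ : List Ty} {A : Fm Γ} : Ax A → AxPlus A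
  | ce {Γ : List Ty} : AxPlus (CE 0 : Fm Γ)
  | ac {Γ : List Ty} (σ τ : Ty) (A : Fm (τ :: σ :: Γ)) : AxPlus (AC σ τ A)
  | ip {Γ : List Ty} (τ : Ty) (A : Fm Γ) (B : Fm (τ :: Γ)) : AxPlus (IP τ A B)

/-! ### Modified realizability -/

/-- The type of the potential realizers of a formula. Since there is no unit type, the
(irrelevant) realizers of prime formulas have type `N`. -/
@[reducible] def Fm.rty : {Γ : List Ty} → Fm Γ → Ty
  | _, .eq _ _ => .N
  | _, .bot => .N
  | _, .and A B => A.rty ⊠ B.rty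
  | _, .or A B => A.rty ⊞ B.rty
  | _, .imp A B => A.rty ⇒ B.rty
  | _, .all σ A => σ ⇒ A.rty
  | _, .ex σ A => σ ⊠ A.rty

/-- `A.mr θ r` is the formula `r mr A[θ]`. -/
def Fm.mr : {Γ : List Ty} → (A : Fm Γ) → {Δ : List Ty} → Sub Γ Δ → Tm Δ A.rty → Fm Δ
  | _, .eq s t, _, θ, _ => s.subst θ ≐ t.subst θ
  | _, .bot, _, _, _ => .bot
  | _, .and A B, _, θ, r => A.mr θ (p1 r) ⋏ B.mr θ (p2 r)
  | _, .or A B, _, θ, r =>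
      .ex A.rty (r.wk A.rty ≐ il v0 ⋏ A.mr (θ.wk A.rty) v0) ⋎
      .ex B.rty (r.wk B.rty ≐ ir v0 ⋏ B.mr (θ.wk B.rty) v0)
  | _, .imp A B, _, θ, r =>
      .all A.rty (A.mr (θ.wk A.rty) v0 ⇛ B.mr (θ.wk A.rty) (r.wk A.rty ⬝ v0))
  | _, .all σ A, _, θ, r => .all σ (A.mr (θ.lift σ) (r.wk σ ⬝ v0))
  | _, .ex _ A, _, θ, r => A.mr (θ.cons (p1 r)) (p2 r)

/-- `A.mrOpen` is the formula `x mr A` with a new free variable `x`. -/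
def Fm.mrOpen {Γ : List Ty} (A : Fm Γ) : Fm (A.rty :: Γ) := A.mr (Sub.shift Γ A.rty) v0

/-- The modified realizability interpretation `∃ x (x mr A)` of `A`. -/
def Fm.mrInt {Γ : List Ty} (A : Fm Γ) : Fm Γ := .ex A.rty A.mrOpen

/-! ### The apartness interpretation -/

mutual

/-- The type `σ⁺` whose elements (in the domain) interpret the elements of type `σ`. -/
@[reducible] def Ty.plus : Ty → Ty
  | .N => .N
  | .prod σ τ => σ.plus ⊠ τ.plus
  | .sum σ τ => σ.plus ⊞ τ.plus
  | .arr σ τ => (σ.plus ⇒ τ.plus) ⊠ (σ.plus ⇒ σ.plus ⇒ τ.minus ⇒ σ.minus)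

/-- The type `σ⁻` of evidence for apartness of elements of type `σ`. -/
@[reducible] def Ty.minus : Ty → Ty
  | .N => .N
  | .prod σ τ => σ.minus ⊞ τ.minus
  | .sum σ τ => σ.minus ⊠ τ.minus
  | .arr σ τ => σ.plus ⊠ τ.minus

end

/-- A formula `dom(x)` on `p` and a formula `app(x, y, z)` on `p`, `p`, `m`, read as:
`z` is evidence that `x` and `y` are apart. -/
structure Apart (p m : Ty) where
  dom : {Γ : List Ty} → Tm Γ p → Fm Γ
  app : {Γ : List Ty} → Tm Γ p → Tm Γ p → Tm Γ m → Fm Γ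

def Apart.nat : Apart Ty.N Ty.N where
  dom x := x ≐ x
  app x y _ := Fm.neg (x ≐ y)

section Apartness

variable {p m q n : Ty}

def Apart.domProd (P : Apart p m) (Q : Apart q n) {Γ : List Ty} (x : Tm Γ (p ⊠ q)) : Fm Γ :=
  P.dom (p1 x) ⋏ Q.dom (p2 x)

def Apart.prod (P : Apart p m) (Q : Apart q n) : Apart (p ⊠ q) (m ⊞ n) where
  dom x := P.domProd Q x
  app x y z :=
    (.ex m (z.wk m ≐ il v0 ⋏ P.app (p1 (x.wk m)) (p1 (y.wk m)) v0) ⋎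
      .ex n (z.wk n ≐ ir v0 ⋏ Q.app (p2 (x.wk n)) (p2 (y.wk n)) v0)) ⋏
    P.domProd Q x ⋏ P.domProd Q y

def Apart.domSum (P : Apart p m) (Q : Apart q n) {Γ : List Ty} (x : Tm Γ (p ⊞ q)) : Fm Γ :=
  .ex p (x.wk p ≐ il v0 ⋏ P.dom v0) ⋎ .ex q (x.wk q ≐ ir v0 ⋏ Q.dom v0)

def Apart.sum (P : Apart p m) (Q : Apart q n) : Apart (p ⊞ q) (m ⊠ n) where
  dom x := P.domSum Q x
  app x y z :=
    (.ex p (.ex q (((x.wk p).wk q ≐ il v1 ⋏ (y.wk p).wk q ≐ ir v0) ⋎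
        ((x.wk p).wk q ≐ ir v0 ⋏ (y.wk p).wk q ≐ il v1))) ⋎
      .ex p (.ex p ((x.wk p).wk p ≐ il v1 ⋏ (y.wk p).wk p ≐ il v0 ⋏
        P.app v1 v0 (p1 ((z.wk p).wk p)))) ⋎
      .ex q (.ex q ((x.wk q).wk q ≐ ir v1 ⋏ (y.wk q).wk q ≐ ir v0 ⋏
        Q.app v1 v0 (p2 ((z.wk q).wk q))))) ⋏
    P.domSum Q x ⋏ P.domSum Q y

def Apart.domArr (P : Apart p m) (Q : Apart q n) {Γ : List Ty}
    (x : Tm Γ ((p ⇒ q) ⊠ (p ⇒ p ⇒ n ⇒ m))) : Fm Γ :=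
  .all p (P.dom v0 ⇛ Q.dom (p1 (x.wk p) ⬝ v0)) ⋏
  .all p (.all p (.all n (P.dom v2 ⇛ P.dom v1 ⇛
    Q.app (p1 (((x.wk p).wk p).wk n) ⬝ v2) (p1 (((x.wk p).wk p).wk n) ⬝ v1) v0 ⇛
    P.app v2 v1 (p2 (((x.wk p).wk p).wk n) ⬝ v2 ⬝ v1 ⬝ v0))))

def Apart.arr (P : Apart p m) (Q : Apart q n) :
    Apart ((p ⇒ q) ⊠ (p ⇒ p ⇒ n ⇒ m)) (p ⊠ n) where
  dom x := P.domArr Q x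
  app x y z :=
    P.dom (p1 z) ⋏ Q.app (p1 x ⬝ p1 z) (p1 y ⬝ p1 z) (p2 z) ⋏
    P.domArr Q x ⋏ P.domArr Q y

end Apartness

/-- The formulas `dom_σ` and `app_σ`. -/
def apart : (σ : Ty) → Apart σ.plus σ.minus
  | .N => .nat
  | .prod σ τ => (apart σ).prod (apart τ)
  | .sum σ τ => (apart σ).sum (apart τ)
  | .arr σ τ => (apart σ).arr (apart τ)

/-! Interpretation of the constants. An element of `(σ ⇒ τ)⁺` is a pair of a function and a
functional that reflects apartness. -/

section Constants

variable {Γ : List Ty} {p q m n : Ty}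

/-- The value of `f` at `x`. -/
def ap (f : Tm Γ ((p ⇒ q) ⊠ (p ⇒ p ⇒ n ⇒ m))) (x : Tm Γ p) : Tm Γ q := p1 f ⬝ x

/-- The evidence that `x` and `y` are apart, from evidence `w` that their values are apart. -/
def rf (f : Tm Γ ((p ⇒ q) ⊠ (p ⇒ p ⇒ n ⇒ m))) (x y : Tm Γ p) (w : Tm Γ n) : Tm Γ m :=
  p2 f ⬝ x ⬝ y ⬝ w

/-- A function `x ↦ a(x)` together with the reflecting functional `x, y, w ↦ b(x, y, w)`. -/
def mor (a : Tm (p :: Γ) q) (b : Tm (n :: p :: p :: Γ) m) :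
    Tm Γ ((p ⇒ q) ⊠ (p ⇒ p ⇒ n ⇒ m)) :=
  pr (lam a) (lam (lam (lam b)))

/-- Discrimination of numbers: `0` if the arguments are equal, and `1` otherwise. -/
def disc : Tm [] (Ty.N ⇒ Ty.N ⇒ Ty.N) :=
  lam (lam (recN
    (lam (recN zro (lam (lam (suc zro))) v0))
    (lam (lam (lam (recN (suc zro) (lam (lam (v3 ⬝ v1))) v0))))
    v1 ⬝ v0))

/-- Symmetry of apartness: from `x`, `y` and evidence for `x # y`, evidence for `y # x`. -/
def sy : (σ : Ty) → Tm [] (σ.plus ⇒ σ.plus ⇒ σ.minus ⇒ σ.minus)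
  | .N => lam (lam (lam v0))
  | .prod σ τ => lam (lam (lam (cases v0
      (il (cl (sy σ) ⬝ p1 v3 ⬝ p1 v2 ⬝ v0))
      (ir (cl (sy τ) ⬝ p2 v3 ⬝ p2 v2 ⬝ v0)))))
  | .sum σ τ => lam (lam (lam (cases v2
      (cases v2 (pr (cl (sy σ) ⬝ v1 ⬝ v0 ⬝ p1 v2) (p2 v2)) v2)
      (cases v2 v2 (pr (p1 v2) (cl (sy τ) ⬝ v1 ⬝ v0 ⬝ p2 v2))))))
  | .arr _ τ => lam (lam (lam
      (pr (p1 v0) (cl (sy τ) ⬝ ap v2 (p1 v0) ⬝ ap v1 (p1 v0) ⬝ p2 v0))))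

/-- Cotransitivity of apartness: from `x`, `y`, `z` and evidence for `x # y`, evidence for
`x # z` or evidence for `y # z`. -/
def tr : (σ : Ty) → Tm [] (σ.plus ⇒ σ.plus ⇒ σ.plus ⇒ σ.minus ⇒ σ.minus ⊞ σ.minus)
  | .N => lam (lam (lam (lam (recN (ir v0) (lam (lam (il v2))) (cl disc ⬝ v3 ⬝ v1)))))
  | .prod σ τ => lam (lam (lam (lam (cases v0
      (cases (cl (tr σ) ⬝ p1 v4 ⬝ p1 v3 ⬝ p1 v2 ⬝ v0) (il (il v0)) (ir (il v0)))
      (cases (cl (tr τ) ⬝ p2 v4 ⬝ p2 v3 ⬝ p2 v2 ⬝ v0) (il (ir v0)) (ir (ir v0)))))))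
  | .sum σ τ => lam (lam (lam (lam (cases v3
      (cases v2
        (cases v4
          (cases (cl (tr σ) ⬝ v2 ⬝ v0 ⬝ v1 ⬝ p1 v3) (il (pr v0 (p2 v4))) (ir (pr v0 (p2 v4))))
          (ir v3))
        (il v2))
      (cases v2
        (il v2)
        (cases v4
          (ir v3)
          (cases (cl (tr τ) ⬝ v2 ⬝ v0 ⬝ v1 ⬝ p2 v3)
            (il (pr (p1 v4) v0)) (ir (pr (p1 v4) v0)))))))))
  | .arr _ τ => lam (lam (lam (lam (cases
      (cl (tr τ) ⬝ ap v3 (p1 v0) ⬝ ap v2 (p1 v0) ⬝ ap v1 (p1 v0) ⬝ p2 v0)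
      (il (pr (p1 v1) v0)) (ir (pr (p1 v1) v0))))))

/-- The underlying function of the interpretation of the recursor. -/
def itr (σ : Ty) : Tm [] (σ.plus ⇒ (Ty.N ⇒ σ ⇒ σ).plus ⇒ Ty.N ⇒ σ.plus) :=
  lam (lam (lam (recN v2 (lam (lam (ap (ap v3 v1) v0))) v0)))

/-- The closed term `c⁺` of type `σ⁺` that interprets a constant `c` of type `σ`. -/
def Con.plus : {σ : Ty} → Con σ → Tm [] σ.plus
  | _, .k _ τ => mor (mor v1 (cl (dfl τ.minus))) (p2 v0)
  | _, .s _ _ ρ =>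
      mor
        (mor
          (mor (ap (ap v2 v0) (ap v1 v0))
            (cases
              (cl (tr ρ) ⬝ ap (ap v4 v2) (ap v3 v2) ⬝ ap (ap v4 v1) (ap v3 v1) ⬝
                ap (ap v4 v2) (ap v3 v1) ⬝ v0)
              (rf v4 v3 v2 (rf (ap v5 v3) (ap v4 v3) (ap v4 v2) v0))
              (cl (sy _) ⬝ v2 ⬝ v3 ⬝ rf v5 v2 v3 (pr (ap v4 v2) v0))))
          (pr (p1 v0)
            (rf (ap v3 (p1 v0)) (ap v2 (p1 v0)) (ap v1 (p1 v0)) (p2 v0))))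
        (pr (p1 (p2 v0)) (pr (ap (p1 v0) (p1 (p2 v0))) (p2 (p2 v0))))
  | _, .pair σ τ =>
      mor (mor (pr v1 v0) (cases v0 (cl (dfl τ.minus)) v0))
        (cases (p2 v0) v0 (cl (dfl σ.minus)))
  | _, .fst _ _ => mor (p1 v0) (il v0)
  | _, .snd _ _ => mor (p2 v0) (ir v0)
  | _, .inl _ _ => mor (il v0) (p1 v0)
  | _, .inr _ _ => mor (ir v0) (p2 v0)
  | _, .case σ τ ρ =>
      mor
        (mor
          (mor (cases v0 (ap v3 v0) (ap v2 v0))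
            (cases v2
              (cases v2 (pr (rf v6 v1 v0 v2) (cl (dfl τ.minus))) (cl (dfl (σ ⊞ τ).minus)))
              (cases v2 (cl (dfl (σ ⊞ τ).minus)) (pr (cl (dfl σ.minus)) (rf v5 v1 v0 v2)))))
          (cases (p1 v0) (cl (dfl (τ ⇒ ρ).minus)) (pr v0 (p2 v1))))
        (cases (p1 (p2 v0)) (pr v0 (p2 (p2 v1))) (cl (dfl (σ ⇒ ρ).minus)))
  | _, .zero => zro
  | _, .succ => mor (suc v0) v0
  | _, .iter σ =>
      mor
        (mor
          (mor (cl (itr σ) ⬝ v2 ⬝ v1 ⬝ v0) zro)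
          (recN (cl (dfl (σ.minus ⇒ (Ty.N ⇒ σ ⇒ σ).minus)))
            (lam (lam (lam
              (cases
                (cl (tr σ) ⬝ ap (ap v5 v2) (cl (itr σ) ⬝ v6 ⬝ v5 ⬝ v2) ⬝
                  ap (ap v4 v2) (cl (itr σ) ⬝ v6 ⬝ v4 ⬝ v2) ⬝
                  ap (ap v4 v2) (cl (itr σ) ⬝ v6 ⬝ v5 ⬝ v2) ⬝ v0)
                (pr v3 (pr (cl (itr σ) ⬝ v7 ⬝ v6 ⬝ v3) v0))
                (v2 ⬝ (cl (sy σ) ⬝ (cl (itr σ) ⬝ v7 ⬝ v5 ⬝ v3) ⬝ (cl (itr σ) ⬝ v7 ⬝ v6 ⬝ v3) ⬝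
                  rf (ap v5 v3) (cl (itr σ) ⬝ v7 ⬝ v5 ⬝ v3)
                    (cl (itr σ) ⬝ v7 ⬝ v6 ⬝ v3) v0))))))
            (p1 v0) ⬝ p2 v0))
        (recN (lam v0)
          (lam (lam (lam (v1 ⬝ rf (ap (p1 v3) v2)
            (cl (itr σ) ⬝ v5 ⬝ p1 v3 ⬝ v2) (cl (itr σ) ⬝ v4 ⬝ p1 v3 ⬝ v2) v0))))
          (p1 (p2 v0)) ⬝ p2 (p2 v0))

end Constants

def Var.plus : {Γ : List Ty} → {σ : Ty} → Var Γ σ → Var (Γ.map Ty.plus) σ.plus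
  | _, _, .zero => .zero
  | _, _, .succ x => .succ x.plus

def Tm.plus {Γ : List Ty} : {σ : Ty} → Tm Γ σ → Tm (Γ.map Ty.plus) σ.plus
  | _, .var x => .var x.plus
  | _, .con c => cl c.plus
  | _, .app t s => ap t.plus s.plus

/-- The interpretation `α`: quantifiers are relativized to `dom`, and two elements are equal
if there is no evidence that they are apart. -/
def Fm.alpha : {Γ : List Ty} → Fm Γ → Fm (Γ.map Ty.plus)
  | _, .eq (σ := σ) s t =>
      Fm.neg (.ex σ.minus ((apart σ).app (s.plus.wk σ.minus) (t.plus.wk σ.minus) v0))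
  | _, .bot => .bot
  | _, .and A B => A.alpha ⋏ B.alpha
  | _, .or A B => A.alpha ⋎ B.alpha
  | _, .imp A B => A.alpha ⇛ B.alpha
  | _, .all σ A => .all σ.plus ((apart σ).dom v0 ⇛ A.alpha)
  | _, .ex σ A => .ex σ.plus ((apart σ).dom v0 ⋏ A.alpha)

end EHA

-- Derivability in EHA is replaced by truth in one generic model, and both interpretations become
-- constructions on models with truth values in a frame. The elements of `generic` are terms with
-- parameters modulo provable equality, and its truth values are sets of assumption lists that are
-- closed under derivability. The value of a formula is the set of the assumption lists that derive
-- it (`generic.sem_env`), so a sentence with value `⊤` is derivable (`generic.prov_of_sem`).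
--
-- Apartness: over a model `M` with total elements and strict equality, the elements of the types
-- `σ⁺` form a structure `M.alpha`, with extent `dom` and with equality "there is no evidence of
-- apartness". Truth of `A` in `M.alpha` is truth of the translation of `A` in `M` (`sem_alpha`).
-- This structure is again a model of EHA: apartness is irreflexive, symmetric and cotransitive
-- (`ap_irrefl`, `ap_sy`, `ap_tr`), and every function carries a functional that pulls apartness of
-- values back to apartness of arguments, so that application respects equality. The lifted
-- constants must carry such functionals too (`dm_con`); for `s` and the recursor, where function
-- and argument vary together, cotransitivity supplies them.
--
-- Converse extensionality: the functional carried by `Φ` turns `Φ f ≠ Φ g` into a point where `f`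
-- and `g` differ. This is nearly a witness for CE₀, but a witness has to reflect apartness itself,
-- and the point may depend on how `Φ`, `f` and `g` are represented. The least point of difference,
-- found by a search bounded by the given one, has no such dependence (`diffAp_congr`), and it
-- yields an element of the apartness model (`dm_convExt`).
--
-- Realizability: in any model with a witness `X` of CE₀, whatever EHA + CE₀ + AC + IP derives is
-- realized by a term that may mention `X` (`Situation.realizes_of_prov`). A realizer of `∀ x ∃ y`
-- already contains a choice function, which gives AC; whether an object realizes a negation does
-- not depend on the object, which gives IP. In `generic.alpha` the closed term `convExt` is
-- substituted for `X`, and the result is the required closed term of type `|A|⁺`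
-- (`exists_realizer`).

set_option linter.unusedSectionVars false

namespace EHA

/-! ### Structures with truth values in a frame -/

/-- A structure for the language of finite types, with an extent predicate `dom` and an equality
predicate `eq`, both with values in `H`. -/
structure Str (H : Type) where
  D : Ty → Type
  ap : {σ τ : Ty} → D (σ ⇒ τ) → D σ → D τ
  con : {σ : Ty} → Con σ → D σ
  dom : {σ : Ty} → D σ → H
  eq : {σ : Ty} → D σ → D σ → H

infixl:80 " ⋆ " => EHA.Str.ap _

namespace Str

/-- Assignments of elements to the variables of a context. -/
def Env {H : Type} (M : Str H) (Γ : List Ty) : Type := ∀ σ : Ty, Var Γ σ → M.D σ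

section Basic

variable {H : Type} {M : Str H} {Γ Δ : List Ty} {σ τ ρ : Ty}

def Env.nil : M.Env [] := fun _ x => by cases x

def Env.cons (γ : M.Env Γ) (d : M.D σ) : M.Env (σ :: Γ)
  | _, .zero => d
  | _, .succ x => γ _ x

@[simp] theorem Env.cons_zero (γ : M.Env Γ) (d : M.D σ) : γ.cons d σ .zero = d := rfl

@[simp] theorem Env.cons_succ (γ : M.Env Γ) (d : M.D σ) (x : Var Γ τ) :
    γ.cons d τ (.succ x) = γ τ x := rfl

theorem Env.eq_nil (γ : M.Env []) : γ = Env.nil := by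
  funext σ x; cases x

def eval (γ : M.Env Γ) : {σ : Ty} → Tm Γ σ → M.D σ
  | _, .var x => γ _ x
  | _, .con c => M.con c
  | _, .app t s => eval γ t ⋆ eval γ s

/-- The value of a closed term. -/
def val (M : Str H) (t : Tm [] σ) : M.D σ := eval Env.nil t

/-- The environment that interprets a substitution. -/
def evalSub (γ : M.Env Δ) (θ : Sub Γ Δ) : M.Env Γ := fun σ x => eval γ (θ σ x)

@[simp] theorem eval_var (γ : M.Env Γ) (x : Var Γ σ) : eval γ (.var x) = γ _ x := rfl
@[simp] theorem eval_con (γ : M.Env Γ) (c : Con σ) : eval γ (.con c) = M.con c := rfl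
@[simp] theorem eval_app (γ : M.Env Γ) (t : Tm Γ (σ ⇒ τ)) (s : Tm Γ σ) :
    eval γ (t ⬝ s) = eval γ t ⋆ eval γ s := rfl

theorem eval_subst (γ : M.Env Δ) (θ : Sub Γ Δ) (t : Tm Γ σ) :
    eval γ (t.subst θ) = eval (evalSub γ θ) t := by
  induction t with
  | var x => rfl
  | con c => rfl
  | app t s iht ihs => simp only [Tm.subst, eval_app, iht, ihs]

@[simp] theorem evalSub_shift (γ : M.Env Γ) (d : M.D σ) :
    evalSub (γ.cons d) (Sub.shift Γ σ) = γ := rfl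

@[simp] theorem evalSub_id (γ : M.Env Γ) : evalSub γ (Sub.id Γ) = γ := rfl

@[simp] theorem evalSub_cons (γ : M.Env Δ) (θ : Sub Γ Δ) (t : Tm Δ σ) :
    evalSub γ (θ.cons t) = (evalSub γ θ).cons (eval γ t) := by
  funext τ x; cases x <;> rfl

@[simp] theorem eval_wk (γ : M.Env Γ) (d : M.D τ) (t : Tm Γ σ) :
    eval (γ.cons d) (t.wk τ) = eval γ t := by
  rw [Tm.wk, eval_subst]; rfl

@[simp] theorem evalSub_wk (γ : M.Env Δ) (d : M.D τ) (θ : Sub Γ Δ) :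
    evalSub (γ.cons d) (θ.wk τ) = evalSub γ θ := by
  funext σ x; exact eval_wk γ d (θ σ x)

@[simp] theorem evalSub_lift (γ : M.Env Δ) (d : M.D τ) (θ : Sub Γ Δ) :
    evalSub (γ.cons d) (θ.lift τ) = (evalSub γ θ).cons d := by
  rw [Sub.lift, evalSub_cons, evalSub_wk]; rfl

@[simp] theorem eval_cl (γ : M.Env Γ) (t : Tm [] σ) : eval γ (cl t) = M.val t := by
  rw [cl, eval_subst, Env.eq_nil (evalSub _ _)]; rfl

def zro : M.D Ty.N := M.con .zero
def suc (n : M.D Ty.N) : M.D Ty.N := M.con .succ ⋆ n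
def pair (a : M.D σ) (b : M.D τ) : M.D (σ ⊠ τ) := M.con (.pair σ τ) ⋆ a ⋆ b
def fst (x : M.D (σ ⊠ τ)) : M.D σ := M.con (.fst σ τ) ⋆ x
def snd (x : M.D (σ ⊠ τ)) : M.D τ := M.con (.snd σ τ) ⋆ x
def inl (a : M.D σ) : M.D (σ ⊞ τ) := M.con (.inl σ τ) ⋆ a
def inr (b : M.D τ) : M.D (σ ⊞ τ) := M.con (.inr σ τ) ⋆ b
def case (f : M.D (σ ⇒ ρ)) (g : M.D (τ ⇒ ρ)) (x : M.D (σ ⊞ τ)) : M.D ρ :=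
  M.con (.case σ τ ρ) ⋆ f ⋆ g ⋆ x
def iter (a : M.D σ) (b : M.D (Ty.N ⇒ σ ⇒ σ)) (n : M.D Ty.N) : M.D σ :=
  M.con (.iter σ) ⋆ a ⋆ b ⋆ n

@[simp] theorem eval_zro (γ : M.Env Γ) : eval γ EHA.zro = zro := rfl
@[simp] theorem eval_suc (γ : M.Env Γ) (t : Tm Γ Ty.N) :
    eval γ (EHA.suc t) = suc (eval γ t) := rfl
@[simp] theorem eval_pr (γ : M.Env Γ) (a : Tm Γ σ) (b : Tm Γ τ) :
    eval γ (pr a b) = pair (eval γ a) (eval γ b) := rfl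
@[simp] theorem eval_p1 (γ : M.Env Γ) (a : Tm Γ (σ ⊠ τ)) : eval γ (p1 a) = fst (eval γ a) := rfl
@[simp] theorem eval_p2 (γ : M.Env Γ) (a : Tm Γ (σ ⊠ τ)) : eval γ (p2 a) = snd (eval γ a) := rfl
@[simp] theorem eval_il (γ : M.Env Γ) (a : Tm Γ σ) :
    eval γ (il a : Tm Γ (σ ⊞ τ)) = inl (eval γ a) := rfl
@[simp] theorem eval_ir (γ : M.Env Γ) (a : Tm Γ τ) :
    eval γ (ir a : Tm Γ (σ ⊞ τ)) = inr (eval γ a) := rfl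
@[simp] theorem eval_recN (γ : M.Env Γ) (a : Tm Γ σ) (b : Tm Γ (Ty.N ⇒ σ ⇒ σ)) (n : Tm Γ Ty.N) :
    eval γ (recN a b n) = iter (eval γ a) (eval γ b) (eval γ n) := rfl
@[simp] theorem eval_cases (γ : M.Env Γ) (x : Tm Γ (σ ⊞ τ)) (a : Tm (σ :: Γ) ρ)
    (b : Tm (τ :: Γ) ρ) :
    eval γ (cases x a b) = case (eval γ (lam a)) (eval γ (lam b)) (eval γ x) := rfl

section Vars

variable {σ₀ σ₁ σ₂ σ₃ σ₄ σ₅ σ₆ σ₇ : Ty} (γ : M.Env Γ) (d₀ : M.D σ₀) (d₁ : M.D σ₁) (d₂ : M.D σ₂)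
  (d₃ : M.D σ₃) (d₄ : M.D σ₄) (d₅ : M.D σ₅) (d₆ : M.D σ₆) (d₇ : M.D σ₇)

@[simp] theorem eval_v0 : eval (γ.cons d₀) v0 = d₀ := rfl
@[simp] theorem eval_v1 : eval ((γ.cons d₁).cons d₀) v1 = d₁ := rfl
@[simp] theorem eval_v2 : eval (((γ.cons d₂).cons d₁).cons d₀) v2 = d₂ := rfl
@[simp] theorem eval_v3 : eval ((((γ.cons d₃).cons d₂).cons d₁).cons d₀) v3 = d₃ := rfl
@[simp] theorem eval_v4 : eval (((((γ.cons d₄).cons d₃).cons d₂).cons d₁).cons d₀) v4 = d₄ := rfl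
@[simp] theorem eval_v5 :
    eval ((((((γ.cons d₅).cons d₄).cons d₃).cons d₂).cons d₁).cons d₀) v5 = d₅ := rfl
@[simp] theorem eval_v6 :
    eval (((((((γ.cons d₆).cons d₅).cons d₄).cons d₃).cons d₂).cons d₁).cons d₀) v6 = d₆ := rfl
@[simp] theorem eval_v7 :
    eval ((((((((γ.cons d₇).cons d₆).cons d₅).cons d₄).cons d₃).cons d₂).cons d₁).cons d₀) v7
      = d₇ := rfl

end Vars

end Basic

/-! ### Truth values of formulas -/

section Sem

variable {H : Type} [Order.Frame H] {M : Str H} {Γ Δ : List Ty} {σ τ ρ : Ty}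

/-- The truth value of a formula; quantifiers are relativized to the extent predicate. -/
def sem : {Γ : List Ty} → Fm Γ → M.Env Γ → H
  | _, .eq s t, γ => M.eq (eval γ s) (eval γ t)
  | _, .bot, _ => ⊥
  | _, .and A B, γ => sem A γ ⊓ sem B γ
  | _, .or A B, γ => sem A γ ⊔ sem B γ
  | _, .imp A B, γ => sem A γ ⇨ sem B γ
  | _, .all _ A, γ => ⨅ d, M.dom d ⇨ sem A (γ.cons d)
  | _, .ex _ A, γ => ⨆ d, M.dom d ⊓ sem A (γ.cons d)

@[simp] theorem sem_eq (γ : M.Env Γ) (s t : Tm Γ σ) :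
    sem (s ≐ t) γ = M.eq (eval γ s) (eval γ t) := rfl
@[simp] theorem sem_bot (γ : M.Env Γ) : sem .bot γ = ⊥ := rfl
@[simp] theorem sem_and (γ : M.Env Γ) (A B : Fm Γ) : sem (A ⋏ B) γ = sem A γ ⊓ sem B γ := rfl
@[simp] theorem sem_or (γ : M.Env Γ) (A B : Fm Γ) : sem (A ⋎ B) γ = sem A γ ⊔ sem B γ := rfl
@[simp] theorem sem_imp (γ : M.Env Γ) (A B : Fm Γ) : sem (A ⇛ B) γ = sem A γ ⇨ sem B γ := rfl
@[simp] theorem sem_all (γ : M.Env Γ) (A : Fm (σ :: Γ)) :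
    sem (.all σ A) γ = ⨅ d, M.dom d ⇨ sem A (γ.cons d) := rfl
@[simp] theorem sem_ex (γ : M.Env Γ) (A : Fm (σ :: Γ)) :
    sem (.ex σ A) γ = ⨆ d, M.dom d ⊓ sem A (γ.cons d) := rfl
@[simp] theorem sem_neg (γ : M.Env Γ) (A : Fm Γ) : sem A.neg γ = (sem A γ)ᶜ := himp_bot _

theorem sem_subst (A : Fm Γ) (θ : Sub Γ Δ) (γ : M.Env Δ) :
    sem (A.subst θ) γ = sem A (evalSub γ θ) := by
  induction A generalizing Δ with
  | eq s t => simp only [Fm.subst, sem_eq, eval_subst]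
  | bot => rfl
  | and A B ihA ihB => simp only [Fm.subst, sem_and, ihA, ihB]
  | or A B ihA ihB => simp only [Fm.subst, sem_or, ihA, ihB]
  | imp A B ihA ihB => simp only [Fm.subst, sem_imp, ihA, ihB]
  | all σ A ih => simp only [Fm.subst, sem_all, ih, evalSub_lift]
  | ex σ A ih => simp only [Fm.subst, sem_ex, ih, evalSub_lift]

@[simp] theorem sem_inst (A : Fm (σ :: Γ)) (t : Tm Γ σ) (γ : M.Env Γ) :
    sem (A.inst t) γ = sem A (γ.cons (eval γ t)) := by
  rw [Fm.inst, sem_subst, evalSub_cons, evalSub_id]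

end Sem

end Str

/-! ### Forcing in a frame -/

section Forcing

variable {H : Type} [Order.Frame H] {p a b c : H} {ι : Type}

/-- Read `p ≤ a` as "`p` forces `a`". The rules of this section are natural deduction in that
reading: a hypothesis is introduced by passing to some `q ≤ p` that forces it. Distributivity of the
frame justifies the elimination of disjunctions and of existential quantifiers. -/
theorem forces_himp (h : ∀ q ≤ p, q ≤ a → q ≤ b) : p ≤ a ⇨ b :=
  le_himp_iff.2 (h _ inf_le_left inf_le_right)

theorem forces_compl (h : ∀ q ≤ p, q ≤ a → q ≤ ⊥) : p ≤ aᶜ := by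
  rw [← himp_bot]; exact forces_himp h

theorem forces_mp (h : p ≤ a ⇨ b) (ha : p ≤ a) : p ≤ b :=
  (le_inf h ha).trans himp_inf_le

theorem forces_absurd (h : p ≤ aᶜ) (ha : p ≤ a) : p ≤ b :=
  (forces_mp (by rwa [himp_bot]) ha).trans bot_le

theorem forces_or (h : p ≤ a ⊔ b) (ha : ∀ q ≤ p, q ≤ a → q ≤ c) (hb : ∀ q ≤ p, q ≤ b → q ≤ c) :
    p ≤ c :=
  calc p ≤ p ⊓ (a ⊔ b) := le_inf le_rfl h
    _ = p ⊓ a ⊔ p ⊓ b := inf_sup_left ..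
    _ ≤ c := sup_le (ha _ inf_le_left inf_le_right) (hb _ inf_le_left inf_le_right)

theorem forces_ex {f : ι → H} (h : p ≤ ⨆ i, f i) (hf : ∀ i, ∀ q ≤ p, q ≤ f i → q ≤ c) : p ≤ c :=
  calc p ≤ p ⊓ ⨆ i, f i := le_inf le_rfl h
    _ = ⨆ i, p ⊓ f i := inf_iSup_eq ..
    _ ≤ c := iSup_le fun i => hf i _ inf_le_left inf_le_right

theorem forces_all {f : ι → H} (h : p ≤ ⨅ i, f i) (i : ι) : p ≤ f i := h.trans (iInf_le f i)

theorem forces_exists {f : ι → H} (i : ι) (h : p ≤ f i) : p ≤ ⨆ i, f i := le_iSup_of_le i h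

theorem forces_iff (h : ∀ q, q ≤ a ↔ q ≤ b) : a = b :=
  le_antisymm ((h a).1 le_rfl) ((h b).2 le_rfl)

end Forcing

/-! ### Models of extensional arithmetic -/

namespace Str

variable {H : Type} [Order.Frame H]

/-- `M` is a model of `EHA` in which the defining equations of the constants hold strictly. -/
class IsModel (M : Str H) : Prop where
  dom_con {σ : Ty} (c : Con σ) : ⊤ ≤ M.dom (M.con c)
  dom_ap {σ τ : Ty} {f : M.D (σ ⇒ τ)} {a : M.D σ} {p : H} :
    p ≤ M.dom f → p ≤ M.dom a → p ≤ M.dom (f ⋆ a)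
  k {σ τ : Ty} (a : M.D σ) (b : M.D τ) : M.con (.k σ τ) ⋆ a ⋆ b = a
  s {σ τ ρ : Ty} (a : M.D (σ ⇒ τ ⇒ ρ)) (b : M.D (σ ⇒ τ)) (c : M.D σ) :
    M.con (.s σ τ ρ) ⋆ a ⋆ b ⋆ c = a ⋆ c ⋆ (b ⋆ c)
  fst_pair {σ τ : Ty} (a : M.D σ) (b : M.D τ) : fst (pair a b) = a
  snd_pair {σ τ : Ty} (a : M.D σ) (b : M.D τ) : snd (pair a b) = b
  case_inl {σ τ ρ : Ty} (f : M.D (σ ⇒ ρ)) (g : M.D (τ ⇒ ρ)) (a : M.D σ) :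
    case f g (inl a) = f ⋆ a
  case_inr {σ τ ρ : Ty} (f : M.D (σ ⇒ ρ)) (g : M.D (τ ⇒ ρ)) (b : M.D τ) :
    case f g (inr b) = g ⋆ b
  iter_zro {σ : Ty} (a : M.D σ) (b : M.D (Ty.N ⇒ σ ⇒ σ)) : iter a b zro = a
  iter_suc {σ : Ty} (a : M.D σ) (b : M.D (Ty.N ⇒ σ ⇒ σ)) (n : M.D Ty.N) :
    iter a b (suc n) = b ⋆ n ⋆ iter a b n
  eq_refl {σ : Ty} {a : M.D σ} {p : H} : p ≤ M.dom a → p ≤ M.eq a a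
  eq_symm {σ : Ty} {a b : M.D σ} {p : H} :
    p ≤ M.dom a → p ≤ M.dom b → p ≤ M.eq a b → p ≤ M.eq b a
  eq_trans {σ : Ty} {a b c : M.D σ} {p : H} : p ≤ M.dom a → p ≤ M.dom b → p ≤ M.dom c →
    p ≤ M.eq a b → p ≤ M.eq b c → p ≤ M.eq a c
  eq_ap {σ τ : Ty} {f g : M.D (σ ⇒ τ)} {a b : M.D σ} {p : H} :
    p ≤ M.dom f → p ≤ M.dom g → p ≤ M.dom a → p ≤ M.dom b →
    p ≤ M.eq f g → p ≤ M.eq a b → p ≤ M.eq (f ⋆ a) (g ⋆ b)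
  suc_ne_zro {n : M.D Ty.N} {p : H} : p ≤ M.dom n → p ≤ M.eq (suc n) zro → p ≤ ⊥
  suc_inj {m n : M.D Ty.N} {p : H} : p ≤ M.dom m → p ≤ M.dom n →
    p ≤ M.eq (suc m) (suc n) → p ≤ M.eq m n
  ind {Γ : List Ty} (A : Fm (Ty.N :: Γ)) (γ : M.Env Γ) {p : H} :
    (∀ σ x, p ≤ M.dom (γ σ x)) → p ≤ sem A (γ.cons zro) →
    (∀ n, ∀ q ≤ p, q ≤ M.dom n → q ≤ sem A (γ.cons n) → q ≤ sem A (γ.cons (suc n))) →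
    ∀ n, p ≤ M.dom n → p ≤ sem A (γ.cons n)
  ext_arr {σ τ : Ty} {f g : M.D (σ ⇒ τ)} {p : H} : p ≤ M.dom f → p ≤ M.dom g →
    (∀ x, ∀ q ≤ p, q ≤ M.dom x → q ≤ M.eq (f ⋆ x) (g ⋆ x)) → p ≤ M.eq f g
  ext_prod {σ τ : Ty} {x : M.D (σ ⊠ τ)} {p : H} : p ≤ M.dom x → p ≤ M.eq (pair (fst x) (snd x)) x
  ext_sum {σ τ : Ty} {x : M.D (σ ⊞ τ)} {p : H} : p ≤ M.dom x →
    p ≤ (⨆ u, M.dom u ⊓ M.eq x (inl u)) ⊔ ⨆ v, M.dom v ⊓ M.eq x (inr v)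

attribute [simp] IsModel.k IsModel.s IsModel.fst_pair IsModel.snd_pair IsModel.case_inl
  IsModel.case_inr IsModel.iter_zro IsModel.iter_suc

variable {M : Str H} [IsModel M] {Γ Δ : List Ty} {σ τ : Ty} {p q : H}

theorem lam_ap' (γ : M.Env Γ) (d : M.D σ) :
    {τ : Ty} → (t : Tm (σ :: Γ) τ) → eval γ (lam t) ⋆ d = eval (γ.cons d) t
  | _, .var .zero => by simp [lam]
  | _, .var (.succ x) => by simp [lam]
  | _, .con c => by simp [lam]
  | _, .app t s => by simp [lam, lam_ap' γ d t, lam_ap' γ d s]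

-- The β-rule is an identity of elements, because the equations of `k` and `s` hold strictly in
-- `IsModel`. Explicit terms can therefore be computed by `simp`, without transport along an
-- equality with values in `H`.
@[simp] theorem lam_ap (γ : M.Env Γ) (t : Tm (σ :: Γ) τ) (d : M.D σ) :
    eval γ (lam t) ⋆ d = eval (γ.cons d) t := lam_ap' γ d t

theorem dom_con' (c : Con σ) : p ≤ M.dom (M.con c) := le_top.trans (IsModel.dom_con c)

theorem dom_eval {γ : M.Env Γ} (h : ∀ σ x, p ≤ M.dom (γ σ x)) (t : Tm Γ σ) :
    p ≤ M.dom (eval γ t) := by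
  induction t with
  | var x => exact h _ x
  | con c => exact dom_con' c
  | app t s iht ihs => exact IsModel.dom_ap iht ihs

theorem dom_val (t : Tm [] σ) : p ≤ M.dom (M.val t) :=
  dom_eval (fun _ x => by cases x) t

theorem dom_cons {γ : M.Env Γ} {d : M.D σ} (h : ∀ σ x, p ≤ M.dom (γ σ x)) (hd : p ≤ M.dom d) :
    ∀ τ x, p ≤ M.dom (γ.cons d τ x)
  | _, .zero => hd
  | _, .succ x => h _ x

/-- Two assignments are equal and total with truth value at least `p`. -/
structure Agree (p : H) (γ δ : M.Env Γ) : Prop where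
  left (σ : Ty) (x : Var Γ σ) : p ≤ M.dom (γ σ x)
  right (σ : Ty) (x : Var Γ σ) : p ≤ M.dom (δ σ x)
  eq (σ : Ty) (x : Var Γ σ) : p ≤ M.eq (γ σ x) (δ σ x)

theorem Agree.mono {γ δ : M.Env Γ} (h : Agree p γ δ) (hq : q ≤ p) : Agree q γ δ :=
  ⟨fun _ x => hq.trans (h.left _ x), fun _ x => hq.trans (h.right _ x),
    fun _ x => hq.trans (h.eq _ x)⟩

theorem Agree.symm {γ δ : M.Env Γ} (h : Agree p γ δ) : Agree p δ γ :=
  ⟨h.right, h.left, fun _ x => IsModel.eq_symm (h.left _ x) (h.right _ x) (h.eq _ x)⟩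

theorem Agree.refl {γ : M.Env Γ} (h : ∀ σ x, p ≤ M.dom (γ σ x)) : Agree p γ γ :=
  ⟨h, h, fun _ x => IsModel.eq_refl (h _ x)⟩

theorem Agree.cons {γ δ : M.Env Γ} (h : Agree p γ δ) {d e : M.D σ} (hd : p ≤ M.dom d)
    (he : p ≤ M.dom e) (hde : p ≤ M.eq d e) : Agree p (γ.cons d) (δ.cons e) where
  left := dom_cons h.left hd
  right := dom_cons h.right he
  eq
    | _, .zero => hde
    | _, .succ x => h.eq _ x

theorem Agree.eval {γ δ : M.Env Γ} (h : Agree p γ δ) (t : Tm Γ σ) :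
    p ≤ M.eq (eval γ t) (eval δ t) := by
  induction t with
  | var x => exact h.eq _ x
  | con c => exact IsModel.eq_refl (dom_con' c)
  | app t s iht ihs =>
    exact IsModel.eq_ap (dom_eval h.left t) (dom_eval h.right t) (dom_eval h.left s)
      (dom_eval h.right s) iht ihs

/-- Equality in the apartness model is not identity, so that substitution of equals has to be proved
by induction on the formula. Implications use the symmetry of agreement to carry the premise back.
-/
theorem Agree.sem {A : Fm Γ} {γ δ : M.Env Γ} (h : Agree p γ δ) (hA : p ≤ sem A γ) :
    p ≤ sem A δ := by
  induction A generalizing p with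
  | eq s t =>
    refine IsModel.eq_trans (dom_eval h.right s) (dom_eval h.left s) (dom_eval h.right t)
      (h.symm.eval s) ?_
    exact IsModel.eq_trans (dom_eval h.left s) (dom_eval h.left t) (dom_eval h.right t) hA
      (h.eval t)
  | bot => exact hA
  | and A B ihA ihB => exact le_inf (ihA h (hA.trans inf_le_left)) (ihB h (hA.trans inf_le_right))
  | or A B ihA ihB =>
    exact forces_or hA (fun q hq hA => (ihA (h.mono hq) hA).trans le_sup_left)
      (fun q hq hB => (ihB (h.mono hq) hB).trans le_sup_right)
  | imp A B ihA ihB =>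
    exact forces_himp fun q hq ha =>
      ihB (h.mono hq) (forces_mp (hq.trans hA) (ihA (h.mono hq).symm ha))
  | all σ A ih =>
    refine le_iInf fun d => forces_himp fun q hq hd => ?_
    exact ih ((h.mono hq).cons hd hd (IsModel.eq_refl hd)) (forces_mp (hq.trans (forces_all hA d)) hd)
  | ex σ A ih =>
    refine forces_ex hA fun d q hq hd => forces_exists d ?_
    have hd' := hd.trans inf_le_left
    exact le_inf hd' (ih ((h.mono hq).cons hd' hd' (IsModel.eq_refl hd')) (hd.trans inf_le_right))

end Str
end EHA

namespace EHA

/-! ### Semantic modified realizability -/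

/-- Terms do not occur in the type of realizers. The equality is not definitional, which is the
reason for the heterogeneous equalities between realizers in what follows. -/
theorem Fm.rty_subst {Γ Δ : List Ty} (A : Fm Γ) (θ : Sub Γ Δ) : (A.subst θ).rty = A.rty := by
  induction A generalizing Δ with
  | eq s t => rfl
  | bot => rfl
  | and A B ihA ihB => simp only [Fm.subst, Fm.rty, ihA, ihB]
  | or A B ihA ihB => simp only [Fm.subst, Fm.rty, ihA, ihB]
  | imp A B ihA ihB => simp only [Fm.subst, Fm.rty, ihA, ihB]
  | all σ A ih => simp only [Fm.subst, Fm.rty, ih]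
  | ex σ A ih => simp only [Fm.subst, Fm.rty, ih]

namespace Str

variable {H : Type} [Order.Frame H] {M : Str H} {Γ Δ Ω : List Ty} {σ τ : Ty} {p q : H}

/-- The truth value of `r mr A`. -/
def rel : {Γ : List Ty} → (A : Fm Γ) → M.Env Γ → M.D A.rty → H
  | _, .eq s t, γ, _ => M.eq (eval γ s) (eval γ t)
  | _, .bot, _, _ => ⊥
  | _, .and A B, γ, r => rel A γ (fst r) ⊓ rel B γ (snd r)
  | _, .or A B, γ, r =>
      (⨆ u, M.dom u ⊓ (M.eq r (inl u) ⊓ rel A γ u)) ⊔ ⨆ u, M.dom u ⊓ (M.eq r (inr u) ⊓ rel B γ u)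
  | _, .imp A B, γ, r => ⨅ u, M.dom u ⇨ (rel A γ u ⇨ rel B γ (r ⋆ u))
  | _, .all _ A, γ, r => ⨅ d, M.dom d ⇨ rel A (γ.cons d) (r ⋆ d)
  | _, .ex _ A, γ, r => rel A (γ.cons (fst r)) (snd r)

theorem sem_mr (A : Fm Γ) (θ : Sub Γ Δ) (r : Tm Δ A.rty) (γ : M.Env Δ) :
    sem (A.mr θ r) γ = rel A (evalSub γ θ) (eval γ r) := by
  induction A generalizing Δ with
  | eq s t => simp [Fm.mr, rel, eval_subst]
  | bot => rfl
  | and A B ihA ihB => simp [Fm.mr, rel, ihA, ihB]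
  | or A B ihA ihB => simp [Fm.mr, rel, ihA, ihB]
  | imp A B ihA ihB => simp [Fm.mr, rel, ihA, ihB]
  | all σ A ih => simp [Fm.mr, rel, ih]
  | ex σ A ih => simp [Fm.mr, rel, ih]

theorem rel_subst (A : Fm Γ) (θ : Sub Γ Δ) : ∀ (γ : M.Env Δ) (r : M.D (A.subst θ).rty)
    (r' : M.D A.rty), HEq r r' → rel (A.subst θ) γ r = rel A (evalSub γ θ) r' := by
  induction A generalizing Δ with
  | eq s t => intro γ _ _ _; simp only [Fm.subst, rel, eval_subst]
  | bot => intros; rfl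
  | and A B ihA ihB =>
    have hA := A.rty_subst θ
    have hB := B.rty_subst θ
    have ihA := ihA θ
    have ihB := ihB θ
    change ∀ (γ : M.Env Δ) (r : M.D ((A.subst θ).rty ⊠ (B.subst θ).rty)) (r' : M.D _), HEq r r' →
      rel (A.subst θ) γ (fst r) ⊓ rel (B.subst θ) γ (snd r) =
        rel A (evalSub γ θ) (fst r') ⊓ rel B (evalSub γ θ) (snd r')
    -- The predicates and their realizer types are abstracted together. The equations between types
    -- then have a variable on one side and can be eliminated by `subst`.
    generalize rel (M := M) (A.subst θ) = RA at *
    generalize rel (M := M) (B.subst θ) = RB at *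
    generalize (A.subst θ).rty = α at *
    generalize (B.subst θ).rty = β at *
    subst hA hB
    rintro γ r _ ⟨⟩
    rw [ihA _ _ _ HEq.rfl, ihB _ _ _ HEq.rfl]
  | or A B ihA ihB =>
    have hA := A.rty_subst θ
    have hB := B.rty_subst θ
    have ihA := ihA θ
    have ihB := ihB θ
    change ∀ (γ : M.Env Δ) (r : M.D ((A.subst θ).rty ⊞ (B.subst θ).rty)) (r' : M.D _), HEq r r' →
      (⨆ u, M.dom u ⊓ (M.eq r (inl u) ⊓ rel (A.subst θ) γ u)) ⊔
        (⨆ u, M.dom u ⊓ (M.eq r (inr u) ⊓ rel (B.subst θ) γ u)) =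
      (⨆ u, M.dom u ⊓ (M.eq r' (inl u) ⊓ rel A (evalSub γ θ) u)) ⊔
        (⨆ u, M.dom u ⊓ (M.eq r' (inr u) ⊓ rel B (evalSub γ θ) u))
    generalize rel (M := M) (A.subst θ) = RA at *
    generalize rel (M := M) (B.subst θ) = RB at *
    generalize (A.subst θ).rty = α at *
    generalize (B.subst θ).rty = β at *
    subst hA hB
    rintro γ r _ ⟨⟩
    simp only [ihA _ _ _ HEq.rfl, ihB _ _ _ HEq.rfl]
  | imp A B ihA ihB =>
    have hA := A.rty_subst θ
    have hB := B.rty_subst θ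
    have ihA := ihA θ
    have ihB := ihB θ
    change ∀ (γ : M.Env Δ) (r : M.D ((A.subst θ).rty ⇒ (B.subst θ).rty)) (r' : M.D _), HEq r r' →
      (⨅ u, M.dom u ⇨ (rel (A.subst θ) γ u ⇨ rel (B.subst θ) γ (r ⋆ u))) =
      ⨅ u, M.dom u ⇨ (rel A (evalSub γ θ) u ⇨ rel B (evalSub γ θ) (r' ⋆ u))
    generalize rel (M := M) (A.subst θ) = RA at *
    generalize rel (M := M) (B.subst θ) = RB at *
    generalize (A.subst θ).rty = α at *
    generalize (B.subst θ).rty = β at *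
    subst hA hB
    rintro γ r _ ⟨⟩
    simp only [ihA _ _ _ HEq.rfl, ihB _ _ _ HEq.rfl]
  | all σ A ih =>
    have hA := A.rty_subst (θ.lift σ)
    have ih := ih (θ.lift σ)
    change ∀ (γ : M.Env Δ) (r : M.D (σ ⇒ (A.subst (θ.lift σ)).rty)) (r' : M.D _), HEq r r' →
      (⨅ d, M.dom d ⇨ rel (A.subst (θ.lift σ)) (γ.cons d) (r ⋆ d)) =
      ⨅ d, M.dom d ⇨ rel A ((evalSub γ θ).cons d) (r' ⋆ d)
    generalize rel (M := M) (A.subst (θ.lift σ)) = RA at *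
    generalize (A.subst (θ.lift σ)).rty = α at *
    subst hA
    rintro γ r _ ⟨⟩
    simp only [ih _ _ _ HEq.rfl, evalSub_lift]
  | ex σ A ih =>
    have hA := A.rty_subst (θ.lift σ)
    have ih := ih (θ.lift σ)
    change ∀ (γ : M.Env Δ) (r : M.D (σ ⊠ (A.subst (θ.lift σ)).rty)) (r' : M.D _), HEq r r' →
      rel (A.subst (θ.lift σ)) (γ.cons (fst r)) (snd r) =
      rel A ((evalSub γ θ).cons (fst r')) (snd r')
    generalize rel (M := M) (A.subst (θ.lift σ)) = RA at *
    generalize (A.subst (θ.lift σ)).rty = α at *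
    subst hA
    rintro γ r _ ⟨⟩
    simp only [ih _ _ _ HEq.rfl, evalSub_lift]

theorem forces_all_dom {F : M.D σ → H} (h : ∀ d, ∀ q ≤ p, q ≤ M.dom d → q ≤ F d) :
    p ≤ ⨅ d, M.dom d ⇨ F d :=
  le_iInf fun d => forces_himp (h d)

theorem forces_all_dom_elim {F : M.D σ → H} (h : p ≤ ⨅ d, M.dom d ⇨ F d) {d : M.D σ}
    (hd : p ≤ M.dom d) : p ≤ F d :=
  forces_mp (forces_all h d) hd

theorem forces_ex_dom {F : M.D σ → H} {c : H} (h : p ≤ ⨆ d, M.dom d ⊓ F d)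
    (hc : ∀ d, ∀ q ≤ p, q ≤ M.dom d → q ≤ F d → q ≤ c) : p ≤ c :=
  forces_ex h fun d q hq hd => hc d q hq (hd.trans inf_le_left) (hd.trans inf_le_right)

theorem forces_ex_dom_intro {F : M.D σ → H} (d : M.D σ) (hd : p ≤ M.dom d) (h : p ≤ F d) :
    p ≤ ⨆ d, M.dom d ⊓ F d :=
  forces_exists d (le_inf hd h)

variable [IsModel M]

section Rules

variable {ρ : Ty}

theorem dom_pair {a : M.D σ} {b : M.D τ} (ha : p ≤ M.dom a) (hb : p ≤ M.dom b) :
    p ≤ M.dom (pair a b) := IsModel.dom_ap (IsModel.dom_ap (dom_con' _) ha) hb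
theorem dom_inl {a : M.D σ} (h : p ≤ M.dom a) : p ≤ M.dom (inl (τ := τ) a) :=
  IsModel.dom_ap (dom_con' _) h
theorem dom_inr {a : M.D τ} (h : p ≤ M.dom a) : p ≤ M.dom (inr (σ := σ) a) :=
  IsModel.dom_ap (dom_con' _) h
theorem dom_case {f : M.D (σ ⇒ ρ)} {g : M.D (τ ⇒ ρ)} {x : M.D (σ ⊞ τ)} (hf : p ≤ M.dom f)
    (hg : p ≤ M.dom g) (h : p ≤ M.dom x) : p ≤ M.dom (case f g x) :=
  IsModel.dom_ap (IsModel.dom_ap (IsModel.dom_ap (dom_con' _) hf) hg) h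

theorem case_congr {f : M.D (σ ⇒ ρ)} {g : M.D (τ ⇒ ρ)} {x y : M.D (σ ⊞ τ)} (hf : p ≤ M.dom f)
    (hg : p ≤ M.dom g) (hx : p ≤ M.dom x) (hy : p ≤ M.dom y) (h : p ≤ M.eq x y) :
    p ≤ M.eq (case f g x) (case f g y) := by
  have hc : p ≤ M.dom (M.con (.case σ τ ρ) ⋆ f ⋆ g) :=
    IsModel.dom_ap (IsModel.dom_ap (dom_con' _) hf) hg
  exact IsModel.eq_ap hc hc hx hy (IsModel.eq_refl hc) h

/-- The statement that `r` realizes `A` is the value of the ordinary formula `A.mrOpen`, with `r` as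
the value of an extra variable, so `Agree.sem` applies to it. -/
theorem rel_congr {A : Fm Γ} {γ δ : M.Env Γ} {r s : M.D A.rty} (h : Agree p γ δ)
    (hr : p ≤ M.dom r) (hs : p ≤ M.dom s) (hrs : p ≤ M.eq r s) (hA : p ≤ rel A γ r) :
    p ≤ rel A δ s := by
  have key (γ : M.Env Γ) (r : M.D A.rty) : rel A γ r = sem A.mrOpen (γ.cons r) := by
    rw [Fm.mrOpen, sem_mr]; rfl
  rw [key] at hA ⊢
  exact (h.cons hr hs hrs).sem hA

end Rules

/-- `X` witnesses the principle `CE n`. -/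
structure IsWitness (n : ℕ) (X : M.D (pure (n + 2) ⇒ pure (n + 1) ⇒ pure (n + 1) ⇒ pure n)) :
    Prop where
  dom : ⊤ ≤ M.dom X
  reflects {p : H} {Φ : M.D (pure (n + 2))} {f g : M.D (pure (n + 1))} : p ≤ M.dom Φ →
    p ≤ M.dom f → p ≤ M.dom g → p ≤ (M.eq (Φ ⋆ f) (Φ ⋆ g))ᶜ →
    p ≤ (M.eq (f ⋆ (X ⋆ Φ ⋆ f ⋆ g)) (g ⋆ (X ⋆ Φ ⋆ f ⋆ g)))ᶜ

/-- A condition on assignments for `Ω` and truth values, under which `X` is the value of a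
term. -/
structure Situation {α : Ty} (X : M.D α) (Ω : List Ty) where
  holds : M.Env Ω → H → Prop
  mono {ω : M.Env Ω} {p q : H} : holds ω p → q ≤ p → holds ω q
  dom {ω : M.Env Ω} {p : H} : holds ω p → ∀ σ x, p ≤ M.dom (ω σ x)
  wit : Tm Ω α
  wit_eq {ω : M.Env Ω} {p : H} : holds ω p → eval ω wit = X

-- Realizers of the axioms of EHA, of choice and of independence of premise

namespace Situation

variable {α : Ty} {X : M.D α} (C : Situation X Ω)

def ext (F : M.Env Ω → M.D σ → H) : Situation X (σ :: Ω) where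
  holds ω p := ∃ ω' d, ω = Env.cons ω' d ∧ C.holds ω' p ∧ p ≤ M.dom d ∧ p ≤ F ω' d
  mono := by
    rintro ω p q ⟨ω, d, rfl, h, hd, hF⟩ hq
    exact ⟨ω, d, rfl, C.mono h hq, hq.trans hd, hq.trans hF⟩
  dom := by
    rintro ω p ⟨ω, d, rfl, h, hd, -⟩
    exact dom_cons (C.dom h) hd
  wit := C.wit.wk σ
  wit_eq := by
    rintro ω p ⟨ω, d, rfl, h, -⟩
    rw [eval_wk, C.wit_eq h]

/-- `A` is realized by a term in every situation. -/
def Realizes (A : Fm Γ) (e : M.Env Ω → M.Env Γ) : Prop :=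
  ∃ t : Tm Ω A.rty, ∀ ω p, C.holds ω p → p ≤ rel A (e ω) (eval ω t)

variable {C}

theorem dom_eval {ω : M.Env Ω} (h : C.holds ω p) (t : Tm Ω σ) : p ≤ M.dom (eval ω t) :=
  Str.dom_eval (C.dom h) t

theorem realizes_subst {A : Fm Γ} {θ : Sub Γ Δ} {e : M.Env Ω → M.Env Δ} :
    C.Realizes (A.subst θ) e ↔ C.Realizes A fun ω => evalSub (e ω) θ := by
  have h := A.rty_subst θ
  have hr := rel_subst (M := M) A θ
  unfold Realizes
  generalize rel (M := M) (A.subst θ) = R at *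
  generalize (A.subst θ).rty = α at *
  subst h
  simp only [hr _ _ _ HEq.rfl]

theorem Realizes.ext {A : Fm Γ} {e : M.Env Ω → M.Env Γ} {e' : M.Env (σ :: Ω) → M.Env Γ}
    {F : M.Env Ω → M.D σ → H} (h : C.Realizes A e) (he : ∀ ω d, e' (Env.cons ω d) = e ω) :
    (C.ext F).Realizes A e' := by
  obtain ⟨t, ht⟩ := h
  refine ⟨t.wk σ, ?_⟩
  rintro _ p ⟨ω, d, rfl, h, -⟩
  rw [eval_wk, he]
  exact ht ω p h

/-- Induction is realized by the recursor. The realizer types of the base case and of the step are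
kept as variables `α` and `β`, since they agree with `A.rty` only up to a proof; `R` and `S` stand
for the corresponding realizability predicates. -/
theorem realizes_ind (A : Fm (Ty.N :: Γ)) (θ : Sub Γ Ω) {α β : Ty} (hα : α = A.rty)
    (hβ : β = A.rty) (R : M.Env Γ → M.D α → H) (S : M.Env (Ty.N :: Γ) → M.D β → H)
    (hR : ∀ γ r r', HEq r r' → R γ r = rel A (γ.cons zro) r')
    (hS : ∀ (γ : M.Env Γ) d r r', HEq r r' → S (γ.cons d) r = rel A (γ.cons (suc d)) r') :
    ∃ t : Tm Ω (α ⇒ (Ty.N ⇒ A.rty ⇒ β) ⇒ Ty.N ⇒ A.rty), ∀ ω p, C.holds ω p →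
      p ≤ ⨅ u, M.dom u ⇨ (R (evalSub ω θ) u ⇨ ⨅ b, M.dom b ⇨
        ((⨅ n, M.dom n ⇨ ⨅ w, M.dom w ⇨ (rel A ((evalSub ω θ).cons n) w ⇨
          S ((evalSub ω θ).cons n) (b ⋆ n ⋆ w))) ⇨
        ⨅ n, M.dom n ⇨ rel A ((evalSub ω θ).cons n) (eval ω t ⋆ u ⋆ b ⋆ n))) := by
  subst hα hβ
  simp only [hR _ _ _ HEq.rfl, hS _ _ _ _ HEq.rfl]
  refine ⟨.con (.iter _), fun ω p h => ?_⟩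
  refine forces_all_dom fun u q₁ h₁ hu => forces_himp fun q₂ h₂ hRu => ?_
  refine forces_all_dom fun b q₃ h₃ hb => forces_himp fun q₄ h₄ hS' => ?_
  refine forces_all_dom fun n q₅ h₅ hn => ?_
  -- The predicate "the `n`-th iterate realizes `A` at `n`" is written as a formula in `n` with `u`
  -- and `b` as parameters, because a model has induction for formulas only.
  have key (n : M.D Ty.N) : rel A ((evalSub ω θ).cons n) (iter u b n) =
      sem (A.mr (((((Sub.id Γ).wk (Ty.N ⇒ A.rty ⇒ A.rty)).wk A.rty).wk Ty.N).cons v0)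
        (recN v1 v2 v0)) ((((evalSub ω θ).cons b).cons u).cons n) := by
    simp [sem_mr]
  have hq := h₅.trans h₄
  have hdom : ∀ σ x, q₅ ≤ M.dom (((evalSub ω θ).cons b).cons u σ x) :=
    dom_cons (dom_cons
      (fun σ x => hq.trans <| h₃.trans <| h₂.trans <| h₁.trans <| dom_eval h (θ σ x))
      (hq.trans hb)) (hq.trans <| h₃.trans <| h₂.trans hu)
  change q₅ ≤ rel A _ (iter u b n)
  rw [key]
  refine IsModel.ind _ _ hdom ?_ ?_ n hn
  · rw [← key, IsModel.iter_zro]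
    exact hq.trans <| h₃.trans hRu
  · intro m r hr hm ih
    rw [← key] at ih ⊢
    rw [IsModel.iter_suc]
    refine forces_mp (forces_all_dom_elim (forces_all_dom_elim ((hr.trans h₅).trans hS') hm) ?_) ih
    refine IsModel.dom_ap (IsModel.dom_ap (IsModel.dom_ap (dom_con' _) ?_) ?_) hm
    · exact hr.trans (hq.trans <| h₃.trans <| h₂.trans hu)
    · exact hr.trans (hq.trans hb)

/-- A realizer of `∀ x ∃ y A` sends `x` to a pair of a value and a realizer. The realizer of choice
splits this function into its two components, after which premise and conclusion have the same truth
value. -/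
theorem realizes_ac (A : Fm (τ :: σ :: Γ)) (θ : Sub Γ Ω) {α : Ty} (hα : α = A.rty)
    (R : M.Env (σ :: (σ ⇒ τ) :: Γ) → M.D α → H)
    (hR : ∀ (γ : M.Env Γ) f d r r', HEq r r' →
      R ((γ.cons f).cons d) r = rel A ((γ.cons d).cons (f ⋆ d)) r') :
    ∃ t : Tm Ω ((σ ⇒ τ ⊠ A.rty) ⇒ (σ ⇒ τ) ⊠ (σ ⇒ α)), ∀ ω p, C.holds ω p →
      p ≤ ⨅ u, M.dom u ⇨ ((⨅ d, M.dom d ⇨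
          rel A (((evalSub ω θ).cons d).cons (fst (u ⋆ d))) (snd (u ⋆ d))) ⇨
        ⨅ d, M.dom d ⇨ R (((evalSub ω θ).cons (fst (eval ω t ⋆ u))).cons d)
          (snd (eval ω t ⋆ u) ⋆ d)) := by
  subst hα
  simp only [hR _ _ _ _ _ HEq.rfl]
  refine ⟨lam (pr (lam (p1 (v1 ⬝ v0))) (lam (p2 (v1 ⬝ v0)))), fun ω p h => ?_⟩
  refine forces_all_dom fun u q₁ h₁ hu => forces_himp fun q₂ h₂ h => ?_
  refine h.trans (le_of_eq ?_)
  simp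

/-- A negation is realized by every element of its realizer type or by none, since `r mr ¬A` does
not mention `r`. The given realizer can thus be applied to a default element before it is known
whether `¬A` is realized, which fixes the witness `y` in advance. -/
theorem realizes_ip (A : Fm Γ) (B : Fm (τ :: Γ)) (θ : Sub Γ Ω) {α : Ty} (hα : α = A.rty)
    (R : M.Env (τ :: Γ) → M.D α → H)
    (hR : ∀ (γ : M.Env Γ) d r r', HEq r r' → R (γ.cons d) r = rel A γ r') :
    ∃ t : Tm Ω (((A.rty ⇒ .N) ⇒ τ ⊠ B.rty) ⇒ τ ⊠ ((α ⇒ .N) ⇒ B.rty)), ∀ ω p, C.holds ω p →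
      p ≤ ⨅ u, M.dom u ⇨ ((⨅ v, M.dom v ⇨
          ((⨅ w, M.dom w ⇨ (rel A (evalSub ω θ) w ⇨ ⊥)) ⇨
            rel B ((evalSub ω θ).cons (fst (u ⋆ v))) (snd (u ⋆ v)))) ⇨
        ⨅ v, M.dom v ⇨
          ((⨅ w, M.dom w ⇨ (R ((evalSub ω θ).cons (fst (eval ω t ⋆ u))) w ⇨ ⊥)) ⇨
            rel B ((evalSub ω θ).cons (fst (eval ω t ⋆ u))) (snd (eval ω t ⋆ u) ⋆ v))) := by
  subst hα
  simp only [hR _ _ _ _ HEq.rfl]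
  refine ⟨lam (pr (p1 (v0 ⬝ cl (dfl _))) (lam (p2 (v1 ⬝ cl (dfl _))))), fun ω p h => ?_⟩
  refine forces_all_dom fun u q₁ h₁ hu => forces_himp fun q₂ h₂ h => ?_
  refine forces_all_dom fun v q₃ h₃ hv => ?_
  refine (forces_all_dom_elim (d := M.val (dfl (A.rty ⇒ .N))) (h₃.trans h) (dom_val _)).trans
    (le_of_eq ?_)
  simp

/-- Realizers of prime formulas carry no information. A default term therefore realizes each axiom
built from equations and `⊥` by implication and universal quantification, and only induction and the
decomposition of sums need real work. -/
theorem realizes_ax {A : Fm Γ} (hA : Ax A) (θ : Sub Γ Ω) :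
    C.Realizes A (evalSub · θ) := by
  have hev {ω : M.Env Ω} {p q : H} (h : C.holds ω p) (hq : q ≤ p) {σ : Ty} (t : Tm _ σ) :
      q ≤ M.dom (eval (evalSub ω θ) t) :=
    hq.trans (Str.dom_eval (fun σ x => dom_eval h (θ σ x)) t)
  cases hA with
  | refl a => exact ⟨cl (dfl _), fun ω p h => IsModel.eq_refl (hev h le_rfl a)⟩
  | symm a b =>
    refine ⟨cl (dfl _), fun ω p h => forces_all_dom fun _ q₁ h₁ _ => forces_himp fun q₂ h₂ => ?_⟩
    have hq := h₂.trans h₁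
    exact IsModel.eq_symm (hev h hq a) (hev h hq b)
  | trans a b c =>
    refine ⟨cl (dfl _), fun ω p h => forces_all_dom fun _ q₁ h₁ _ => forces_himp fun q₂ h₂ hab =>
      forces_all_dom fun _ q₃ h₃ _ => forces_himp fun q₄ h₄ hbc => ?_⟩
    have hq := h₄.trans h₃
    have hp := hq.trans (h₂.trans h₁)
    exact IsModel.eq_trans (hev h hp a) (hev h hp b) (hev h hp c) (hq.trans hab) hbc
  | congr f g a b =>
    refine ⟨cl (dfl _), fun ω p h => forces_all_dom fun _ q₁ h₁ _ => forces_himp fun q₂ h₂ hab =>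
      forces_all_dom fun _ q₃ h₃ _ => forces_himp fun q₄ h₄ hbc => ?_⟩
    have hq := h₄.trans h₃
    have hp := hq.trans (h₂.trans h₁)
    exact IsModel.eq_ap (hev h hp f) (hev h hp g) (hev h hp a) (hev h hp b) (hq.trans hab) hbc
  | k a b =>
    refine ⟨cl (dfl _), fun ω p h => ?_⟩
    simpa [rel] using IsModel.eq_refl (hev h le_rfl a)
  | s a b c =>
    refine ⟨cl (dfl _), fun ω p h => ?_⟩
    simpa [rel] using IsModel.eq_refl (hev h le_rfl (a ⬝ c ⬝ (b ⬝ c)))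
  | fst a b =>
    refine ⟨cl (dfl _), fun ω p h => ?_⟩
    simpa [rel] using IsModel.eq_refl (hev h le_rfl a)
  | snd a b =>
    refine ⟨cl (dfl _), fun ω p h => ?_⟩
    simpa [rel] using IsModel.eq_refl (hev h le_rfl b)
  | caseInl f g a =>
    refine ⟨cl (dfl _), fun ω p h => ?_⟩
    exact (IsModel.eq_refl (hev h le_rfl (f ⬝ a))).trans_eq
      (congrArg (M.eq · _) (IsModel.case_inl _ _ _).symm)
  | caseInr f g a =>
    refine ⟨cl (dfl _), fun ω p h => ?_⟩
    exact (IsModel.eq_refl (hev h le_rfl (g ⬝ a))).trans_eq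
      (congrArg (M.eq · _) (IsModel.case_inr _ _ _).symm)
  | recZero a b =>
    refine ⟨cl (dfl _), fun ω p h => ?_⟩
    simpa [rel] using IsModel.eq_refl (hev h le_rfl a)
  | recSucc a b n =>
    refine ⟨cl (dfl _), fun ω p h => ?_⟩
    simpa [rel] using IsModel.eq_refl (hev h le_rfl (b ⬝ n ⬝ recN a b n))
  | succNeZero n =>
    refine ⟨cl (dfl _), fun ω p h => forces_all_dom fun _ q₁ h₁ _ => forces_himp fun q₂ h₂ => ?_⟩
    exact IsModel.suc_ne_zro (hev h (h₂.trans h₁) n)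
  | succInj m n =>
    refine ⟨cl (dfl _), fun ω p h => forces_all_dom fun _ q₁ h₁ _ => forces_himp fun q₂ h₂ => ?_⟩
    exact IsModel.suc_inj (hev h (h₂.trans h₁) m) (hev h (h₂.trans h₁) n)
  | ind A =>
    exact realizes_ind A θ (A.rty_subst _) (A.rty_subst _) _ _
      (fun γ r r' h => (rel_subst A _ γ r r' h).trans (by rw [evalSub_cons]; rfl))
      (fun γ d r r' h => (rel_subst A _ (γ.cons d) r r' h).trans (by rw [evalSub_cons]; rfl))
  | extArr f g =>
    refine ⟨cl (dfl _), fun ω p h => forces_all_dom fun _ q₁ h₁ _ => forces_himp fun q₂ h₂ hfg => ?_⟩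
    have hq := h₂.trans h₁
    refine IsModel.ext_arr (hev h hq f) (hev h hq g) fun x q₃ h₃ hx => ?_
    simpa [rel] using forces_all_dom_elim (h₃.trans hfg) hx
  | extProd x =>
    exact ⟨cl (dfl _), fun ω p h => IsModel.ext_prod (hev h le_rfl x)⟩
  | @extSum σ τ x =>
    refine ⟨cases (x.subst θ) (il (pr v0 EHA.zro)) (ir (pr v0 EHA.zro)), fun ω p h => ?_⟩
    have hx := hev h le_rfl x
    have hf := dom_eval h (lam (il (pr v0 EHA.zro) : Tm (σ :: Ω) ((σ ⊠ .N) ⊞ (τ ⊠ .N))))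
    have hg := dom_eval h (lam (ir (pr v0 EHA.zro) : Tm (τ :: Ω) ((σ ⊠ .N) ⊞ (τ ⊠ .N))))
    simp only [rel, eval_cases, eval_subst]
    refine forces_or (IsModel.ext_sum hx) (fun q hq hu => le_sup_of_le_left ?_)
      (fun q hq hu => le_sup_of_le_right ?_)
    · refine forces_ex_dom hu fun u r hr hu hux => ?_
      have hd := dom_pair hu (dom_con' (M := M) .zero)
      refine forces_ex_dom_intro (pair u zro) hd (le_inf ?_ ?_)
      -- The sum is decomposed only up to equality, so the value of the case distinction at `x` is
      -- compared with its value at `inl u`, where it computes.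
      · have hrp := hr.trans hq
        simpa using case_congr (hrp.trans hf) (hrp.trans hg) (hrp.trans hx) (dom_inl hu) hux
      · simpa using hux
    · refine forces_ex_dom hu fun u r hr hu hux => ?_
      have hd := dom_pair hu (dom_con' (M := M) .zero)
      refine forces_ex_dom_intro (pair u zro) hd (le_inf ?_ ?_)
      · have hrp := hr.trans hq
        simpa using case_congr (hrp.trans hf) (hrp.trans hg) (hrp.trans hx) (dom_inr hu) hux
      · simpa using hux

end Situation

end Str
end EHA

-- Soundness of modified realizability for derivations

namespace EHA
namespace Str

variable {H : Type} [Order.Frame H] {M : Str H} {Γ Δ Ω : List Ty} {σ τ : Ty} {p q : H}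
variable [IsModel M]

namespace Situation

theorem realizes_axPlus {X : M.D (pure 2 ⇒ pure 1 ⇒ pure 1 ⇒ pure 0)}
    (hX : IsWitness 0 X) {C : Situation X Ω} {A : Fm Γ} (hA : AxPlus A) (θ : Sub Γ Ω) :
    C.Realizes A (evalSub · θ) := by
  cases hA with
  | base h => exact realizes_ax h θ
  | ce =>
    -- This is the only use of the distinguished term for `X`. The remaining component of the
    -- realizer concerns a negated equation and can be arbitrary.
    refine ⟨pr C.wit (cl (dfl _)), fun ω p h => ?_⟩
    simp only [CE, Fm.neg, rel, eval_pr, IsModel.fst_pair, eval_app, eval_v0,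
      eval_v1, eval_v2, eval_v3, C.wit_eq h]
    refine forces_all_dom fun Φ q₁ h₁ hΦ => forces_all_dom fun f q₂ h₂ hf =>
      forces_all_dom fun g q₃ h₃ hg => forces_all_dom fun u q₄ h₄ _ => forces_himp fun q₅ h₅ hne =>
      forces_all_dom fun v q₆ h₆ _ => ?_
    rw [himp_bot]
    have h₅ := h₆.trans (h₅.trans h₄)
    have h₃ := h₅.trans h₃
    refine hX.reflects ((h₃.trans h₂).trans hΦ) (h₃.trans hf) (h₅.trans hg) ?_
    -- Any total number realizes a true equation, so `zro` may be fed to the realized premise `Φ f ≠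
    -- Φ g`.
    exact forces_compl fun r hr he => forces_mp (forces_all_dom_elim (d := zro)
      ((hr.trans h₆).trans hne) (dom_con' _)) he
  | ac σ τ A =>
    exact realizes_ac A θ (A.rty_subst _) _ fun γ f d r r' h =>
      (rel_subst A _ ((γ.cons f).cons d) r r' h).trans (by
        simp only [evalSub_cons, evalSub_wk, evalSub_shift]; rfl)
  | ip τ A B =>
    exact realizes_ip A B θ (A.rty_subst _) _ fun γ d r r' h =>
      (rel_subst A _ (γ.cons d) r r' h).trans (by rw [evalSub_shift])

/-- Induction on the derivation, with the context of realizers, the situation and the substitution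
of terms for free variables all left arbitrary. A discharged assumption becomes a new variable for
its realizer, and a generalized variable becomes a new variable of the situation. The realizing term
must not depend on the assignment or on the truth value `p`. -/
theorem realizes_of_prov {X : M.D (pure 2 ⇒ pure 1 ⇒ pure 1 ⇒ pure 0)} (hX : IsWitness 0 X)
    {Δ : List (Fm Γ)} {A : Fm Γ} (hA : Prov AxPlus Δ A) {Ω : List Ty} (C : Situation X Ω)
    (θ : Sub Γ Ω) (hΔ : ∀ B ∈ Δ, C.Realizes B (evalSub · θ)) : C.Realizes A (evalSub · θ) := by
  induction hA generalizing Ω with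
  | ax h => exact realizes_axPlus hX h θ
  | hyp h => exact hΔ _ h
  | botE _ ih =>
    obtain ⟨t, ht⟩ := ih C θ hΔ
    exact ⟨cl (dfl _), fun ω p h => (ht ω p h).trans bot_le⟩
  | andI _ _ ih₁ ih₂ =>
    obtain ⟨t, ht⟩ := ih₁ C θ hΔ
    obtain ⟨s, hs⟩ := ih₂ C θ hΔ
    refine ⟨pr t s, fun ω p h => ?_⟩
    simpa [rel] using ⟨ht ω p h, hs ω p h⟩
  | andE₁ _ ih =>
    obtain ⟨t, ht⟩ := ih C θ hΔ
    exact ⟨p1 t, fun ω p h => (ht ω p h).trans inf_le_left⟩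
  | andE₂ _ ih =>
    obtain ⟨t, ht⟩ := ih C θ hΔ
    exact ⟨p2 t, fun ω p h => (ht ω p h).trans inf_le_right⟩
  | orI₁ _ ih =>
    obtain ⟨t, ht⟩ := ih C θ hΔ
    exact ⟨il t, fun ω p h => le_sup_of_le_left <| forces_ex_dom_intro _ (dom_eval h t) <|
      le_inf (IsModel.eq_refl (dom_eval h (il t))) (ht ω p h)⟩
  | orI₂ _ ih =>
    obtain ⟨t, ht⟩ := ih C θ hΔ
    exact ⟨ir t, fun ω p h => le_sup_of_le_right <| forces_ex_dom_intro _ (dom_eval h t) <|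
      le_inf (IsModel.eq_refl (dom_eval h (ir t))) (ht ω p h)⟩
  | @orE Γ Δ A B D _ _ _ ih ih₁ ih₂ =>
    obtain ⟨t, ht⟩ := ih C θ hΔ
    -- Either branch gives a term with one additional free variable, which stands for a realizer of
    -- the disjunct.
    have step (A' : Fm Γ)
        (ih : ∀ {Ω : List Ty} (C : Situation X Ω) (θ : Sub Γ Ω),
          (∀ B ∈ A' :: Δ, C.Realizes B (evalSub · θ)) → C.Realizes D (evalSub · θ)) :
        ∃ s : Tm (A'.rty :: Ω) D.rty, ∀ ω p, C.holds ω p → ∀ u, p ≤ M.dom u →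
          p ≤ rel A' (evalSub ω θ) u → p ≤ rel D (evalSub ω θ) (eval (Env.cons ω u) s) := by
      obtain ⟨s, hs⟩ := ih (C.ext (fun ω u => rel A' (evalSub ω θ) u)) (θ.wk _) (by
        intro B' hB'
        rcases List.mem_cons.1 hB' with rfl | hB'
        · refine ⟨v0, ?_⟩
          rintro _ p ⟨ω, d, rfl, -, -, h⟩
          simpa using h
        · exact (hΔ _ hB').ext fun ω d => evalSub_wk ..)
      refine ⟨s, fun ω p h u hu hA => ?_⟩
      simpa using hs (Env.cons ω u) p ⟨ω, u, rfl, h, hu, hA⟩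
    obtain ⟨a, ha⟩ := step A ih₁
    obtain ⟨b, hb⟩ := step B ih₂
    refine ⟨cases t a b, fun ω p h => ?_⟩
    -- The realizer of the disjunction is equal to an injection only with some truth value, so the
    -- conclusion is first obtained at the injection and then transported.
    have hc {q : H} (hq : q ≤ p) {x y : M.D (A.rty ⊞ B.rty)} (hx : q ≤ M.dom x) (hy : q ≤ M.dom y)
        (he : q ≤ M.eq x y) :
        q ≤ rel D (evalSub ω θ) (case (eval ω (lam a)) (eval ω (lam b)) x) →
        q ≤ rel D (evalSub ω θ) (case (eval ω (lam a)) (eval ω (lam b)) y) := by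
      have hf := hq.trans (dom_eval h (lam a))
      have hg := hq.trans (dom_eval h (lam b))
      exact rel_congr (Agree.refl fun σ x => hq.trans (dom_eval h (θ σ x))) (dom_case hf hg hx)
        (dom_case hf hg hy) (case_congr hf hg hx hy he)
    refine forces_or (ht ω p h) (fun q hq hu => ?_) (fun q hq hu => ?_)
    · refine forces_ex_dom hu fun u r hr hu hA => ?_
      have hrp := hr.trans hq
      have hdt := hrp.trans (dom_eval h t)
      refine hc hrp (dom_inl hu) hdt
        (IsModel.eq_symm hdt (dom_inl hu) (hA.trans inf_le_left)) ?_
      simpa using ha ω r (C.mono h hrp) u hu (hA.trans inf_le_right)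
    · refine forces_ex_dom hu fun u r hr hu hA => ?_
      have hrp := hr.trans hq
      have hdt := hrp.trans (dom_eval h t)
      refine hc hrp (dom_inr hu) hdt
        (IsModel.eq_symm hdt (dom_inr hu) (hA.trans inf_le_left)) ?_
      simpa using hb ω r (C.mono h hrp) u hu (hA.trans inf_le_right)
  | @impI Γ Δ A B _ ih =>
    obtain ⟨t, ht⟩ := ih (C.ext (fun ω u => rel A (evalSub ω θ) u)) (θ.wk _) (by
      intro B' hB'
      rcases List.mem_cons.1 hB' with rfl | hB'
      · refine ⟨v0, ?_⟩
        rintro _ p ⟨ω, d, rfl, -, -, h⟩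
        simpa using h
      · exact (hΔ _ hB').ext fun ω d => evalSub_wk ..)
    refine ⟨lam t, fun ω p h => forces_all_dom fun u q₁ h₁ hu => forces_himp fun q₂ h₂ hA => ?_⟩
    simpa using ht (Env.cons ω u) q₂ ⟨ω, u, rfl, C.mono h (h₂.trans h₁), h₂.trans hu, hA⟩
  | impE _ _ ih₁ ih₂ =>
    obtain ⟨t, ht⟩ := ih₁ C θ hΔ
    obtain ⟨s, hs⟩ := ih₂ C θ hΔ
    exact ⟨t ⬝ s, fun ω p h =>
      forces_mp (forces_all_dom_elim (ht ω p h) (dom_eval h s)) (hs ω p h)⟩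
  | @allI Γ Δ σ A _ ih =>
    obtain ⟨t, ht⟩ := ih (C.ext (fun _ (_ : M.D σ) => ⊤)) (θ.lift σ) (by
      intro B' hB'
      obtain ⟨B, hB, rfl⟩ := List.mem_map.1 hB'
      refine realizes_subst.2 ((hΔ _ hB).ext fun ω d => ?_)
      rw [evalSub_lift, evalSub_shift])
    refine ⟨lam t, fun ω p h => forces_all_dom fun u q₁ h₁ hu => ?_⟩
    simpa using ht (Env.cons ω u) q₁ ⟨ω, u, rfl, C.mono h h₁, hu, le_top⟩
  | @allE Γ Δ σ A s _ ih =>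
    obtain ⟨t, ht⟩ := ih C θ hΔ
    refine realizes_subst.2 ⟨t ⬝ s.subst θ, fun ω p h => ?_⟩
    simpa [eval_subst] using forces_all_dom_elim (ht ω p h) (dom_eval h (s.subst θ))
  | @exI Γ Δ σ A s _ ih =>
    obtain ⟨t, ht⟩ := realizes_subst.1 (ih C θ hΔ)
    refine ⟨pr (s.subst θ) t, fun ω p h => ?_⟩
    simpa [eval_subst, rel] using ht ω p h
  | @exE Γ Δ σ A D _ _ ih₁ ih₂ =>
    obtain ⟨t, ht⟩ := ih₁ C θ hΔ
    -- A realizer of `∃` contains an explicit witness. It is substituted for the eigenvariable, and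
    -- the situation need not be extended.
    have h := ih₂ C (θ.cons (p1 t)) (by
      intro B' hB'
      rcases List.mem_cons.1 hB' with rfl | hB'
      · refine ⟨p2 t, fun ω p h => ?_⟩
        simpa [rel] using ht ω p h
      · obtain ⟨B, hB, rfl⟩ := List.mem_map.1 hB'
        refine realizes_subst.2 ?_
        simpa using hΔ _ hB)
    simpa using realizes_subst.1 h

end Situation

end Str
end EHA

namespace EHA

/-! ### Syntactic facts -/

section Substitution

variable {Γ Δ Ξ : List Ty} {σ τ : Ty}

def Sub.comp (θ : Sub Γ Δ) (η : Sub Δ Ξ) : Sub Γ Ξ := fun σ x => (θ σ x).subst η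

theorem Tm.subst_subst (t : Tm Γ σ) (θ : Sub Γ Δ) (η : Sub Δ Ξ) :
    (t.subst θ).subst η = t.subst (θ.comp η) := by
  induction t with
  | var x => rfl
  | con c => rfl
  | app t s iht ihs => simp only [Tm.subst, iht, ihs]

theorem Tm.wk_subst_cons (t : Tm Γ τ) (θ : Sub Γ Δ) (s : Tm Δ σ) :
    (t.wk σ).subst (θ.cons s) = t.subst θ := by
  rw [Tm.wk, Tm.subst_subst]; rfl

theorem Tm.wk_subst_lift (t : Tm Γ τ) (θ : Sub Γ Δ) :
    (t.wk σ).subst (θ.lift σ) = (t.subst θ).wk σ := by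
  rw [Sub.lift, Tm.wk_subst_cons, Tm.wk, Tm.subst_subst]; rfl

theorem Tm.subst_id (t : Tm Γ σ) : t.subst (Sub.id Γ) = t := by
  induction t with
  | var x => rfl
  | con c => rfl
  | app t s iht ihs => simp only [Tm.subst, iht, ihs]

theorem Sub.lift_comp_lift (θ : Sub Γ Δ) (η : Sub Δ Ξ) :
    (θ.lift σ).comp (η.lift σ) = (θ.comp η).lift σ := by
  funext τ x
  cases x with
  | zero => rfl
  | succ x => exact Tm.wk_subst_lift (θ τ x) η

theorem Sub.lift_comp_cons (θ : Sub Γ Δ) (η : Sub Δ Ξ) (t : Tm Ξ σ) :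
    (θ.lift σ).comp (η.cons t) = (θ.comp η).cons t := by
  funext τ x
  cases x with
  | zero => rfl
  | succ x => exact Tm.wk_subst_cons (θ τ x) η t

theorem Sub.comp_id (θ : Sub Γ Δ) : θ.comp (Sub.id Δ) = θ := by
  funext τ x; exact Tm.subst_id _

theorem Sub.lift_id : (Sub.id Γ).lift σ = Sub.id (σ :: Γ) := by
  funext τ x; cases x <;> rfl

theorem Fm.subst_subst (A : Fm Γ) (θ : Sub Γ Δ) (η : Sub Δ Ξ) :
    (A.subst θ).subst η = A.subst (θ.comp η) := by
  induction A generalizing Δ Ξ with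
  | eq s t => simp only [Fm.subst, Tm.subst_subst]
  | bot => rfl
  | and A B ihA ihB => simp only [Fm.subst, ihA, ihB]
  | or A B ihA ihB => simp only [Fm.subst, ihA, ihB]
  | imp A B ihA ihB => simp only [Fm.subst, ihA, ihB]
  | all σ A ih => simp only [Fm.subst, ih, Sub.lift_comp_lift]
  | ex σ A ih => simp only [Fm.subst, ih, Sub.lift_comp_lift]

theorem Fm.subst_id (A : Fm Γ) : A.subst (Sub.id Γ) = A := by
  induction A with
  | eq s t => simp only [Fm.subst, Tm.subst_id]
  | bot => rfl
  | and A B ihA ihB => simp only [Fm.subst, ihA, ihB]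
  | or A B ihA ihB => simp only [Fm.subst, ihA, ihB]
  | imp A B ihA ihB => simp only [Fm.subst, ihA, ihB]
  | all σ A ih => simp only [Fm.subst, Sub.lift_id, ih]
  | ex σ A ih => simp only [Fm.subst, Sub.lift_id, ih]

theorem Prov.mono {T : ∀ {Γ : List Ty}, Fm Γ → Prop} {Δ Δ' : List (Fm Γ)} {A : Fm Γ}
    (h : Prov T Δ A) (hΔ : Δ ⊆ Δ') : Prov T Δ' A := by
  induction h with
  | ax h => exact .ax h
  | hyp h => exact .hyp (hΔ h)
  | botE _ ih => exact .botE (ih hΔ)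
  | andI _ _ ih₁ ih₂ => exact .andI (ih₁ hΔ) (ih₂ hΔ)
  | andE₁ _ ih => exact .andE₁ (ih hΔ)
  | andE₂ _ ih => exact .andE₂ (ih hΔ)
  | orI₁ _ ih => exact .orI₁ (ih hΔ)
  | orI₂ _ ih => exact .orI₂ (ih hΔ)
  | orE _ _ _ ih ih₁ ih₂ =>
    exact .orE (ih hΔ) (ih₁ (List.cons_subset_cons _ hΔ)) (ih₂ (List.cons_subset_cons _ hΔ))
  | impI _ ih => exact .impI (ih (List.cons_subset_cons _ hΔ))
  | impE _ _ ih₁ ih₂ => exact .impE (ih₁ hΔ) (ih₂ hΔ)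
  | allI _ ih => exact .allI (ih (List.map_subset _ hΔ))
  | allE t _ ih => exact .allE t (ih hΔ)
  | exI t _ ih => exact .exI t (ih hΔ)
  | exE _ _ ih₁ ih₂ => exact .exE (ih₁ hΔ) (ih₂ (List.cons_subset_cons _ (List.map_subset _ hΔ)))

end Substitution

/-! ### The generic model -/

/-- Closed terms with parameters: infinitely many of each type. -/
inductive PT : Ty → Type
  | par {σ : Ty} : ℕ → PT σ
  | con {σ : Ty} : Con σ → PT σ
  | app {σ τ : Ty} : PT (σ ⇒ τ) → PT σ → PT τ

/-- Replacements of the parameters by terms in context. -/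
def Val (Ξ : List Ty) : Type := ∀ σ : Ty, ℕ → Tm Ξ σ

def PEnv (Γ : List Ty) : Type := ∀ σ : Ty, Var Γ σ → PT σ

section Params

variable {Γ Δ Ξ : List Ty} {σ τ : Ty}

def PT.at (κ : Val Ξ) : {σ : Ty} → PT σ → Tm Ξ σ
  | _, .par i => κ _ i
  | _, .con c => .con c
  | _, .app t s => t.at κ ⬝ s.at κ

def PEnv.at (κ : Val Ξ) (r : PEnv Γ) : Sub Γ Ξ := fun σ x => (r σ x).at κ

def PEnv.cons (r : PEnv Γ) (t : PT σ) : PEnv (σ :: Γ)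
  | _, .zero => t
  | _, .succ x => r _ x

def PEnv.nil : PEnv [] := fun _ x => by cases x

theorem PEnv.cons_at (κ : Val Ξ) (r : PEnv Γ) (t : PT σ) :
    (r.cons t).at κ = (r.at κ).cons (t.at κ) := by
  funext τ x; cases x <;> rfl

def Tm.toPT (r : PEnv Γ) : {σ : Ty} → Tm Γ σ → PT σ
  | _, .var x => r _ x
  | _, .con c => .con c
  | _, .app t s => .app (t.toPT r) (s.toPT r)

theorem Tm.toPT_at (κ : Val Ξ) (r : PEnv Γ) (t : Tm Γ σ) :
    (t.toPT r).at κ = t.subst (r.at κ) := by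
  induction t with
  | var x => rfl
  | con c => rfl
  | app t s iht ihs => simp only [Tm.toPT, PT.at, Tm.subst, iht, ihs]

def Val.wk (σ : Ty) (κ : Val Ξ) : Val (σ :: Ξ) := fun τ i => (κ τ i).wk σ

theorem PT.at_wk (κ : Val Ξ) (t : PT τ) : t.at (κ.wk σ) = (t.at κ).wk σ := by
  induction t with
  | par i => rfl
  | con c => rfl
  | app t s iht ihs => simp only [PT.at, iht, ihs]; rfl

/-- Two replacements agree on the parameters below `n`. -/
def Val.EqBelow (n : ℕ) (κ κ' : Val Ξ) : Prop := ∀ σ, ∀ i < n, κ σ i = κ' σ i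

/-- A term contains finitely many parameters. Boundedness is expressed through replacements, which
avoids a definition of occurrence. -/
theorem PT.exists_bound (t : PT σ) :
    ∃ n, ∀ m ≥ n, ∀ (Ξ : List Ty) (κ κ' : Val Ξ), κ.EqBelow m κ' → t.at κ = t.at κ' := by
  induction t with
  | par i => exact ⟨i + 1, fun m hm Ξ κ κ' h => h _ i hm⟩
  | con c => exact ⟨0, fun _ _ _ _ _ _ => rfl⟩
  | app t s iht ihs =>
    obtain ⟨n, hn⟩ := iht
    obtain ⟨m, hm⟩ := ihs
    refine ⟨max n m, fun k hk Ξ κ κ' h => ?_⟩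
    rw [PT.at, PT.at, hn k (le_trans (le_max_left ..) hk) Ξ κ κ' h,
      hm k (le_trans (le_max_right ..) hk) Ξ κ κ' h]

theorem PEnv.exists_bound : {Γ : List Ty} → (r : PEnv Γ) →
    ∃ n, ∀ m ≥ n, ∀ (Ξ : List Ty) (κ κ' : Val Ξ), κ.EqBelow m κ' → r.at κ = r.at κ'
  | [], r => ⟨0, fun _ _ _ _ _ _ => by funext σ x; cases x⟩
  | σ :: Γ, r => by
    obtain ⟨n, hn⟩ := PEnv.exists_bound (fun τ x => r τ x.succ)
    obtain ⟨m, hm⟩ := (r σ .zero).exists_bound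
    refine ⟨max n m, fun k hk Ξ κ κ' h => ?_⟩
    funext τ x
    cases x with
    | zero => exact hm k (le_trans (le_max_right ..) hk) Ξ κ κ' h
    | succ x => exact congrFun (congrFun (hn k (le_trans (le_max_left ..) hk) Ξ κ κ' h) τ) x

open Classical in
/-- Weaken `κ` and interpret the parameter `n` of type `σ` by the new variable. -/
noncomputable def Val.fresh (σ : Ty) (n : ℕ) (κ : Val Ξ) : Val (σ :: Ξ) := fun τ i =>
  if h : σ = τ then if i = n then h ▸ v0 else (κ τ i).wk σ else (κ τ i).wk σ

theorem Val.fresh_self (σ : Ty) (n : ℕ) (κ : Val Ξ) : κ.fresh σ n σ n = v0 := by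
  simp [Val.fresh]

theorem Val.fresh_eqBelow (σ : Ty) (n : ℕ) (κ : Val Ξ) : (κ.fresh σ n).EqBelow n (κ.wk σ) := by
  intro τ i hi
  simp [Val.fresh, hi.ne, Val.wk]

/-- A formula with parameters. -/
structure Clo where
  Γ : List Ty
  fm : Fm Γ
  env : PEnv Γ

def Clo.at (κ : Val Ξ) (B : Clo) : Fm Ξ := B.fm.subst (B.env.at κ)

theorem Clo.at_wk (κ : Val Ξ) (B : Clo) : B.at (κ.wk σ) = (B.at κ).wk σ := by
  unfold Clo.at
  rw [Fm.wk, Fm.subst_subst]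
  congr 1
  funext τ x
  exact PT.at_wk κ _

theorem exists_bound_list : ∀ L : List Clo,
    ∃ n, ∀ m ≥ n, ∀ (Ξ : List Ty) (κ κ' : Val Ξ), κ.EqBelow m κ' →
      L.map (Clo.at κ) = L.map (Clo.at κ')
  | [] => ⟨0, fun _ _ _ _ _ _ => rfl⟩
  | B :: L => by
    obtain ⟨n, hn⟩ := exists_bound_list L
    obtain ⟨m, hm⟩ := B.env.exists_bound
    refine ⟨max n m, fun k hk Ξ κ κ' h => ?_⟩
    rw [List.map_cons, List.map_cons, hn k (le_trans (le_max_left ..) hk) Ξ κ κ' h, Clo.at, Clo.at,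
      hm k (le_trans (le_max_right ..) hk) Ξ κ κ' h]

/-- Derivability of `B` from `L`, uniformly in the parameters. -/
def Entails (L : List Clo) (B : Clo) : Prop :=
  ∀ (Ξ : List Ty) (κ : Val Ξ), Prov Ax (L.map (Clo.at κ)) (B.at κ)

theorem Entails.mono {L L' : List Clo} {B : Clo} (h : Entails L B) (hL : L ⊆ L') : Entails L' B :=
  fun Ξ κ => (h Ξ κ).mono (List.map_subset _ hL)

theorem Clo.cons_at (κ : Val Ξ) (A : Fm (σ :: Γ)) (r : PEnv Γ) (t : PT σ) :
    Clo.at κ ⟨_, A, r.cons t⟩ = (A.subst ((r.at κ).lift σ)).inst (t.at κ) := by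
  rw [Clo.at, Fm.inst, Fm.subst_subst, Sub.lift_comp_cons, Sub.comp_id, PEnv.cons_at]

/-- For `n` beyond all parameters in `L` and `r`, sending the parameter `n` to the new variable does
to `L` nothing but weaken it. This is the eigenvariable condition, with a parameter in the role of
the variable. -/
theorem exists_fresh (L : List Clo) (r : PEnv Γ) : ∃ n, ∀ (Ξ : List Ty) (κ : Val Ξ),
    L.map (Clo.at (κ.fresh σ n)) = (L.map (Clo.at κ)).map (Fm.wk σ) ∧
    (r.cons (.par n)).at (κ.fresh σ n) = (r.at κ).lift σ := by
  obtain ⟨n, hn⟩ := exists_bound_list L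
  obtain ⟨m, hm⟩ := r.exists_bound
  refine ⟨max n m, fun Ξ κ => ⟨?_, ?_⟩⟩
  · rw [hn _ (le_max_left n m) _ _ _ (Val.fresh_eqBelow σ (max n m) κ), List.map_map]
    exact List.map_congr_left fun B _ => Clo.at_wk κ B
  · rw [PEnv.cons_at, hm _ (le_max_right n m) _ _ _ (Val.fresh_eqBelow σ (max n m) κ), Sub.lift]
    congr 1
    · funext τ x
      exact PT.at_wk κ _
    · exact Val.fresh_self ..

/-- Derivability of all instances includes a fresh parameter, and uniformity over replacements turns
that instance into a derivation with a new variable, to which `Prov.allI` applies. -/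
theorem entails_all {L : List Clo} {A : Fm (σ :: Γ)} {r : PEnv Γ} :
    Entails L ⟨_, .all σ A, r⟩ ↔ ∀ t : PT σ, Entails L ⟨_, A, r.cons t⟩ := by
  constructor
  · intro h t Ξ κ
    rw [Clo.cons_at]
    exact .allE _ (h Ξ κ)
  · intro h Ξ κ
    obtain ⟨n, hn⟩ := exists_fresh (σ := σ) L r
    obtain ⟨h₁, h₂⟩ := hn Ξ κ
    have := h (.par n) _ (κ.fresh σ n)
    rw [h₁, Clo.at, h₂] at this
    exact .allI this

theorem entails_ex_elim {L : List Clo} {A : Fm (σ :: Γ)} {r : PEnv Γ} {B : Clo}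
    (h : Entails L ⟨_, .ex σ A, r⟩) (hB : ∀ t : PT σ, Entails (⟨_, A, r.cons t⟩ :: L) B) :
    Entails L B := by
  intro Ξ κ
  obtain ⟨n, hn⟩ := exists_fresh (σ := σ) (B :: L) r
  obtain ⟨h₁, h₂⟩ := hn Ξ κ
  obtain ⟨h₀, h₁⟩ := List.cons.inj h₁
  have := hB (.par n) _ (κ.fresh σ n)
  rw [List.map_cons, h₁, Clo.at, h₂, h₀] at this
  exact .exE (h Ξ κ) this

end Params

-- The frame of truth values of the generic model

/-- Finite lists of assumptions, ordered by reverse inclusion. -/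
def World : Type := List Clo

instance : Preorder World where
  le L L' := List.Subset L' L
  le_refl L := List.Subset.refl L
  le_trans _ _ _ h h' := List.Subset.trans h' h

def World.cons (B : Clo) (L : World) : World := List.cons B L

theorem World.cons_le (B : Clo) (L : World) : L.cons B ≤ L := List.subset_cons_self B L

/-- The nucleus on the frame of lower sets of worlds whose fixed points are the lower sets that
are closed under derivability. -/
def nuc : Nucleus (LowerSet World) where
  toFun S :=
    { carrier := {L | ∀ L' ≤ L, ∀ B, (∀ K ≤ L', K ∈ S → Entails K B) → Entails L' B}
      lower' := fun L L' hL h K hK => h K (hK.trans hL) }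
  map_inf' S T := by
    refine le_antisymm (le_inf ?_ ?_) ?_
    · exact fun L h L' hL B hB => h L' hL B fun K hK hS => hB K hK hS.1
    · exact fun L h L' hL B hB => h L' hL B fun K hK hS => hB K hK hS.2
    · exact fun L h L' hL B hB => h.1 L' hL B fun K hK hS => h.2 K (hK.trans hL) B
        fun J hJ hT => hB J (hJ.trans hK) ⟨S.lower hJ hS, hT⟩
  idempotent' S := fun L h L' hL B hB => h L' hL B fun K hK hS => hS K le_rfl B
    fun J hJ hT => hB J (hJ.trans hK) hT
  le_apply' S := fun L h L' hL B hB => hB L' le_rfl (S.lower hL h)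

/-- The truth values of the generic model. -/
abbrev Truth : Type := Set.range nuc

namespace Truth

variable {Γ : List Ty} {σ τ : Ty}

def mk (S : LowerSet World)
    (h : ∀ L, (∀ L' ≤ L, ∀ B, (∀ K ≤ L', K ∈ S → Entails K B) → Entails L' B) → L ∈ S) : Truth :=
  ⟨S, Nucleus.mem_range.2 (le_antisymm h nuc.le_apply)⟩

theorem mem_of (a : Truth) {L : World}
    (h : ∀ K ≤ L, ∀ B, (∀ J ≤ K, J ∈ a.1 → Entails J B) → Entails K B) : L ∈ a.1 := by
  rw [← Nucleus.mem_range.1 a.2]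
  exact h

/-- The truth value of a formula with parameters. -/
def of (B : Clo) : Truth :=
  mk ⟨{L | Entails L B}, fun _ _ hL h => h.mono hL⟩ fun L h => h L le_rfl B fun _ _ hK => hK

theorem mem_inf {a b : Truth} {L : World} : L ∈ (a ⊓ b).1 ↔ L ∈ a.1 ∧ L ∈ b.1 := by
  refine ⟨fun h => ⟨(inf_le_left : a ⊓ b ≤ a) h, (inf_le_right : a ⊓ b ≤ b) h⟩, fun h => ?_⟩
  -- The intersection of two closed sets is closed, hence it is a lower bound of both in the frame
  -- and lies below their meet.
  let c : Truth := mk (a.1 ⊓ b.1) fun L h => ⟨a.mem_of fun K hK B hB => h K hK B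
    fun J hJ hab => hB J hJ hab.1, b.mem_of fun K hK B hB => h K hK B fun J hJ hab => hB J hJ hab.2⟩
  exact (le_inf (fun L h => h.1) (fun L h => h.2) : c ≤ a ⊓ b) h

theorem of_bot (r : PEnv Γ) : of ⟨_, .bot, r⟩ = ⊥ :=
  le_bot_iff.1 fun _ h => mem_of _ fun _ hK _ _ Ξ κ => .botE (h.mono hK Ξ κ)

theorem of_and (A B : Fm Γ) (r : PEnv Γ) : of ⟨_, A ⋏ B, r⟩ = of ⟨_, A, r⟩ ⊓ of ⟨_, B, r⟩ :=
  le_antisymm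
    (le_inf (fun _ h Ξ κ => .andE₁ (h Ξ κ)) (fun _ h Ξ κ => .andE₂ (h Ξ κ)))
    fun _ h Ξ κ => .andI ((mem_inf.1 h).1 Ξ κ) ((mem_inf.1 h).2 Ξ κ)

/-- A world that derives a disjunction need not derive a disjunct, so the join cannot be the union.
By disjunction elimination the worlds extended by `A` and by `B` together cover it, and closed sets
respect such covers. The same reason gives `of_ex`, with a cover indexed by the terms. -/
theorem of_or (A B : Fm Γ) (r : PEnv Γ) : of ⟨_, A ⋎ B, r⟩ = of ⟨_, A, r⟩ ⊔ of ⟨_, B, r⟩ := by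
  refine le_antisymm (fun L h => mem_of _ fun K hK C hC Ξ κ => ?_)
    (sup_le (fun _ h Ξ κ => .orI₁ (h Ξ κ)) (fun _ h Ξ κ => .orI₂ (h Ξ κ)))
  refine .orE (h.mono hK Ξ κ) (hC (K.cons ⟨_, A, r⟩) (World.cons_le _ _) ?_ Ξ κ)
    (hC (K.cons ⟨_, B, r⟩) (World.cons_le _ _) ?_ Ξ κ)
  · exact (le_sup_left : of ⟨_, A, r⟩ ≤ _) fun Ξ κ => .hyp (List.mem_cons_self ..)
  · exact (le_sup_right : of ⟨_, B, r⟩ ≤ _) fun Ξ κ => .hyp (List.mem_cons_self ..)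

theorem of_imp (A B : Fm Γ) (r : PEnv Γ) : of ⟨_, A ⇛ B, r⟩ = of ⟨_, A, r⟩ ⇨ of ⟨_, B, r⟩ := by
  refine le_antisymm (le_himp_iff.2 fun L h Ξ κ => ?_) (fun L h Ξ κ => .impI ?_)
  · exact .impE ((mem_inf.1 h).1 Ξ κ) ((mem_inf.1 h).2 Ξ κ)
  -- Implication is evaluated at the world enlarged by its own premise, where that premise is
  -- derivable.
  · have h₁ := (of ⟨_, A, r⟩ ⇨ of ⟨_, B, r⟩).1.lower (World.cons_le ⟨_, A, r⟩ L) h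
    have h₂ : L.cons ⟨_, A, r⟩ ∈ (of ⟨_, A, r⟩).1 := fun Ξ κ => .hyp (List.mem_cons_self ..)
    exact (himp_inf_le : (of ⟨_, A, r⟩ ⇨ of ⟨_, B, r⟩) ⊓ _ ≤ _) (mem_inf.2 ⟨h₁, h₂⟩) Ξ κ

theorem of_all (A : Fm (σ :: Γ)) (r : PEnv Γ) :
    of ⟨_, .all σ A, r⟩ = ⨅ t : PT σ, of ⟨_, A, r.cons t⟩ :=
  le_antisymm (le_iInf fun t _ h => entails_all.1 h t)
    fun _ h => entails_all.2 fun t => (iInf_le (fun t => of ⟨_, A, r.cons t⟩) t) h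

theorem of_ex (A : Fm (σ :: Γ)) (r : PEnv Γ) :
    of ⟨_, .ex σ A, r⟩ = ⨆ t : PT σ, of ⟨_, A, r.cons t⟩ := by
  refine le_antisymm (fun L h => mem_of _ fun K hK C hC => ?_) (iSup_le fun t L h Ξ κ => ?_)
  · refine entails_ex_elim (h.mono hK) fun t => hC (K.cons _) (World.cons_le _ _) ?_
    exact (le_iSup (fun t => of ⟨_, A, r.cons t⟩) t) fun Ξ κ => .hyp (List.mem_cons_self ..)
  · have := h Ξ κ
    rw [Clo.cons_at] at this
    exact .exI _ this

end Truth

/-! #### The generic structure -/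

def PT.Eqv {σ : Ty} (t s : PT σ) : Prop :=
  ∀ (Ξ : List Ty) (κ : Val Ξ), Prov Ax [] (t.at κ ≐ s.at κ)

namespace PT.Eqv

variable {σ τ : Ty}

theorem ap {f g : PT (σ ⇒ τ)} {a b : PT σ} (h : f.Eqv g) (h' : a.Eqv b) :
    (f.app a).Eqv (g.app b) :=
  fun Ξ κ => .impE (.impE (.ax (.congr ..)) (h Ξ κ)) (h' Ξ κ)

end PT.Eqv

instance PT.setoid (σ : Ty) : Setoid (PT σ) where
  r := PT.Eqv
  iseqv :=
    { refl := fun _ _ _ => .ax (.refl _)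
      symm := fun h Ξ κ => .impE (.ax (.symm ..)) (h Ξ κ)
      trans := fun h h' Ξ κ => .impE (.impE (.ax (.trans ..)) (h Ξ κ)) (h' Ξ κ) }

/-- The truth value of an equation between terms with parameters. -/
def eqTruth {σ : Ty} (t s : PT σ) : Truth :=
  .of ⟨[σ, σ], v1 ≐ v0, (PEnv.nil.cons t).cons s⟩

theorem mem_eqTruth {σ : Ty} {t s : PT σ} {L : World} : L ∈ (eqTruth t s).1 ↔
    ∀ (Ξ : List Ty) (κ : Val Ξ), Prov Ax (L.map (Clo.at κ)) (t.at κ ≐ s.at κ) := Iff.rfl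

theorem eqTruth_le {σ : Ty} {t s t' s' : PT σ} (h : t.Eqv t') (h' : s.Eqv s') :
    eqTruth t s ≤ eqTruth t' s' := fun L hL => mem_eqTruth.2 fun Ξ κ => by
  have e₁ := (h Ξ κ).mono (List.nil_subset (L.map (Clo.at κ)))
  have e₂ := (h' Ξ κ).mono (List.nil_subset (L.map (Clo.at κ)))
  exact .impE (.impE (.ax (.trans ..)) (.impE (.ax (.symm ..)) e₁))
    (.impE (.impE (.ax (.trans ..)) (mem_eqTruth.1 hL Ξ κ)) e₂)

/-- The generic model: terms with parameters up to provable equality. -/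
def generic : Str Truth where
  D σ := Quotient (PT.setoid σ)
  ap := Quotient.map₂ PT.app fun _ _ h _ _ h' => PT.Eqv.ap h h'
  con c := Quotient.mk _ (.con c)
  dom _ := ⊤
  eq := Quotient.lift₂ eqTruth fun _ _ _ _ h h' => le_antisymm (eqTruth_le h h')
    (eqTruth_le (Setoid.symm h) (Setoid.symm h'))

namespace generic

open Str

variable {Γ : List Ty} {σ τ : Ty}

def ofPT (t : PT σ) : generic.D σ := Quotient.mk _ t

def env (r : PEnv Γ) : generic.Env Γ := fun σ x => ofPT (r σ x)

theorem env_cons (r : PEnv Γ) (t : PT σ) : env (r.cons t) = (env r).cons (ofPT t) := by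
  funext τ x; cases x <;> rfl

theorem exists_ofPT (d : generic.D σ) : ∃ t, ofPT t = d := Quotient.exists_rep d

theorem exists_env (γ : generic.Env Γ) : ∃ r, env r = γ :=
  ⟨fun σ x => (γ σ x).out, by funext σ x; exact Quotient.out_eq _⟩

theorem eval_env (r : PEnv Γ) (t : Tm Γ σ) : eval (env r) t = ofPT (t.toPT r) := by
  induction t with
  | var x => rfl
  | con c => rfl
  | app t s iht ihs => rw [eval_app, iht, ihs]; rfl

/-- The truth lemma of the completeness argument: each connective on closed sets matches its
introduction and elimination rules. The extent is `⊤`, so that relativized quantifiers become meets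
and joins over all terms with parameters. -/
theorem sem_env (A : Fm Γ) (r : PEnv Γ) : sem A (env r) = Truth.of ⟨Γ, A, r⟩ := by
  induction A with
  | eq s t =>
    rw [sem_eq, eval_env, eval_env]
    refine forces_iff fun a => forall_congr' fun L => forall_congr' fun _ => ?_
    refine forall_congr' fun Ξ => forall_congr' fun κ => ?_
    change Prov _ _ ((s.toPT r).at κ ≐ (t.toPT r).at κ) ↔ _
    rw [Tm.toPT_at, Tm.toPT_at]; rfl
  | bot => exact (Truth.of_bot r).symm
  | and A B ihA ihB => rw [sem_and, ihA, ihB, Truth.of_and]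
  | or A B ihA ihB => rw [sem_or, ihA, ihB, Truth.of_or]
  | imp A B ihA ihB => rw [sem_imp, ihA, ihB, Truth.of_imp]
  | all σ A ih =>
    rw [Truth.of_all, sem_all]
    simp only [← ih, env_cons]
    refine le_antisymm (le_iInf fun t => (iInf_le _ (ofPT t)).trans ?_) (le_iInf fun d => ?_)
    · exact (top_himp (α := Truth)).le
    · obtain ⟨t, rfl⟩ := exists_ofPT d
      exact (iInf_le _ t).trans (top_himp (α := Truth)).ge
  | ex σ A ih =>
    rw [Truth.of_ex, sem_ex]
    simp only [← ih, env_cons]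
    refine le_antisymm (iSup_le fun d => ?_) (iSup_le fun t => le_trans ?_ (le_iSup _ (ofPT t)))
    · obtain ⟨t, rfl⟩ := exists_ofPT d
      exact inf_le_right.trans (le_iSup (fun t => sem A ((env r).cons (ofPT t))) t)
    · exact le_inf le_top le_rfl

theorem nil_mem_top : ([] : List Clo) ∈ (⊤ : Truth).1 :=
  (le_top : Truth.of ⟨[], .imp .bot .bot, PEnv.nil⟩ ≤ ⊤) fun _ _ =>
    .impI (.hyp (List.mem_cons_self ..))

theorem prov_of_sem {A : Fm []} {γ : generic.Env []} (h : ⊤ ≤ sem A γ) : Prov Ax [] A := by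
  rw [Env.eq_nil γ, ← Env.eq_nil (env PEnv.nil), sem_env] at h
  -- The empty list of assumptions lies in `⊤`. A sentence contains no parameters, so any
  -- replacement by closed terms serves; the default terms supply one.
  have key : Prov Ax [] (A.subst (PEnv.at (fun σ _ => dfl σ) PEnv.nil)) := h nil_mem_top [] _
  have e : (PEnv.at (fun σ _ => dfl σ) PEnv.nil : Sub [] []) = Sub.id [] := by
    funext σ x; cases x
  rwa [e, Fm.subst_id] at key

theorem eq_of_top_le {a b : generic.D σ} (h : ⊤ ≤ generic.eq a b) : a = b := by
  obtain ⟨t, rfl⟩ := exists_ofPT a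
  obtain ⟨s, rfl⟩ := exists_ofPT b
  exact Quotient.sound fun Ξ κ => mem_eqTruth.1 (h nil_mem_top) Ξ κ

end generic

-- The generic structure is a model

theorem Fm.inst_subst {Γ Δ : List Ty} {σ : Ty} (A : Fm (σ :: Γ)) (t : Tm Γ σ) (θ : Sub Γ Δ) :
    (A.inst t).subst θ = (A.subst (θ.lift σ)).inst (t.subst θ) := by
  rw [Fm.inst, Fm.inst, Fm.subst_subst, Fm.subst_subst, Sub.lift_comp_cons, Sub.comp_id]
  congr 1
  funext τ x; cases x <;> rfl

theorem Fm.substSucc_subst {Γ Δ : List Ty} (A : Fm (Ty.N :: Γ)) (θ : Sub Γ Δ) :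
    A.substSucc.subst (θ.lift Ty.N) = (A.subst (θ.lift Ty.N)).substSucc := by
  rw [Fm.substSucc, Fm.substSucc, Fm.subst_subst, Fm.subst_subst, Sub.lift_comp_cons]
  congr 1
  funext τ x; cases x <;> rfl

/-- The axioms are schemata in their free terms, hence closed under substitution. This makes them
true in the generic model at every assignment, where variables take terms with parameters as values.
-/
theorem Ax.subst {Γ Δ : List Ty} {A : Fm Γ} (hA : Ax A) (θ : Sub Γ Δ) : Ax (A.subst θ) := by
  cases hA with
  | refl a => exact .refl _
  | symm a b => exact .symm _ _
  | trans a b c => exact .trans _ _ _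
  | congr f g a b => exact .congr _ _ _ _
  | k a b => exact .k _ _
  | s a b c => exact .s _ _ _
  | fst a b => exact .fst _ _
  | snd a b => exact .snd _ _
  | caseInl f g a => exact .caseInl _ _ _
  | caseInr f g b => exact .caseInr _ _ _
  | recZero a b => exact .recZero _ _
  | recSucc a b n => exact .recSucc _ _ _
  | succNeZero n => exact .succNeZero _
  | succInj m n => exact .succInj _ _
  | ind A =>
    have := Ax.ind (A.subst (θ.lift Ty.N))
    rw [← Fm.substSucc_subst] at this
    simp only [Fm.subst, Fm.inst_subst]
    exact this
  | @extArr σ τ f g =>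
    have := Ax.extArr (f.subst θ) (g.subst θ)
    rw [← Tm.wk_subst_lift, ← Tm.wk_subst_lift] at this
    exact this
  | extProd x => exact .extProd _
  | extSum x =>
    have := Ax.extSum (x.subst θ)
    rw [← Tm.wk_subst_lift, ← Tm.wk_subst_lift] at this
    exact this

namespace generic

open Str

variable {Γ : List Ty} {σ τ : Ty}

theorem sem_ax {A : Fm Γ} (hA : Ax A) (γ : generic.Env Γ) {p : Truth} : p ≤ sem A γ := by
  obtain ⟨r, rfl⟩ := exists_env γ
  rw [sem_env]
  exact fun L _ Ξ κ => .ax (hA.subst _)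

/-- Each law is the corresponding axiom at distinct variables. The laws required as identities
follow since equations of value `⊤` are provable and provably equal terms have been identified. -/
instance : IsModel generic where
  dom_con _ := le_rfl
  dom_ap _ _ := le_top
  k a b := eq_of_top_le (sem_ax (.k v1 v0) ((Env.nil.cons a).cons b))
  s a b c := eq_of_top_le (sem_ax (.s v2 v1 v0) (((Env.nil.cons a).cons b).cons c))
  fst_pair a b := eq_of_top_le (sem_ax (.fst v1 v0) ((Env.nil.cons a).cons b))
  snd_pair a b := eq_of_top_le (sem_ax (.snd v1 v0) ((Env.nil.cons a).cons b))
  case_inl a b c := eq_of_top_le (sem_ax (.caseInl v2 v1 v0) (((Env.nil.cons a).cons b).cons c))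
  case_inr a b c := eq_of_top_le (sem_ax (.caseInr v2 v1 v0) (((Env.nil.cons a).cons b).cons c))
  iter_zro a b := eq_of_top_le (sem_ax (.recZero v1 v0) ((Env.nil.cons a).cons b))
  iter_suc a b c := eq_of_top_le (sem_ax (.recSucc v2 v1 v0) (((Env.nil.cons a).cons b).cons c))
  eq_refl {_ a _} _ := sem_ax (.refl v0) (Env.nil.cons a)
  eq_symm {_ a b _} _ _ h := forces_mp (sem_ax (.symm v1 v0) ((Env.nil.cons a).cons b)) h
  eq_trans {_ a b c _} _ _ _ h h' := forces_mp (forces_mp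
    (sem_ax (.trans v2 v1 v0) (((Env.nil.cons a).cons b).cons c)) h) h'
  eq_ap {_ _ f g a b _} _ _ _ _ h h' := forces_mp (forces_mp
    (sem_ax (.congr v3 v2 v1 v0) ((((Env.nil.cons f).cons g).cons a).cons b)) h) h'
  suc_ne_zro {n _} _ h := forces_mp (sem_ax (.succNeZero v0) (Env.nil.cons n)) h
  suc_inj {m n _} _ _ h := forces_mp (sem_ax (.succInj v1 v0) ((Env.nil.cons m).cons n)) h
  ind A γ p _ h₀ h₁ n hn := by
    have h := sem_ax (.ind A) γ (p := p)
    simp only [sem_imp, sem_inst, eval_zro, sem_all, Fm.substSucc, sem_subst, evalSub_cons,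
      evalSub_shift] at h
    refine forces_all_dom_elim (forces_mp (forces_mp h h₀) ?_) hn
    exact forces_all_dom fun n q hq hn => forces_himp fun r hr h =>
      h₁ n r (hr.trans hq) (hr.trans hn) h
  ext_arr {_ _ f g p} _ _ h := by
    refine forces_mp (sem_ax (.extArr v1 v0) ((Env.nil.cons f).cons g)) ?_
    exact forces_all_dom h
  ext_prod {_ _ x p} _ := sem_ax (.extProd v0) (Env.nil.cons x)
  ext_sum {_ _ x p} _ := sem_ax (.extSum v0) (Env.nil.cons x)

end generic

end EHA

namespace EHA
namespace Str

variable {H : Type} [Order.Frame H]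

/-- A model in which everything exists and equality is strict. -/
class IsTotal (M : Str H) : Prop extends IsModel M where
  dom_eq {σ : Ty} (d : M.D σ) : M.dom d = ⊤
  eq_of_top_le {σ : Ty} {a b : M.D σ} : ⊤ ≤ M.eq a b → a = b

instance : IsTotal generic where
  dom_eq _ := rfl
  eq_of_top_le := generic.eq_of_top_le

variable {M : Str H} [IsTotal M] {Γ Δ : List Ty} {σ τ ρ α β : Ty} {p q : H}

/-! ### Equality in total models -/

theorem total (d : M.D σ) : p ≤ M.dom d := by rw [IsTotal.dom_eq]; exact le_top

theorem erefl (a : M.D σ) : p ≤ M.eq a a := IsModel.eq_refl (total a)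

theorem eq_self (a : M.D σ) : M.eq a a = ⊤ := top_le_iff.1 (erefl a)

theorem esymm {a b : M.D σ} (h : p ≤ M.eq a b) : p ≤ M.eq b a :=
  IsModel.eq_symm (total _) (total _) h

theorem eq_comm (a b : M.D σ) : M.eq a b = M.eq b a :=
  forces_iff fun _ => ⟨esymm, esymm⟩

theorem etrans {a b c : M.D σ} (h : p ≤ M.eq a b) (h' : p ≤ M.eq b c) : p ≤ M.eq a c :=
  IsModel.eq_trans (total _) (total _) (total _) h h'

theorem eap {f g : M.D (σ ⇒ τ)} {a b : M.D σ} (h : p ≤ M.eq f g) (h' : p ≤ M.eq a b) :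
    p ≤ M.eq (f ⋆ a) (g ⋆ b) :=
  IsModel.eq_ap (total _) (total _) (total _) (total _) h h'

attribute [simp] IsTotal.dom_eq

theorem agree_of {γ δ : M.Env Γ} (h : ∀ σ x, p ≤ M.eq (γ σ x) (δ σ x)) : Agree p γ δ :=
  ⟨fun _ _ => total _, fun _ _ => total _, h⟩

/-! ### Functions and predicates that respect equality -/

@[fun_prop]
-- Local equality, with a value below `⊤`, does not permit rewriting. The predicates `CongT`,
-- `CongE` and `Cong` express substitutivity, and `fun_prop` proves them from the shape of an
-- expression.
def CongT (f : M.D σ → M.D τ) : Prop := ∀ a b, M.eq a b ≤ M.eq (f a) (f b)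

@[fun_prop]
def CongE (f : M.D σ → M.Env Γ) : Prop := ∀ a b τ x, M.eq a b ≤ M.eq (f a τ x) (f b τ x)

@[fun_prop]
def Cong (F : M.D σ → H) : Prop := ∀ a b, M.eq a b ⊓ F a ≤ F b

@[fun_prop] theorem CongT.id : CongT (M := M) (σ := σ) (fun x => x) := fun _ _ => le_rfl
@[fun_prop] theorem CongT.const (c : M.D τ) : CongT (σ := σ) (fun _ => c) := fun _ _ => erefl c
@[fun_prop] theorem CongT.ap {f : M.D σ → M.D (α ⇒ τ)} {g : M.D σ → M.D α} (hf : CongT f)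
    (hg : CongT g) : CongT fun x => f x ⋆ g x := fun a b => eap (hf a b) (hg a b)
@[fun_prop] theorem CongE.const (γ : M.Env Γ) : CongE (σ := σ) (fun _ => γ) :=
  fun _ _ _ _ => erefl _
@[fun_prop] theorem CongE.cons {f : M.D σ → M.Env Γ} {g : M.D σ → M.D τ} (hf : CongE f)
    (hg : CongT g) : CongE fun x => (f x).cons (g x) := fun a b _ x => by
  cases x with
  | zero => exact hg a b
  | succ x => exact hf a b _ x
@[fun_prop] theorem CongT.eval {f : M.D σ → M.Env Γ} (hf : CongE f) (t : Tm Γ τ) :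
    CongT fun x => eval (f x) t := fun a b => (agree_of (hf a b)).eval t

@[fun_prop] theorem CongT.case {f : M.D σ → M.D (α ⇒ τ)} {g : M.D σ → M.D (β ⇒ τ)}
    {h : M.D σ → M.D (α ⊞ β)} (hf : CongT f) (hg : CongT g) (hh : CongT h) :
    CongT fun x => case (f x) (g x) (h x) := .ap (.ap (.ap (.const _) hf) hg) hh
@[fun_prop] theorem CongT.iter {f : M.D σ → M.D τ} {g : M.D σ → M.D (.N ⇒ τ ⇒ τ)}
    {h : M.D σ → M.D .N} (hf : CongT f) (hg : CongT g) (hh : CongT h) :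
    CongT fun x => iter (f x) (g x) (h x) := .ap (.ap (.ap (.const _) hf) hg) hh

theorem Cong.le {F : M.D σ → H} (hF : Cong F) {a b : M.D σ} (h : p ≤ M.eq a b) (ha : p ≤ F a) :
    p ≤ F b := (le_inf h ha).trans (hF a b)

@[fun_prop] theorem Cong.const (c : H) : Cong (M := M) (σ := σ) (fun _ => c) :=
  fun _ _ => inf_le_right
@[fun_prop] theorem Cong.eq {f g : M.D σ → M.D τ} (hf : CongT f) (hg : CongT g) :
    Cong fun x => M.eq (f x) (g x) := fun a b =>
  etrans (esymm (inf_le_left.trans (hf a b)))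
    (etrans inf_le_right (inf_le_left.trans (hg a b)))
@[fun_prop] theorem Cong.inf {F G : M.D σ → H} (hF : Cong F) (hG : Cong G) :
    Cong fun x => F x ⊓ G x := fun _ _ =>
  le_inf (hF.le inf_le_left (inf_le_right.trans inf_le_left))
    (hG.le inf_le_left (inf_le_right.trans inf_le_right))
@[fun_prop] theorem Cong.sup {F G : M.D σ → H} (hF : Cong F) (hG : Cong G) :
    Cong fun x => F x ⊔ G x := fun a b => by
  rw [inf_sup_left]
  exact sup_le ((hF a b).trans le_sup_left) ((hG a b).trans le_sup_right)
@[fun_prop] theorem Cong.himp {F G : M.D σ → H} (hF : Cong F) (hG : Cong G) :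
    Cong fun x => F x ⇨ G x := fun _ _ => forces_himp fun _ hq h =>
  hG.le (hq.trans inf_le_left) (forces_mp (hq.trans inf_le_right)
    (hF.le (esymm (hq.trans inf_le_left)) h))
@[fun_prop] theorem Cong.compl {F : M.D σ → H} (hF : Cong F) : Cong fun x => (F x)ᶜ := by
  simp only [← himp_bot]; fun_prop
@[fun_prop] theorem Cong.iSup {ι : Type} {F : M.D σ → ι → H} (hF : ∀ i, Cong fun x => F x i) :
    Cong fun x => ⨆ i, F x i := fun a b => by
  rw [inf_iSup_eq]
  exact iSup_le fun i => (hF i a b).trans (le_iSup (F b) i)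
@[fun_prop] theorem Cong.sem {f : M.D σ → M.Env Γ} (hf : CongE f) (A : Fm Γ) :
    Cong fun x => sem A (f x) := fun a b =>
  (agree_of fun τ x => inf_le_left.trans (hf a b τ x)).sem inf_le_right

/-- Predicates defined by formulas. -/
def Dfn (F : M.D σ → H) : Prop :=
  ∃ (Γ : List Ty) (A : Fm (σ :: Γ)) (γ : M.Env Γ), ∀ d, sem A (γ.cons d) = F d

theorem nat_ind {F : M.D .N → H} (hF : Dfn F) (h₀ : p ≤ F zro)
    (h₁ : ∀ n, ∀ q ≤ p, q ≤ F n → q ≤ F (suc n)) (n : M.D .N) : p ≤ F n := by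
  obtain ⟨Γ, A, γ, hA⟩ := hF
  simp only [← hA] at h₀ h₁ ⊢
  exact IsModel.ind A γ (fun _ _ => total _) h₀ (fun n q hq _ => h₁ n q hq) n (total n)

/-- Induction is spent once, on the formula "`n` is zero or a successor". Afterwards `F` need only
respect equality and need not be definable. -/
theorem nat_cases {F : M.D .N → H} (hF : Cong F) (h₀ : p ≤ F zro) (h₁ : ∀ n, p ≤ F (suc n))
    (n : M.D .N) : p ≤ F n := by
  have key : p ≤ M.eq n zro ⊔ ⨆ m, M.eq n (suc m) := by
    refine nat_ind (F := fun n => M.eq n zro ⊔ ⨆ m, M.eq n (suc m))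
      ⟨[], (v0 ≐ EHA.zro) ⋎ .ex .N (v1 ≐ EHA.suc v0), Env.nil, fun d => by simp⟩ ?_ ?_ n
    · exact le_sup_of_le_left (erefl _)
    · exact fun n q _ _ => le_sup_of_le_right (forces_exists n (erefl _))
  refine forces_or key (fun q hq h => hF.le (esymm h) (hq.trans h₀)) fun q hq h => ?_
  exact forces_ex h fun m r hr h => hF.le (esymm h) ((hr.trans hq).trans (h₁ m))

theorem sum_cases {F : M.D (σ ⊞ τ) → H} (hF : Cong F) (h₁ : ∀ u, p ≤ F (inl u))
    (h₂ : ∀ v, p ≤ F (inr v)) (x : M.D (σ ⊞ τ)) : p ≤ F x := by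
  refine forces_or (IsModel.ext_sum (total x)) (fun q hq h => ?_) (fun q hq h => ?_)
  · exact forces_ex_dom h fun m r hr _ h => hF.le (esymm h) ((hr.trans hq).trans (h₁ m))
  · exact forces_ex_dom h fun m r hr _ h => hF.le (esymm h) ((hr.trans hq).trans (h₂ m))

theorem suc_ne {n : M.D .N} : M.eq (suc n) zro = ⊥ :=
  le_bot_iff.1 (IsModel.suc_ne_zro (total n) le_rfl)

theorem ne_suc {n : M.D .N} : M.eq zro (suc n) = ⊥ := by rw [eq_comm, suc_ne]

theorem eq_suc {m n : M.D .N} : M.eq (suc m) (suc n) = M.eq m n :=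
  forces_iff fun _ => ⟨IsModel.suc_inj (total _) (total _), fun h => eap (erefl _) h⟩

theorem eq_inl_inl {a b : M.D σ} : M.eq (inl (τ := τ) a) (inl b) = M.eq a b := by
  refine forces_iff fun q => ⟨fun h => ?_, fun h => eap (erefl _) h⟩
  -- A left inverse of `inl`; on the other summand it takes the arbitrary value `a`.
  let f : M.D ((σ ⊞ τ) ⇒ σ) := eval (Env.nil.cons a) (lam (cases v0 v0 v2))
  have := eap (erefl f) h
  simpa [f] using this

theorem eq_inr_inr {a b : M.D τ} : M.eq (inr (σ := σ) a) (inr b) = M.eq a b := by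
  refine forces_iff fun q => ⟨fun h => ?_, fun h => eap (erefl _) h⟩
  let f : M.D ((σ ⊞ τ) ⇒ τ) := eval (Env.nil.cons a) (lam (cases v0 v2 v0))
  have := eap (erefl f) h
  simpa [f] using this

theorem eq_inl_inr {a : M.D σ} {b : M.D τ} : M.eq (inl a) (inr b) = ⊥ := by
  refine le_bot_iff.1 ?_
  let f : M.D ((σ ⊞ τ) ⇒ .N) := eval Env.nil (lam (cases v0 (EHA.suc EHA.zro) EHA.zro))
  have := eap (erefl f) (le_refl (M.eq (inl a) (inr b)))
  simpa [f, suc_ne] using this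

theorem eq_inr_inl {a : M.D σ} {b : M.D τ} : M.eq (inr b) (inl a) = ⊥ := by
  rw [eq_comm, eq_inl_inr]

theorem iSup_eq_inf {F : M.D σ → H} (hF : Cong F) (a : M.D σ) : ⨆ b, M.eq a b ⊓ F b = F a := by
  refine le_antisymm (iSup_le fun b => ?_) (forces_exists a (le_inf (erefl a) le_rfl))
  rw [eq_comm]; exact hF b a

/-! ### Truth values of `dom` and `app` -/

/-- The counterpart of `Apart` with truth values in place of formulas. All elements of a total model
exist, so the clauses for quantifiers need no guards. -/
structure SApart (M : Str H) (α β : Ty) where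
  dom : M.D α → H
  app : M.D α → M.D α → M.D β → H

namespace SApart

variable {a m b n : Ty}

def nat : SApart M .N .N where
  dom x := M.eq x x
  app x y _ := (M.eq x y)ᶜ

def domProd (P : SApart M a m) (Q : SApart M b n) (x : M.D (a ⊠ b)) : H :=
  P.dom (fst x) ⊓ Q.dom (snd x)

def prod (P : SApart M a m) (Q : SApart M b n) : SApart M (a ⊠ b) (m ⊞ n) where
  dom := P.domProd Q
  app x y z := ((⨆ u, M.eq z (inl u) ⊓ P.app (fst x) (fst y) u) ⊔
    ⨆ u, M.eq z (inr u) ⊓ Q.app (snd x) (snd y) u) ⊓ (P.domProd Q x ⊓ P.domProd Q y)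

def domSum (P : SApart M a m) (Q : SApart M b n) (x : M.D (a ⊞ b)) : H :=
  (⨆ u, M.eq x (inl u) ⊓ P.dom u) ⊔ ⨆ u, M.eq x (inr u) ⊓ Q.dom u

def sum (P : SApart M a m) (Q : SApart M b n) : SApart M (a ⊞ b) (m ⊠ n) where
  dom := P.domSum Q
  app x y z := ((⨆ u, ⨆ v, (M.eq x (inl u) ⊓ M.eq y (inr v)) ⊔ (M.eq x (inr v) ⊓ M.eq y (inl u))) ⊔
    ((⨆ u, ⨆ v, M.eq x (inl u) ⊓ (M.eq y (inl v) ⊓ P.app u v (fst z))) ⊔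
    ⨆ u, ⨆ v, M.eq x (inr u) ⊓ (M.eq y (inr v) ⊓ Q.app u v (snd z)))) ⊓
    (P.domSum Q x ⊓ P.domSum Q y)

def domArr (P : SApart M a m) (Q : SApart M b n) (x : M.D ((a ⇒ b) ⊠ (a ⇒ a ⇒ n ⇒ m))) : H :=
  (⨅ u, P.dom u ⇨ Q.dom (fst x ⋆ u)) ⊓
  ⨅ u, ⨅ v, ⨅ w, P.dom u ⇨ (P.dom v ⇨ (Q.app (fst x ⋆ u) (fst x ⋆ v) w ⇨
    P.app u v (snd x ⋆ u ⋆ v ⋆ w)))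

def arr (P : SApart M a m) (Q : SApart M b n) :
    SApart M ((a ⇒ b) ⊠ (a ⇒ a ⇒ n ⇒ m)) (a ⊠ n) where
  dom := P.domArr Q
  app x y z := P.dom (fst z) ⊓ (Q.app (fst x ⋆ fst z) (fst y ⋆ fst z) (snd z) ⊓
    (P.domArr Q x ⊓ P.domArr Q y))

end SApart

def sapart (M : Str H) : (σ : Ty) → SApart M σ.plus σ.minus
  | .N => .nat
  | .prod σ τ => (sapart M σ).prod (sapart M τ)
  | .sum σ τ => (sapart M σ).sum (sapart M τ)
  | .arr σ τ => (sapart M σ).arr (sapart M τ)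

/-- The formulas of `P` have the truth values `S`. -/
structure Interprets {a m : Ty} (P : Apart a m) (S : SApart M a m) : Prop where
  dom {Γ : List Ty} (γ : M.Env Γ) (t : Tm Γ a) : sem (P.dom t) γ = S.dom (eval γ t)
  app {Γ : List Ty} (γ : M.Env Γ) (s t : Tm Γ a) (r : Tm Γ m) :
    sem (P.app s t r) γ = S.app (eval γ s) (eval γ t) (eval γ r)

namespace Interprets

variable {a m b n : Ty} {P : Apart a m} {Q : Apart b n} {S : SApart M a m} {T : SApart M b n}

theorem nat : Interprets (M := M) Apart.nat SApart.nat where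
  dom _ _ := rfl
  app _ _ _ _ := sem_neg ..

theorem domProd (hP : Interprets P S) (hQ : Interprets Q T) (γ : M.Env Γ) (t : Tm Γ (a ⊠ b)) :
    sem (P.domProd Q t) γ = S.domProd T (eval γ t) := by
  simp [Apart.domProd, SApart.domProd, hP.dom, hQ.dom]

theorem prod (hP : Interprets P S) (hQ : Interprets Q T) : Interprets (P.prod Q) (S.prod T) where
  dom := hP.domProd hQ
  app γ s t r := by
    simp only [Apart.prod, SApart.prod, sem_and, domProd hP hQ]
    simp [hP.app, hQ.app]

theorem domSum (hP : Interprets P S) (hQ : Interprets Q T) (γ : M.Env Γ) (t : Tm Γ (a ⊞ b)) :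
    sem (P.domSum Q t) γ = S.domSum T (eval γ t) := by
  simp [Apart.domSum, SApart.domSum, hP.dom, hQ.dom]

theorem sum (hP : Interprets P S) (hQ : Interprets Q T) : Interprets (P.sum Q) (S.sum T) where
  dom := hP.domSum hQ
  app γ s t r := by
    simp only [Apart.sum, SApart.sum, sem_and, domSum hP hQ]
    simp [hP.app, hQ.app]

theorem domArr (hP : Interprets P S) (hQ : Interprets Q T) (γ : M.Env Γ)
    (t : Tm Γ ((a ⇒ b) ⊠ (a ⇒ a ⇒ n ⇒ m))) :
    sem (P.domArr Q t) γ = S.domArr T (eval γ t) := by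
  simp [Apart.domArr, SApart.domArr, hP.dom, hQ.dom, hP.app, hQ.app]

theorem arr (hP : Interprets P S) (hQ : Interprets Q T) : Interprets (P.arr Q) (S.arr T) where
  dom := hP.domArr hQ
  app γ s t r := by
    simp only [Apart.arr, SApart.arr, sem_and, domArr hP hQ]
    simp [hQ.app, hP.dom]

end Interprets

theorem sem_apart (σ : Ty) : Interprets (apart σ) (sapart M σ) := by
  induction σ with
  | N => exact .nat
  | prod σ τ ihσ ihτ => exact ihσ.prod ihτ
  | sum σ τ ihσ ihτ => exact ihσ.sum ihτ
  | arr σ τ ihσ ihτ => exact ihσ.arr ihτ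

/-- The truth value of `dom`. -/
def Dm (σ : Ty) (x : M.D σ.plus) : H := (sapart M σ).dom x

/-- The truth value of `app`. -/
def Ap (σ : Ty) (x y : M.D σ.plus) (z : M.D σ.minus) : H := (sapart M σ).app x y z

@[simp] theorem sem_dom (γ : M.Env Γ) (t : Tm Γ σ.plus) :
    sem ((apart σ).dom t) γ = Dm σ (eval γ t) := (sem_apart σ).dom γ t

@[simp] theorem sem_app (γ : M.Env Γ) (s t : Tm Γ σ.plus) (r : Tm Γ σ.minus) :
    sem ((apart σ).app s t r) γ = Ap σ (eval γ s) (eval γ t) (eval γ r) :=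
  (sem_apart σ).app γ s t r

theorem dm_eq_sem (x : M.D σ.plus) :
    Dm σ x = sem ((apart σ).dom v0) (Env.nil.cons x) := by simp

theorem ap_eq_sem (x y : M.D σ.plus) (z : M.D σ.minus) :
    Ap σ x y z = sem ((apart σ).app v2 v1 v0) (((Env.nil.cons x).cons y).cons z) := by simp

@[fun_prop] theorem Cong.dm {f : M.D α → M.D σ.plus} (hf : CongT f) : Cong fun x => Dm σ (f x) := by
  simp only [dm_eq_sem]; fun_prop

@[fun_prop] theorem Cong.ap {f g : M.D α → M.D σ.plus} {h : M.D α → M.D σ.minus} (hf : CongT f)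
    (hg : CongT g) (hh : CongT h) : Cong fun x => Ap σ (f x) (g x) (h x) := by
  simp only [ap_eq_sem]; fun_prop

theorem ap_congr {x y x' y' : M.D σ.plus} {z z' : M.D σ.minus} (hx : p ≤ M.eq x x')
    (hy : p ≤ M.eq y y') (hz : p ≤ M.eq z z') (h : p ≤ Ap σ x y z) : p ≤ Ap σ x' y' z' := by
  have h := Cong.le (F := fun x => Ap σ x y z) (by fun_prop) hx h
  have h := Cong.le (F := fun y => Ap σ x' y z) (by fun_prop) hy h
  exact Cong.le (F := fun z => Ap σ x' y' z) (by fun_prop) hz h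

end Str
end EHA

namespace EHA
namespace Str

variable {H : Type} [Order.Frame H] {M : Str H} [IsTotal M] {σ τ ρ α β : Ty} {p q : H}

/-! ### Apartness type by type -/

@[simp] theorem dm_nat (x : M.D .N) : Dm .N x = ⊤ := eq_self x

@[simp] theorem ap_nat (x y z : M.D .N) : Ap .N x y z = (M.eq x y)ᶜ := rfl

theorem dm_prod (x : M.D (σ.plus ⊠ τ.plus)) :
    Dm (σ ⊠ τ) x = Dm σ (fst x) ⊓ Dm τ (snd x) := rfl

theorem ap_prod_inl (x y : M.D (σ.plus ⊠ τ.plus)) (u : M.D σ.minus) :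
    Ap (σ ⊠ τ) x y (inl u) =
      Ap σ (fst x) (fst y) u ⊓ (Dm (σ ⊠ τ) x ⊓ Dm (σ ⊠ τ) y) := by
  change ((⨆ v, M.eq (inl u) (inl v) ⊓ Ap σ (fst x) (fst y) v) ⊔
    ⨆ v, M.eq (inl u) (inr v) ⊓ Ap τ (snd x) (snd y) v) ⊓ _ = _
  simp only [eq_inl_inl, eq_inl_inr, bot_inf_eq, iSup_bot, sup_bot_eq]
  rw [iSup_eq_inf (by fun_prop)]
  rfl

theorem ap_prod_inr (x y : M.D (σ.plus ⊠ τ.plus)) (u : M.D τ.minus) :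
    Ap (σ ⊠ τ) x y (inr u) =
      Ap τ (snd x) (snd y) u ⊓ (Dm (σ ⊠ τ) x ⊓ Dm (σ ⊠ τ) y) := by
  change ((⨆ v, M.eq (inr u) (inl v) ⊓ Ap σ (fst x) (fst y) v) ⊔
    ⨆ v, M.eq (inr u) (inr v) ⊓ Ap τ (snd x) (snd y) v) ⊓ _ = _
  simp only [eq_inr_inr, eq_inr_inl, bot_inf_eq, iSup_bot, bot_sup_eq]
  rw [iSup_eq_inf (by fun_prop)]
  rfl

@[simp] theorem dm_inl (u : M.D σ.plus) : Dm (σ ⊞ τ) (inl u) = Dm σ u := by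
  change (⨆ v, M.eq (inl u) (inl v) ⊓ Dm σ v) ⊔ (⨆ v, M.eq (inl u) (inr v) ⊓ Dm τ v) = _
  simp only [eq_inl_inl, eq_inl_inr, bot_inf_eq, iSup_bot, sup_bot_eq]
  exact iSup_eq_inf (by fun_prop) u

@[simp] theorem dm_inr (u : M.D τ.plus) : Dm (σ ⊞ τ) (inr u) = Dm τ u := by
  change (⨆ v, M.eq (inr u) (inl v) ⊓ Dm σ v) ⊔ (⨆ v, M.eq (inr u) (inr v) ⊓ Dm τ v) = _
  simp only [eq_inr_inr, eq_inr_inl, bot_inf_eq, iSup_bot, bot_sup_eq]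
  exact iSup_eq_inf (by fun_prop) u

theorem ap_sum (x y : M.D (σ.plus ⊞ τ.plus)) (z : M.D (σ.minus ⊠ τ.minus)) : Ap (σ ⊞ τ) x y z =
    ((⨆ u, ⨆ v, (M.eq x (inl u) ⊓ M.eq y (inr v)) ⊔ (M.eq x (inr v) ⊓ M.eq y (inl u))) ⊔
    ((⨆ u, ⨆ v, M.eq x (inl u) ⊓ (M.eq y (inl v) ⊓ Ap σ u v (fst z))) ⊔
    ⨆ u, ⨆ v, M.eq x (inr u) ⊓ (M.eq y (inr v) ⊓ Ap τ u v (snd z)))) ⊓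
    (Dm (σ ⊞ τ) x ⊓ Dm (σ ⊞ τ) y) := rfl

@[simp] theorem ap_inl_inr (u : M.D σ.plus) (v : M.D τ.plus) (z : M.D (σ.minus ⊠ τ.minus)) :
    Ap (σ ⊞ τ) (inl u) (inr v) z = Dm σ u ⊓ Dm τ v := by
  rw [ap_sum]
  simp only [eq_inl_inl, eq_inl_inr, eq_inr_inr, eq_inr_inl, bot_inf_eq, inf_bot_eq, iSup_bot,
    sup_bot_eq, dm_inl, dm_inr]
  rw [inf_eq_right.2]
  exact forces_exists u (forces_exists v (by simp [eq_self]))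

@[simp] theorem ap_inr_inl (u : M.D σ.plus) (v : M.D τ.plus) (z : M.D (σ.minus ⊠ τ.minus)) :
    Ap (σ ⊞ τ) (inr v) (inl u) z = Dm τ v ⊓ Dm σ u := by
  rw [ap_sum]
  simp only [eq_inl_inl, eq_inl_inr, eq_inr_inr, eq_inr_inl, bot_inf_eq, inf_bot_eq, iSup_bot,
    sup_bot_eq, bot_sup_eq, dm_inl, dm_inr]
  rw [inf_eq_right.2]
  exact forces_exists u (forces_exists v (by simp [eq_self]))

@[simp] theorem ap_inl_inl (u v : M.D σ.plus) (z : M.D (σ.minus ⊠ τ.minus)) :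
    Ap (σ ⊞ τ) (inl u) (inl v) z = Ap σ u v (fst z) ⊓ (Dm σ u ⊓ Dm σ v) := by
  rw [ap_sum]
  simp only [eq_inl_inl, eq_inl_inr, bot_inf_eq, inf_bot_eq, iSup_bot,
    sup_bot_eq, bot_sup_eq, dm_inl, ← inf_iSup_eq]
  rw [iSup_eq_inf (F := fun a => ⨆ b, M.eq v b ⊓ Ap σ a b (fst z)) (by fun_prop),
    iSup_eq_inf (by fun_prop)]

@[simp] theorem ap_inr_inr (u v : M.D τ.plus) (z : M.D (σ.minus ⊠ τ.minus)) :
    Ap (σ ⊞ τ) (inr u) (inr v) z = Ap τ u v (snd z) ⊓ (Dm τ u ⊓ Dm τ v) := by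
  rw [ap_sum]
  simp only [eq_inr_inr, eq_inr_inl, bot_inf_eq, inf_bot_eq, iSup_bot,
    sup_bot_eq, bot_sup_eq, dm_inr, ← inf_iSup_eq]
  rw [iSup_eq_inf (F := fun a => ⨆ b, M.eq v b ⊓ Ap τ a b (snd z)) (by fun_prop),
    iSup_eq_inf (by fun_prop)]

theorem ap_arr (x y : M.D (σ ⇒ τ).plus) (z : M.D (σ.plus ⊠ τ.minus)) :
    Ap (σ ⇒ τ) x y z = Dm σ (fst z) ⊓ (Ap τ (fst x ⋆ fst z) (fst y ⋆ fst z) (snd z) ⊓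
      (Dm (σ ⇒ τ) x ⊓ Dm (σ ⇒ τ) y)) := rfl

theorem dm_arr_intro {x : M.D (σ ⇒ τ).plus}
    (h : ∀ u, ∀ q ≤ p, q ≤ Dm σ u → q ≤ Dm τ (fst x ⋆ u))
    (h' : ∀ u v w, ∀ q ≤ p, q ≤ Dm σ u → q ≤ Dm σ v → q ≤ Ap τ (fst x ⋆ u) (fst x ⋆ v) w →
      q ≤ Ap σ u v (snd x ⋆ u ⋆ v ⋆ w)) : p ≤ Dm (σ ⇒ τ) x :=
  le_inf (le_iInf fun u => forces_himp (h u)) <|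
    le_iInf fun u => le_iInf fun v => le_iInf fun w => forces_himp fun _ hq hu =>
      forces_himp fun _ hr hv => forces_himp fun s hs h => h' u v w s ((hs.trans hr).trans hq)
        ((hs.trans hr).trans hu) (hs.trans hv) h

theorem dm_ap {x : M.D (σ ⇒ τ).plus} {u : M.D σ.plus} (hx : p ≤ Dm (σ ⇒ τ) x) (hu : p ≤ Dm σ u) :
    p ≤ Dm τ (fst x ⋆ u) :=
  forces_mp (forces_all (hx.trans inf_le_left) u) hu

theorem ap_rf {x : M.D (σ ⇒ τ).plus} {u v : M.D σ.plus} {w : M.D τ.minus}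
    (hx : p ≤ Dm (σ ⇒ τ) x) (hu : p ≤ Dm σ u) (hv : p ≤ Dm σ v)
    (h : p ≤ Ap τ (fst x ⋆ u) (fst x ⋆ v) w) : p ≤ Ap σ u v (snd x ⋆ u ⋆ v ⋆ w) :=
  forces_mp (forces_mp (forces_mp
    (forces_all (forces_all (forces_all (hx.trans inf_le_right) u) v) w) hu) hv) h

/-- Evidence of apartness ends in two unequal numbers or in two different summands, and neither
occurs between an element and itself. This makes the derived equality reflexive and disposes of
impossible branches in the lifts of constants. -/
theorem ap_irrefl {x : M.D σ.plus} {z : M.D σ.minus} : Ap σ x x z = ⊥ := by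
  refine le_bot_iff.1 ?_
  induction σ with
  | N => rw [ap_nat, eq_self, compl_top]
  | prod σ τ ihσ ihτ =>
    rw [← himp_eq_top_iff, ← top_le_iff]
    refine sum_cases (F := fun z => Ap (σ ⊠ τ) x x z ⇨ ⊥) (by fun_prop) (fun u => ?_)
      (fun u => ?_) z
    · rw [top_le_iff, himp_eq_top_iff, ap_prod_inl]
      exact inf_le_left.trans ihσ
    · rw [top_le_iff, himp_eq_top_iff, ap_prod_inr]
      exact inf_le_left.trans ihτ
  | sum σ τ ihσ ihτ =>
    rw [← himp_eq_top_iff, ← top_le_iff]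
    refine sum_cases (F := fun x => Ap (σ ⊞ τ) x x z ⇨ ⊥) (by fun_prop) (fun u => ?_)
      (fun u => ?_) x
    · rw [top_le_iff, himp_eq_top_iff, ap_inl_inl]
      exact inf_le_left.trans ihσ
    · rw [top_le_iff, himp_eq_top_iff, ap_inr_inr]
      exact inf_le_left.trans ihτ
  | arr σ τ _ ihτ => exact inf_le_right.trans (inf_le_left.trans ihτ)

theorem ap_absurd {c : H} {x : M.D σ.plus} {z : M.D σ.minus} (h : p ≤ Ap σ x x z) : p ≤ c :=
  h.trans (by rw [ap_irrefl]; exact bot_le)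

/-! ### Symmetry -/

theorem ap_sy {x y : M.D σ.plus} {z : M.D σ.minus} :
    Ap σ x y z ≤ Ap σ y x (M.val (sy σ) ⋆ x ⋆ y ⋆ z) := by
  induction σ with
  | N => simp [eq_comm x y]
  | prod σ τ ihσ ihτ =>
    rw [← himp_eq_top_iff, ← top_le_iff]
    refine sum_cases (F := fun z => Ap (σ ⊠ τ) x y z ⇨ Ap (σ ⊠ τ) y x (M.val (sy (σ ⊠ τ)) ⋆ x ⋆ y ⋆ z))
      (by fun_prop) (fun u => ?_) (fun u => ?_) z
    · have e : M.val (sy (σ ⊠ τ)) ⋆ x ⋆ y ⋆ inl u = inl (M.val (sy σ) ⋆ fst x ⋆ fst y ⋆ u) := by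
        simp [val, sy]
      rw [top_le_iff, himp_eq_top_iff, e, ap_prod_inl, ap_prod_inl, inf_comm (Dm _ y)]
      exact inf_le_inf_right _ ihσ
    · have e : M.val (sy (σ ⊠ τ)) ⋆ x ⋆ y ⋆ inr u = inr (M.val (sy τ) ⋆ snd x ⋆ snd y ⋆ u) := by
        simp [val, sy]
      rw [top_le_iff, himp_eq_top_iff, e, ap_prod_inr, ap_prod_inr, inf_comm (Dm _ y)]
      exact inf_le_inf_right _ ihτ
  | sum σ τ ihσ ihτ =>
    rw [← himp_eq_top_iff, ← top_le_iff]
    refine sum_cases (F := fun x => Ap (σ ⊞ τ) x y z ⇨ Ap (σ ⊞ τ) y x (M.val (sy (σ ⊞ τ)) ⋆ x ⋆ y ⋆ z))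
      (by fun_prop) (fun u => ?_) (fun u => ?_) x
    · refine sum_cases (F := fun y => Ap (σ ⊞ τ) (inl u) y z ⇨
        Ap (σ ⊞ τ) y (inl u) (M.val (sy (σ ⊞ τ)) ⋆ inl u ⋆ y ⋆ z)) (by fun_prop) (fun v => ?_)
        (fun v => ?_) y
      · have e : M.val (sy (σ ⊞ τ)) ⋆ inl u ⋆ inl v ⋆ z =
          pair (M.val (sy σ) ⋆ u ⋆ v ⋆ fst z) (snd z) := by simp [val, sy]
        rw [top_le_iff, himp_eq_top_iff, e, ap_inl_inl, ap_inl_inl, inf_comm (Dm _ v),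
          IsModel.fst_pair]
        exact inf_le_inf_right _ ihσ
      · rw [top_le_iff, himp_eq_top_iff, ap_inl_inr, ap_inr_inl, inf_comm]
    · refine sum_cases (F := fun y => Ap (σ ⊞ τ) (inr u) y z ⇨
        Ap (σ ⊞ τ) y (inr u) (M.val (sy (σ ⊞ τ)) ⋆ inr u ⋆ y ⋆ z)) (by fun_prop) (fun v => ?_)
        (fun v => ?_) y
      · rw [top_le_iff, himp_eq_top_iff, ap_inl_inr, ap_inr_inl, inf_comm]
      · have e : M.val (sy (σ ⊞ τ)) ⋆ inr u ⋆ inr v ⋆ z =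
          pair (fst z) (M.val (sy τ) ⋆ u ⋆ v ⋆ snd z) := by simp [val, sy]
        rw [top_le_iff, himp_eq_top_iff, e, ap_inr_inr, ap_inr_inr, inf_comm (Dm _ v),
          IsModel.snd_pair]
        exact inf_le_inf_right _ ihτ
  | arr σ τ _ ihτ =>
    have e : M.val (sy (σ ⇒ τ)) ⋆ x ⋆ y ⋆ z =
        pair (fst z) (M.val (sy τ) ⋆ (fst x ⋆ fst z) ⋆ (fst y ⋆ fst z) ⋆ snd z) := by
      simp [val, sy, EHA.ap]
    rw [e, ap_arr, ap_arr, IsModel.fst_pair, IsModel.snd_pair, inf_comm (Dm _ y)]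
    exact inf_le_inf_left _ (inf_le_inf_right _ ihτ)

/-! ### Cotransitivity -/

/-- `s` is evidence that `x` and `z` are apart or that `y` and `z` are apart. -/
def Split (σ : Ty) (x y z : M.D σ.plus) (s : M.D (σ.minus ⊞ σ.minus)) : H :=
  (⨆ u, M.eq s (inl u) ⊓ Ap σ x z u) ⊔ ⨆ u, M.eq s (inr u) ⊓ Ap σ y z u

@[fun_prop] theorem Cong.split {f g h : M.D α → M.D σ.plus} {k : M.D α → M.D (σ.minus ⊞ σ.minus)}
    (hf : CongT f) (hg : CongT g) (hh : CongT h) (hk : CongT k) :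
    Cong fun x => Split σ (f x) (g x) (h x) (k x) := by
  unfold Split; fun_prop

@[simp] theorem split_inl (x y z : M.D σ.plus) (u : M.D σ.minus) :
    Split σ x y z (inl u) = Ap σ x z u := by
  simp only [Split, eq_inl_inl, eq_inl_inr, bot_inf_eq, iSup_bot, sup_bot_eq]
  exact iSup_eq_inf (by fun_prop) u

@[simp] theorem split_inr (x y z : M.D σ.plus) (u : M.D σ.minus) :
    Split σ x y z (inr u) = Ap σ y z u := by
  simp only [Split, eq_inr_inr, eq_inr_inl, bot_inf_eq, iSup_bot, bot_sup_eq]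
  exact iSup_eq_inf (by fun_prop) u

/-- Elimination rule for the output of `tr`: a case distinction on `s` may be verified separately
for evidence of either kind. -/
theorem split_case {x y z : M.D σ.plus} {s : M.D (σ.minus ⊞ σ.minus)} {F : M.D β → H}
    {f g : M.D (σ.minus ⇒ β)} (hF : Cong F) (hs : p ≤ Split σ x y z s)
    (hf : ∀ u, ∀ q ≤ p, q ≤ Ap σ x z u → q ≤ F (f ⋆ u))
    (hg : ∀ u, ∀ q ≤ p, q ≤ Ap σ y z u → q ≤ F (g ⋆ u)) : p ≤ F (case f g s) := by
  have e {a b : M.D (σ.minus ⊞ σ.minus)} : M.eq a b ≤ M.eq (case f g a) (case f g b) :=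
    eap (erefl _) le_rfl
  refine forces_or hs (fun q hq h => forces_ex h fun u r hr h => ?_)
    (fun q hq h => forces_ex h fun u r hr h => ?_)
  · refine hF.le (esymm ((h.trans inf_le_left).trans e)) ?_
    rw [IsModel.case_inl]
    exact hf u r (hr.trans hq) (h.trans inf_le_right)
  · refine hF.le (esymm ((h.trans inf_le_left).trans e)) ?_
    rw [IsModel.case_inr]
    exact hg u r (hr.trans hq) (h.trans inf_le_right)

@[simp] theorem disc_zro_zro : M.val disc ⋆ zro ⋆ zro = zro := by simp [val, disc]
@[simp] theorem disc_zro_suc (n : M.D .N) : M.val disc ⋆ zro ⋆ suc n = suc zro := by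
  simp [val, disc]
@[simp] theorem disc_suc_zro (n : M.D .N) : M.val disc ⋆ suc n ⋆ zro = suc zro := by
  simp [val, disc]
@[simp] theorem disc_suc_suc (m n : M.D .N) :
    M.val disc ⋆ suc m ⋆ suc n = M.val disc ⋆ m ⋆ n := by
  simp only [val, disc, lam_ap, eval_app, eval_recN, eval_v0, eval_v1, IsModel.iter_suc]
  congr 2

@[simp] theorem disc_self (n : M.D .N) : M.val disc ⋆ n ⋆ n = zro := by
  refine IsTotal.eq_of_top_le ?_
  refine nat_ind (F := fun n => M.eq (M.val disc ⋆ n ⋆ n) zro)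
    ⟨[], cl disc ⬝ v0 ⬝ v0 ≐ EHA.zro, Env.nil, fun d => by simp⟩ (by simp [eq_self]) ?_ n
  intro n q _ h
  simpa using h

/-- The universal quantifier over `n` stays inside the induction on `m`, because the step compares
the predecessors of both numbers. Decidability of equality of numbers follows. -/
theorem disc_cases (m n : M.D .N) : p ≤ M.eq m n ⊔ M.eq (M.val disc ⋆ m ⋆ n) (suc zro) := by
  have key : p ≤ ⨅ n, M.eq m n ⊔ M.eq (M.val disc ⋆ m ⋆ n) (suc zro) := by
    refine nat_ind (F := fun m => ⨅ n, M.eq m n ⊔ M.eq (M.val disc ⋆ m ⋆ n) (suc zro))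
      ⟨[], .all .N ((v1 ≐ v0) ⋎ (cl disc ⬝ v1 ⬝ v0 ≐ EHA.suc EHA.zro)), Env.nil,
        fun d => by simp⟩ (le_iInf fun n => ?_) (fun m q _ ih => le_iInf fun n => ?_) m
    · exact nat_cases (F := fun n => M.eq zro n ⊔ M.eq (M.val disc ⋆ zro ⋆ n) (suc zro))
        (by fun_prop) (by simp [eq_self]) (fun n => by simp [eq_self]) n
    · refine nat_cases (F := fun n => M.eq (suc m) n ⊔ M.eq (M.val disc ⋆ suc m ⋆ n) (suc zro))
        (by fun_prop) (by simp [eq_self]) (fun n => ?_) n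
      simpa [eq_suc] using forces_all ih n
  exact forces_all key n

theorem eq_or_ne (m n : M.D .N) : p ≤ M.eq m n ⊔ (M.eq m n)ᶜ := by
  refine forces_or (disc_cases m n) (fun q _ h => le_sup_of_le_left h)
    fun q _ h => le_sup_of_le_right (forces_compl fun r hr h' => ?_)
  have : r ≤ M.eq (M.val disc ⋆ m ⋆ m) (M.val disc ⋆ m ⋆ n) := eap (erefl _) h'
  rw [disc_self] at this
  exact (etrans this (hr.trans h)).trans (by rw [ne_suc])

theorem disc_of_ne {m n : M.D .N} (h : p ≤ (M.eq m n)ᶜ) :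
    p ≤ M.eq (M.val disc ⋆ m ⋆ n) (suc zro) :=
  forces_or (disc_cases m n) (fun _ hq h' => forces_absurd (hq.trans h) h') fun _ _ h => h

/-- At `N`, equality is decidable: when `x = z`, the inequality of `x` and `y` passes to `y` and
`z`. At function types the comparison is made at the point named in the evidence. Only `z` needs an
explicit hypothesis of membership in the domain. -/
theorem ap_tr {x y z : M.D σ.plus} {w : M.D σ.minus} :
    Ap σ x y w ⊓ Dm σ z ≤ Split σ x y z (M.val (tr σ) ⋆ x ⋆ y ⋆ z ⋆ w) := by
  induction σ with
  | N =>
    have e : M.val (tr .N) ⋆ x ⋆ y ⋆ z ⋆ w =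
        iter (inr w) (eval ((((Env.nil.cons x).cons y).cons z).cons w) (lam (lam (il v2))))
          (M.val disc ⋆ x ⋆ z) := by
      simp [val, tr]
    rw [e]
    refine forces_or (eq_or_ne x z) (fun q hq h => ?_) fun q hq h => ?_
    · have h' : q ≤ M.eq (M.val disc ⋆ x ⋆ z) zro := by
        have : q ≤ M.eq (M.val disc ⋆ x ⋆ x) (M.val disc ⋆ x ⋆ z) := eap (erefl _) h
        rw [disc_self] at this
        exact esymm this
      refine Cong.le (F := fun n => Split .N x y z (iter _ _ n)) (by fun_prop) (esymm h') ?_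
      rw [IsModel.iter_zro, split_inr]
      refine forces_compl fun r hr hyz => ?_
      exact forces_absurd (hr.trans (hq.trans inf_le_left)) (etrans (hr.trans h) (esymm hyz))
    · refine Cong.le (F := fun n => Split .N x y z (iter _ _ n)) (by fun_prop)
        (esymm (disc_of_ne h)) ?_
      simpa using h
  | prod σ τ ihσ ihτ =>
    rw [inf_comm, ← le_himp_iff]
    refine sum_cases (F := fun w => Ap (σ ⊠ τ) x y w ⇨
      Split (σ ⊠ τ) x y z (M.val (tr (σ ⊠ τ)) ⋆ x ⋆ y ⋆ z ⋆ w))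
      (by fun_prop) (fun u => ?_) (fun u => ?_) w
    · have e : M.val (tr (σ ⊠ τ)) ⋆ x ⋆ y ⋆ z ⋆ inl u =
          case (eval (((((Env.nil.cons x).cons y).cons z).cons (inl (τ := τ.minus) u)).cons u) (lam (il (il v0))))
            (eval (((((Env.nil.cons x).cons y).cons z).cons (inl (τ := τ.minus) u)).cons u) (lam (ir (il v0))))
            (M.val (tr σ) ⋆ fst x ⋆ fst y ⋆ fst z ⋆ u) := by simp [val, tr]
      rw [e, ap_prod_inl]
      refine forces_himp fun q hq h => ?_
      obtain ⟨h, hx, hy⟩ := le_inf_iff.1 h |>.imp_right le_inf_iff.1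
      have hz : q ≤ Dm σ (fst z) := hq.trans inf_le_left
      refine split_case (by fun_prop) ((le_inf h hz).trans ihσ) (fun v r hr h => ?_)
        (fun v r hr h => ?_)
      · simp only [lam_ap, eval_il, eval_v0, split_inl, ap_prod_inl]
        exact le_inf h (le_inf (hr.trans hx) (hr.trans hq))
      · simp only [lam_ap, eval_il, eval_ir, eval_v0, split_inr, ap_prod_inl]
        exact le_inf h (le_inf (hr.trans hy) (hr.trans hq))
    · have e : M.val (tr (σ ⊠ τ)) ⋆ x ⋆ y ⋆ z ⋆ inr u =
          case (eval (((((Env.nil.cons x).cons y).cons z).cons (inr (σ := σ.minus) u)).cons u) (lam (il (ir v0))))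
            (eval (((((Env.nil.cons x).cons y).cons z).cons (inr (σ := σ.minus) u)).cons u) (lam (ir (ir v0))))
            (M.val (tr τ) ⋆ snd x ⋆ snd y ⋆ snd z ⋆ u) := by simp [val, tr]
      rw [e, ap_prod_inr]
      refine forces_himp fun q hq h => ?_
      obtain ⟨h, hx, hy⟩ := le_inf_iff.1 h |>.imp_right le_inf_iff.1
      have hz : q ≤ Dm τ (snd z) := hq.trans inf_le_right
      refine split_case (by fun_prop) ((le_inf h hz).trans ihτ) (fun v r hr h => ?_)
        (fun v r hr h => ?_)
      · simp only [lam_ap, eval_il, eval_ir, eval_v0, split_inl, ap_prod_inr]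
        exact le_inf h (le_inf (hr.trans hx) (hr.trans hq))
      · simp only [lam_ap, eval_ir, eval_v0, split_inr, ap_prod_inr]
        exact le_inf h (le_inf (hr.trans hy) (hr.trans hq))
  | sum σ τ ihσ ihτ =>
    rw [← himp_eq_top_iff, ← top_le_iff]
    refine sum_cases (F := fun x => Ap (σ ⊞ τ) x y w ⊓ Dm (σ ⊞ τ) z ⇨
      Split (σ ⊞ τ) x y z (M.val (tr (σ ⊞ τ)) ⋆ x ⋆ y ⋆ z ⋆ w))
      (by fun_prop) (fun a => ?_) (fun a => ?_) x
    all_goals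
      refine sum_cases (F := fun y => Ap (σ ⊞ τ) _ y w ⊓ Dm (σ ⊞ τ) z ⇨
        Split (σ ⊞ τ) _ y z (M.val (tr (σ ⊞ τ)) ⋆ _ ⋆ y ⋆ z ⋆ w))
        (by fun_prop) (fun b => ?_) (fun b => ?_) y
    all_goals
      refine sum_cases (F := fun z => Ap (σ ⊞ τ) _ _ w ⊓ Dm (σ ⊞ τ) z ⇨
        Split (σ ⊞ τ) _ _ z (M.val (tr (σ ⊞ τ)) ⋆ _ ⋆ _ ⋆ z ⋆ w))
        (by fun_prop) (fun c => ?_) (fun c => ?_) z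
    all_goals rw [top_le_iff, himp_eq_top_iff]
    · have e : M.val (tr (σ ⊞ τ)) ⋆ inl a ⋆ inl b ⋆ inl c ⋆ w =
          case (eval (((((((Env.nil.cons (inl (τ := τ.plus) a)).cons (inl (τ := τ.plus) b)).cons
              (inl (τ := τ.plus) c)).cons w).cons a).cons
              c).cons b) (lam (il (pr v0 (p2 v4)))))
            (eval (((((((Env.nil.cons (inl (τ := τ.plus) a)).cons (inl (τ := τ.plus) b)).cons
              (inl (τ := τ.plus) c)).cons w).cons a).cons
              c).cons b) (lam (ir (pr v0 (p2 v4)))))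
            (M.val (tr σ) ⋆ a ⋆ b ⋆ c ⋆ fst w) := by simp [val, tr]
      rw [e, ap_inl_inl, dm_inl]
      have ha := (inf_le_left.trans (inf_le_right.trans inf_le_left) :
        (Ap σ a b (fst w) ⊓ (Dm σ a ⊓ Dm σ b)) ⊓ Dm σ c ≤ Dm σ a)
      have hb := (inf_le_left.trans (inf_le_right.trans inf_le_right) :
        (Ap σ a b (fst w) ⊓ (Dm σ a ⊓ Dm σ b)) ⊓ Dm σ c ≤ Dm σ b)
      refine split_case (by fun_prop) ((inf_le_inf_right _ inf_le_left).trans ihσ)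
        (fun v r hr h => ?_) (fun v r hr h => ?_)
      · simpa using ⟨h, hr.trans ha, hr.trans inf_le_right⟩
      · simpa using ⟨h, hr.trans hb, hr.trans inf_le_right⟩
    -- Elements of different summands are apart on any evidence, so `w` is handed on unchanged.
    -- Recursion is needed only when all three lie in the same summand.
    · have e : M.val (tr (σ ⊞ τ)) ⋆ inl a ⋆ inl b ⋆ inr c ⋆ w = inl w := by simp [val, tr]
      rw [e, ap_inl_inl, dm_inr, split_inl, ap_inl_inr]
      exact inf_le_inf_right _ (inf_le_right.trans inf_le_left)
    · have e : M.val (tr (σ ⊞ τ)) ⋆ inl a ⋆ inr b ⋆ inl c ⋆ w = inr w := by simp [val, tr]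
      rw [e, ap_inl_inr, dm_inl, split_inr, ap_inr_inl]
      exact inf_le_inf_right _ inf_le_right
    · have e : M.val (tr (σ ⊞ τ)) ⋆ inl a ⋆ inr b ⋆ inr c ⋆ w = inl w := by simp [val, tr]
      rw [e, ap_inl_inr, dm_inr, split_inl, ap_inl_inr]
      exact inf_le_inf_right _ inf_le_left
    · have e : M.val (tr (σ ⊞ τ)) ⋆ inr a ⋆ inl b ⋆ inl c ⋆ w = inl w := by simp [val, tr]
      rw [e, ap_inr_inl, dm_inl, split_inl, ap_inr_inl]
      exact inf_le_inf_right _ inf_le_left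
    · have e : M.val (tr (σ ⊞ τ)) ⋆ inr a ⋆ inl b ⋆ inr c ⋆ w = inr w := by simp [val, tr]
      rw [e, ap_inr_inl, dm_inr, split_inr, ap_inl_inr]
      exact inf_le_inf_right _ inf_le_right
    · have e : M.val (tr (σ ⊞ τ)) ⋆ inr a ⋆ inr b ⋆ inl c ⋆ w = inl w := by simp [val, tr]
      rw [e, ap_inr_inr, dm_inl, split_inl, ap_inr_inl]
      exact inf_le_inf_right _ (inf_le_right.trans inf_le_left)
    · have e : M.val (tr (σ ⊞ τ)) ⋆ inr a ⋆ inr b ⋆ inr c ⋆ w =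
          case (eval (((((((Env.nil.cons (inr (σ := σ.plus) a)).cons (inr (σ := σ.plus) b)).cons
              (inr (σ := σ.plus) c)).cons w).cons a).cons
              c).cons b) (lam (il (pr (p1 v4) v0))))
            (eval (((((((Env.nil.cons (inr (σ := σ.plus) a)).cons (inr (σ := σ.plus) b)).cons
              (inr (σ := σ.plus) c)).cons w).cons a).cons
              c).cons b) (lam (ir (pr (p1 v4) v0))))
            (M.val (tr τ) ⋆ a ⋆ b ⋆ c ⋆ snd w) := by simp [val, tr]
      rw [e, ap_inr_inr, dm_inr]
      have ha := (inf_le_left.trans (inf_le_right.trans inf_le_left) :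
        (Ap τ a b (snd w) ⊓ (Dm τ a ⊓ Dm τ b)) ⊓ Dm τ c ≤ Dm τ a)
      have hb := (inf_le_left.trans (inf_le_right.trans inf_le_right) :
        (Ap τ a b (snd w) ⊓ (Dm τ a ⊓ Dm τ b)) ⊓ Dm τ c ≤ Dm τ b)
      refine split_case (by fun_prop) ((inf_le_inf_right _ inf_le_left).trans ihτ)
        (fun v r hr h => ?_) (fun v r hr h => ?_)
      · simpa using ⟨h, hr.trans ha, hr.trans inf_le_right⟩
      · simpa using ⟨h, hr.trans hb, hr.trans inf_le_right⟩
  | arr σ τ _ ihτ =>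
    have e : M.val (tr (σ ⇒ τ)) ⋆ x ⋆ y ⋆ z ⋆ w =
        case (eval ((((Env.nil.cons x).cons y).cons z).cons w) (lam (il (pr (p1 v1) v0))))
          (eval ((((Env.nil.cons x).cons y).cons z).cons w) (lam (ir (pr (p1 v1) v0))))
          (M.val (tr τ) ⋆ (fst x ⋆ fst w) ⋆ (fst y ⋆ fst w) ⋆ (fst z ⋆ fst w) ⋆ snd w) := by
      simp [val, tr, EHA.ap]
    rw [e, ap_arr]
    refine le_of_forall_le fun q h => ?_
    obtain ⟨⟨hw, h, hx, hy⟩, hz⟩ := by simpa only [le_inf_iff] using h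
    refine split_case (by fun_prop) ((le_inf h (dm_ap hz hw)).trans ihτ)
      (fun v r hr h => ?_) (fun v r hr h => ?_)
    · simp only [lam_ap, eval_il, eval_pr, eval_p1, eval_v0, eval_v1, split_inl, ap_arr,
        IsModel.fst_pair, IsModel.snd_pair]
      exact le_inf (hr.trans hw) (le_inf h (le_inf (hr.trans hx) (hr.trans hz)))
    · simp only [lam_ap, eval_ir, eval_pr, eval_p1, eval_v0, eval_v1, split_inr, ap_arr,
        IsModel.fst_pair, IsModel.snd_pair]
      exact le_inf (hr.trans hw) (le_inf h (le_inf (hr.trans hy) (hr.trans hz)))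

end Str
end EHA

namespace EHA
namespace Str

variable {H : Type} [Order.Frame H] {M : Str H} [IsTotal M] {Γ Δ : List Ty} {σ τ ρ α β : Ty}
  {p q : H}

/-! ### The constants belong to the domain -/

@[simp] theorem eval_ap {a b m n : Ty} (γ : M.Env Γ) (f : Tm Γ ((a ⇒ b) ⊠ (a ⇒ a ⇒ n ⇒ m)))
    (x : Tm Γ a) : eval γ (EHA.ap f x) = fst (eval γ f) ⋆ eval γ x := rfl

@[simp] theorem eval_rf {a b m n : Ty} (γ : M.Env Γ) (f : Tm Γ ((a ⇒ b) ⊠ (a ⇒ a ⇒ n ⇒ m)))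
    (x y : Tm Γ a) (w : Tm Γ n) :
    eval γ (rf f x y w) = snd (eval γ f) ⋆ eval γ x ⋆ eval γ y ⋆ eval γ w := rfl

@[simp] theorem fst_mor {a b m n : Ty} (γ : M.Env Γ) (f : Tm (a :: Γ) b)
    (g : Tm (n :: a :: a :: Γ) m) (x : M.D a) :
    fst (eval γ (mor f g)) ⋆ x = eval (γ.cons x) f := by
  simp [mor]

@[simp] theorem snd_mor {a b m n : Ty} (γ : M.Env Γ) (f : Tm (a :: Γ) b)
    (g : Tm (n :: a :: a :: Γ) m) (x y : M.D a) (w : M.D n) :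
    snd (eval γ (mor f g)) ⋆ x ⋆ y ⋆ w = eval (((γ.cons x).cons y).cons w) g := by
  simp [mor]

theorem dm_mor {γ : M.Env Γ} {a : Tm (σ.plus :: Γ) τ.plus}
    {b : Tm (τ.minus :: σ.plus :: σ.plus :: Γ) σ.minus}
    (h : ∀ u, ∀ q ≤ p, q ≤ Dm σ u → q ≤ Dm τ (eval (γ.cons u) a))
    (h' : ∀ u v w, ∀ q ≤ p, q ≤ Dm σ u → q ≤ Dm σ v →
      q ≤ Ap τ (eval (γ.cons u) a) (eval (γ.cons v) a) w →
      q ≤ Ap σ u v (eval (((γ.cons u).cons v).cons w) b)) :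
    p ≤ Dm (σ ⇒ τ) (eval γ (mor a b)) := by
  refine dm_arr_intro ?_ ?_
  · simpa using h
  · simpa using h'

/-- Evidence that two functions are apart consists of a point of the domain and evidence at that
point. In a curried constant, repeated use exposes the later arguments. -/
theorem ap_mor {γ : M.Env Γ} {δ : M.Env Δ} {a : Tm (σ.plus :: Γ) τ.plus}
    {b : Tm (τ.minus :: σ.plus :: σ.plus :: Γ) σ.minus} {a' : Tm (σ.plus :: Δ) τ.plus}
    {b' : Tm (τ.minus :: σ.plus :: σ.plus :: Δ) σ.minus} {w : M.D (σ.plus ⊠ τ.minus)}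
    (h : p ≤ Ap (σ ⇒ τ) (eval γ (mor a b)) (eval δ (mor a' b')) w) :
    p ≤ Dm σ (fst w) ∧
      p ≤ Ap τ (eval (γ.cons (fst w)) a) (eval (δ.cons (fst w)) a') (snd w) := by
  rw [ap_arr, fst_mor, fst_mor] at h
  exact ⟨h.trans inf_le_left, h.trans (inf_le_right.trans inf_le_left)⟩

theorem ap_arr_intro {x y : M.D (σ ⇒ τ).plus} {u : M.D σ.plus} {w : M.D τ.minus}
    (hx : p ≤ Dm (σ ⇒ τ) x) (hy : p ≤ Dm (σ ⇒ τ) y) (hu : p ≤ Dm σ u)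
    (h : p ≤ Ap τ (fst x ⋆ u) (fst y ⋆ u) w) : p ≤ Ap (σ ⇒ τ) x y (pair u w) := by
  rw [ap_arr, IsModel.fst_pair, IsModel.snd_pair]
  exact le_inf hu (le_inf h (le_inf hx hy))

theorem dm_k : p ≤ Dm (σ ⇒ τ ⇒ σ) (M.val (Con.k σ τ).plus) := by
  refine dm_mor (fun u q _ hu => ?_) (fun u v w q _ _ _ h => ?_)
  · exact dm_mor (fun v r hr _ => hr.trans hu) (fun _ _ _ _ _ _ _ h => ap_absurd h)
  · exact (ap_mor h).2

/-- The argument `z` occurs twice in `x z (y z)`. Cotransitivity at `x z (y z')` separates the two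
occurrences: one alternative is reflected through `x z` and then `y`, the other is apartness of `x
z'` and `x z` at `y z'`, reflected through `x` and then turned around by `sy`. -/
theorem dm_s : p ≤ Dm ((σ ⇒ τ ⇒ ρ) ⇒ (σ ⇒ τ) ⇒ σ ⇒ ρ) (M.val (Con.s σ τ ρ).plus) := by
  refine dm_mor (fun x p₁ _ hx => dm_mor (fun y p₂ h₂ hy => dm_mor (fun z p₃ h₃ hz => ?_) ?_) ?_) ?_
  · exact dm_ap (dm_ap ((h₃.trans h₂).trans hx) hz) (dm_ap (h₃.trans hy) hz)
  · intro z z' w q hq hz hz' h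
    have hx := (hq.trans h₂).trans hx
    have hy := hq.trans hy
    simp only [eval_ap, eval_v0, eval_v1, eval_v2] at h
    have hyz := dm_ap hy hz
    have hyz' := dm_ap hy hz'
    have hs := (le_inf h (dm_ap (dm_ap hx hz) hyz')).trans ap_tr
    simp only [eval_cases, eval_cl, eval_app, eval_ap, eval_v0, eval_v1, eval_v2, eval_v3, eval_v4]
    refine split_case (by fun_prop) hs (fun u r hr h => ?_) (fun u r hr h => ?_)
    · simp only [lam_ap, eval_rf, eval_ap, eval_v0, eval_v2, eval_v3, eval_v4, eval_v5]
      refine ap_rf (hr.trans hy) (hr.trans hz) (hr.trans hz') ?_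
      exact ap_rf (hr.trans (dm_ap hx hz)) (hr.trans hyz) (hr.trans hyz') h
    · simp only [lam_ap, eval_rf, eval_ap, eval_v0, eval_v2, eval_v3, eval_v4, eval_v5, eval_app,
        eval_cl, eval_pr]
      refine le_trans (ap_rf (hr.trans hx) (hr.trans hz') (hr.trans hz) ?_) ap_sy
      exact ap_arr_intro (dm_ap (hr.trans hx) (hr.trans hz'))
        (dm_ap (hr.trans hx) (hr.trans hz)) (hr.trans hyz') h
  · intro y y' w q hq hy hy' h
    obtain ⟨hz, h⟩ := ap_mor h
    simp only [eval_ap, eval_v0, eval_v1, eval_v2] at h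
    simp only [eval_pr, eval_rf, eval_ap, eval_p1, eval_p2, eval_v0, eval_v1, eval_v2, eval_v3]
    refine ap_arr_intro hy hy' hz ?_
    exact ap_rf (dm_ap (hq.trans hx) hz) (dm_ap hy hz) (dm_ap hy' hz) h
  · intro x x' w q hq hx hx' h
    obtain ⟨hy, h⟩ := ap_mor h
    obtain ⟨hz, h⟩ := ap_mor h
    simp only [eval_ap, eval_v0, eval_v1, eval_v2] at h
    simp only [eval_pr, eval_ap, eval_p1, eval_p2, eval_v0]
    refine ap_arr_intro hx hx' hz ?_
    exact ap_arr_intro (dm_ap hx hz) (dm_ap hx' hz) (dm_ap hy hz) h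

theorem dm_pair : p ≤ Dm (σ ⇒ τ ⇒ σ ⊠ τ) (M.val (Con.pair σ τ).plus) := by
  refine dm_mor (fun x p₁ _ hx => dm_mor (fun y p₂ h₂ hy => ?_) ?_) ?_
  · simp only [dm_prod, eval_pr, eval_v0, eval_v1, IsModel.fst_pair, IsModel.snd_pair]
    exact le_inf (h₂.trans hx) hy
  · intro y y' w q _ _ _ h
    refine forces_mp (sum_cases (F := fun w => Ap (σ ⊠ τ) (pair x y) (pair x y') w ⇨
      Ap τ y y' (eval ((((Env.nil.cons x).cons y).cons y').cons w)
        (cases v0 (cl (dfl τ.minus)) v0))) (by fun_prop) (fun u => ?_) (fun u => ?_) w) h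
    -- The first components coincide, so this alternative cannot occur and a default value of
    -- evidence is harmless.
    · rw [ap_prod_inl, IsModel.fst_pair, IsModel.fst_pair, ap_irrefl]
      simp
    · rw [ap_prod_inr, IsModel.snd_pair, IsModel.snd_pair]
      refine forces_himp fun _ _ h => ?_
      simpa using h.trans inf_le_left
  · intro x x' w q _ _ _ h
    obtain ⟨_, h⟩ := ap_mor h
    have key (s : M.D (σ.minus ⊞ τ.minus)) : q ≤ Ap (σ ⊠ τ) (pair x (fst w)) (pair x' (fst w)) s ⇨
        Ap σ x x' (case (eval (((Env.nil.cons x).cons x').cons w) (lam v0))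
          (eval (((Env.nil.cons x).cons x').cons w) (lam (cl (dfl σ.minus)))) s) := by
      refine sum_cases (F := fun s => Ap (σ ⊠ τ) (pair x (fst w)) (pair x' (fst w)) s ⇨
        Ap σ x x' (case (eval (((Env.nil.cons x).cons x').cons w) (lam v0))
          (eval (((Env.nil.cons x).cons x').cons w) (lam (cl (dfl σ.minus)))) s))
        (by fun_prop) (fun u => ?_) (fun u => ?_) s
      · rw [ap_prod_inl, IsModel.fst_pair, IsModel.fst_pair]
        refine forces_himp fun _ _ h => ?_
        simpa using h.trans inf_le_left
      · rw [ap_prod_inr, IsModel.snd_pair, IsModel.snd_pair, ap_irrefl]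
        simp
    exact forces_mp (key (snd w)) h

theorem dm_fst : p ≤ Dm (σ ⊠ τ ⇒ σ) (M.val (Con.fst σ τ).plus) := by
  refine dm_mor (fun x p₁ _ hx => hx.trans inf_le_left) ?_
  intro x y w q _ hx hy h
  simp only [eval_il, eval_v0, ap_prod_inl]
  exact le_inf h (le_inf hx hy)

theorem dm_snd : p ≤ Dm (σ ⊠ τ ⇒ τ) (M.val (Con.snd σ τ).plus) := by
  refine dm_mor (fun x p₁ _ hx => hx.trans inf_le_right) ?_
  intro x y w q _ hx hy h
  simp only [eval_ir, eval_v0, ap_prod_inr]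
  exact le_inf h (le_inf hx hy)

theorem dm_inl_con : p ≤ Dm (σ ⇒ σ ⊞ τ) (M.val (Con.inl σ τ).plus) := by
  refine dm_mor (fun x p₁ _ hx => by simpa using hx) ?_
  intro x y w q _ hx hy h
  simp only [eval_il, eval_v0, ap_inl_inl] at h
  exact h.trans inf_le_left

theorem dm_inr_con : p ≤ Dm (τ ⇒ σ ⊞ τ) (M.val (Con.inr σ τ).plus) := by
  refine dm_mor (fun x p₁ _ hx => by simpa using hx) ?_
  intro x y w q _ hx hy h
  simp only [eval_ir, eval_v0, ap_inr_inr] at h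
  exact h.trans inf_le_left

/-- The underlying function of `case`, with the functions `f` and `g` as parameters. -/
def caseTm (σ τ ρ : Ty) : Tm [(σ ⊞ τ).plus, (τ ⇒ ρ).plus, (σ ⇒ ρ).plus] ρ.plus :=
  cases v0 (EHA.ap v3 v0) (EHA.ap v2 v0)

section Case

variable (f : M.D (σ ⇒ ρ).plus) (g : M.D (τ ⇒ ρ).plus)

@[simp] theorem eval_caseTm_inl (u : M.D σ.plus) :
    eval (((Env.nil.cons f).cons g).cons (inl u)) (caseTm σ τ ρ) = fst f ⋆ u := by
  simp [caseTm]

@[simp] theorem eval_caseTm_inr (u : M.D τ.plus) :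
    eval (((Env.nil.cons f).cons g).cons (inr u)) (caseTm σ τ ρ) = fst g ⋆ u := by
  simp [caseTm]

end Case

theorem dm_caseTm {f : M.D (σ ⇒ ρ).plus} {g : M.D (τ ⇒ ρ).plus} {x : M.D (σ ⊞ τ).plus}
    (hf : p ≤ Dm (σ ⇒ ρ) f) (hg : p ≤ Dm (τ ⇒ ρ) g) (hx : p ≤ Dm (σ ⊞ τ) x) :
    p ≤ Dm ρ (eval (((Env.nil.cons f).cons g).cons x) (caseTm σ τ ρ)) := by
  refine forces_mp (sum_cases (F := fun s => Dm (σ ⊞ τ) s ⇨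
    Dm ρ (eval (((Env.nil.cons f).cons g).cons s) (caseTm σ τ ρ))) (by fun_prop)
      (fun u => ?_) (fun u => ?_) x) hx
  · rw [dm_inl, eval_caseTm_inl]
    exact forces_himp fun q hq h => dm_ap (hq.trans hf) h
  · rw [dm_inr, eval_caseTm_inr]
    exact forces_himp fun q hq h => dm_ap (hq.trans hg) h

theorem sum_cases₂ {F : M.D (σ ⊞ τ) → M.D (α ⊞ β) → H} (hF : ∀ y, Cong fun x => F x y)
    (hF' : ∀ x, Cong (F x)) (h₁ : ∀ u v, p ≤ F (inl u) (inl v)) (h₂ : ∀ u v, p ≤ F (inl u) (inr v))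
    (h₃ : ∀ u v, p ≤ F (inr u) (inl v)) (h₄ : ∀ u v, p ≤ F (inr u) (inr v)) (x : M.D (σ ⊞ τ))
    (y : M.D (α ⊞ β)) : p ≤ F x y :=
  sum_cases (F := fun x => F x y) (hF y) (fun u => sum_cases (hF' _) (h₁ u) (h₂ u) y)
    (fun u => sum_cases (hF' _) (h₃ u) (h₄ u) y) x

theorem dm_case : p ≤ Dm ((σ ⇒ ρ) ⇒ (τ ⇒ ρ) ⇒ σ ⊞ τ ⇒ ρ) (M.val (Con.case σ τ ρ).plus) := by
  refine dm_mor (fun f p₁ _ hf => dm_mor (fun g p₂ h₂ hg => dm_mor (fun x p₃ h₃ hx => ?_) ?_) ?_) ?_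
  · exact dm_caseTm (h₃.trans (h₂.trans hf)) (h₃.trans hg) hx
  · intro x x' w q hq hx hx' h
    have hf := hq.trans (h₂.trans hf)
    have hg := hq.trans hg
    -- The domain conditions and the apartness hypothesis are built into the predicate, so that they
    -- are specialized together with `x` and `x'` by the case distinction.
    refine forces_mp (forces_mp (forces_mp (sum_cases₂ (F := fun x x' =>
      Dm (σ ⊞ τ) x ⇨ (Dm (σ ⊞ τ) x' ⇨
        (Ap ρ (eval (((Env.nil.cons f).cons g).cons x) (caseTm σ τ ρ))
          (eval (((Env.nil.cons f).cons g).cons x') (caseTm σ τ ρ)) w ⇨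
        Ap (σ ⊞ τ) x x' (eval (((((Env.nil.cons f).cons g).cons x).cons x').cons w)
        (cases v2
          (cases v2 (pr (rf v6 v1 v0 v2) (cl (dfl τ.minus))) (cl (dfl (σ ⊞ τ).minus)))
          (cases v2 (cl (dfl (σ ⊞ τ).minus)) (pr (cl (dfl σ.minus)) (rf v5 v1 v0 v2))))))))
      (fun _ => by fun_prop) (fun _ => by fun_prop) (fun u v => ?_) (fun u v => ?_)
      (fun u v => ?_) (fun u v => ?_) x x') hx) hx') h
    all_goals
      refine forces_himp fun r hr hu => forces_himp fun s hs hv => forces_himp fun t ht h => ?_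
      simp only [dm_inl, dm_inr] at hu hv
      have hu := ht.trans (hs.trans hu)
      have hv := ht.trans hv
      have hq := ht.trans (hs.trans hr)
    · simp only [eval_caseTm_inl] at h
      simp only [IsModel.case_inl, lam_ap, eval_v0, eval_cases, eval_v2,
        eval_pr, eval_rf, eval_v6, eval_v1, ap_inl_inl, IsModel.fst_pair]
      exact le_inf (ap_rf (hq.trans hf) hu hv h) (le_inf hu hv)
    · rw [ap_inl_inr]
      exact le_inf hu hv
    · rw [ap_inr_inl]
      exact le_inf hu hv
    · simp only [eval_caseTm_inr] at h
      simp only [IsModel.case_inr, lam_ap, eval_v0, eval_cases, eval_v2,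
        eval_pr, eval_rf, eval_v5, eval_v1, ap_inr_inr, IsModel.snd_pair]
      exact le_inf (ap_rf (hq.trans hg) hu hv h) (le_inf hu hv)
  · intro g g' w q hq hg hg' h
    obtain ⟨hx, h⟩ := ap_mor h
    refine forces_mp (forces_mp (sum_cases (F := fun s => Dm (σ ⊞ τ) s ⇨
      (Ap ρ (eval (((Env.nil.cons f).cons g).cons s) (caseTm σ τ ρ))
          (eval (((Env.nil.cons f).cons g').cons s) (caseTm σ τ ρ)) (snd w) ⇨
        Ap (τ ⇒ ρ) g g' (case
          (eval ((((Env.nil.cons f).cons g).cons g').cons w) (lam (cl (dfl (τ ⇒ ρ).minus))))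
          (eval ((((Env.nil.cons f).cons g).cons g').cons w) (lam (pr v0 (p2 v1)))) s)))
      (by fun_prop) (fun u => ?_) (fun u => ?_) (fst w)) hx) h
    all_goals refine forces_himp fun r hr hu => forces_himp fun s hs h => ?_
    · rw [eval_caseTm_inl, eval_caseTm_inl] at h
      exact ap_absurd h
    · rw [dm_inr] at hu
      rw [eval_caseTm_inr, eval_caseTm_inr] at h
      simp only [IsModel.case_inr, lam_ap, eval_v0, eval_pr, eval_p2, eval_v1]
      have hr := hs.trans hr
      exact ap_arr_intro (hr.trans hg) (hr.trans hg') (hs.trans hu) h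
  · intro f f' w q hq hf hf' h
    obtain ⟨hg, h⟩ := ap_mor h
    obtain ⟨hx, h⟩ := ap_mor h
    refine forces_mp (forces_mp (sum_cases (F := fun s => Dm (σ ⊞ τ) s ⇨
      (Ap ρ (eval (((Env.nil.cons f).cons (fst w)).cons s) (caseTm σ τ ρ))
          (eval (((Env.nil.cons f').cons (fst w)).cons s) (caseTm σ τ ρ)) (snd (snd w)) ⇨
        Ap (σ ⇒ ρ) f f' (case
          (eval (((Env.nil.cons f).cons f').cons w) (lam (pr v0 (p2 (p2 v1)))))
          (eval (((Env.nil.cons f).cons f').cons w) (lam (cl (dfl (σ ⇒ ρ).minus)))) s)))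
      (by fun_prop) (fun u => ?_) (fun u => ?_) (fst (snd w))) hx) h
    all_goals refine forces_himp fun r hr hu => forces_himp fun s hs h => ?_
    · rw [dm_inl] at hu
      rw [eval_caseTm_inl, eval_caseTm_inl] at h
      simp only [IsModel.case_inl, lam_ap, eval_v0, eval_pr, eval_p2, eval_v1]
      have hr := hs.trans hr
      exact ap_arr_intro (hr.trans hf) (hr.trans hf') (hs.trans hu) h
    · rw [eval_caseTm_inr, eval_caseTm_inr] at h
      exact ap_absurd h

theorem dm_suc : p ≤ Dm (.N ⇒ .N) (M.val Con.succ.plus) := by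
  refine dm_mor (fun x p₁ _ hx => by simp) ?_
  intro x y w q _ hx hy h
  simpa [eq_suc] using h

end Str
end EHA

namespace EHA
namespace Str

variable {H : Type} [Order.Frame H] {M : Str H} [IsTotal M] {Γ Δ : List Ty} {σ τ ρ α β : Ty}
  {p q : H}

/-! ### The recursor belongs to the domain -/

theorem dm_zro {n : M.D .N} : p ≤ Dm .N n := by rw [dm_nat]; exact le_top

/-- The underlying function of the interpretation of the recursor. -/
abbrev itrAp (a : M.D σ.plus) (f : M.D (.N ⇒ σ ⇒ σ).plus) (n : M.D .N) : M.D σ.plus :=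
  M.val (itr σ) ⋆ a ⋆ f ⋆ n

theorem itrAp_zro (a : M.D σ.plus) (f : M.D (.N ⇒ σ ⇒ σ).plus) : itrAp a f zro = a := by
  simp [itrAp, val, itr]

theorem itrAp_suc (a : M.D σ.plus) (f : M.D (.N ⇒ σ ⇒ σ).plus) (n : M.D .N) :
    itrAp a f (suc n) = fst (fst f ⋆ n) ⋆ itrAp a f n := by
  simp only [itrAp, val, itr, lam_ap, eval_recN, eval_ap, eval_v0, eval_v1, eval_v2, eval_v3,
    IsModel.iter_suc]
  congr 2

theorem dm_itrAp {a : M.D σ.plus} {f : M.D (.N ⇒ σ ⇒ σ).plus} (ha : p ≤ Dm σ a)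
    (hf : p ≤ Dm (.N ⇒ σ ⇒ σ) f) (n : M.D .N) : p ≤ Dm σ (itrAp a f n) := by
  refine nat_ind (F := fun n => Dm σ (itrAp a f n))
    ⟨_, (apart σ).dom (cl (itr σ) ⬝ v2 ⬝ v1 ⬝ v0), (Env.nil.cons a).cons f, fun d => by simp⟩
    ?_ ?_ n
  · rwa [itrAp_zro]
  · intro n q hq ih
    rw [itrAp_suc]
    exact dm_ap (dm_ap (hq.trans hf) dm_zro) ih

/-- The evidence changes from one stage to the preceding one, so the induction quantifies over `w`
and iterates a function of evidence. The base `b` is arbitrary, since both recursions begin with the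
same `a`. -/
theorem itrAp_reflects_fun {a : M.D σ.plus} {f f' : M.D (.N ⇒ σ ⇒ σ).plus}
    {b : M.D (σ.minus ⇒ (.N ⇒ σ ⇒ σ).minus)}
    {c : M.D (.N ⇒ (σ.minus ⇒ (.N ⇒ σ ⇒ σ).minus) ⇒ (σ.minus ⇒ (.N ⇒ σ ⇒ σ).minus))}
    (h : ∀ n (e : M.D (σ.minus ⇒ (.N ⇒ σ ⇒ σ).minus)) w, ∀ q ≤ p,
      (∀ w, q ≤ Ap σ (itrAp a f n) (itrAp a f' n) w ⇨ Ap (.N ⇒ σ ⇒ σ) f f' (e ⋆ w)) →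
      q ≤ Ap σ (itrAp a f (suc n)) (itrAp a f' (suc n)) w →
      q ≤ Ap (.N ⇒ σ ⇒ σ) f f' (c ⋆ n ⋆ e ⋆ w)) (n : M.D .N) (w : M.D σ.minus) :
    p ≤ Ap σ (itrAp a f n) (itrAp a f' n) w ⇨ Ap (.N ⇒ σ ⇒ σ) f f' (iter b c n ⋆ w) := by
  refine forces_all (nat_ind (F := fun n => ⨅ w, Ap σ (itrAp a f n) (itrAp a f' n) w ⇨
    Ap (.N ⇒ σ ⇒ σ) f f' (iter b c n ⋆ w)) ⟨_, .all σ.minus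
      ((apart σ).app (cl (itr σ) ⬝ v6 ⬝ v5 ⬝ v1) (cl (itr σ) ⬝ v6 ⬝ v4 ⬝ v1) v0 ⇛
        (apart (.N ⇒ σ ⇒ σ)).app v5 v4 (recN v3 v2 v1 ⬝ v0)),
      ((((Env.nil.cons a).cons f).cons f').cons b).cons c, fun d => by simp⟩ ?_ ?_ n) w
  · refine le_iInf fun w => ?_
    rw [itrAp_zro, itrAp_zro, ap_irrefl, bot_himp]
    exact le_top
  · intro n q hq ih
    refine le_iInf fun w => forces_himp fun r hr hw => ?_
    rw [IsModel.iter_suc]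
    exact h n _ w r (hr.trans hq) (fun w => hr.trans (forces_all ih w)) hw

theorem itrAp_reflects_init {a a' : M.D σ.plus} {f : M.D (.N ⇒ σ ⇒ σ).plus}
    {b : M.D (σ.minus ⇒ σ.minus)} {c : M.D (.N ⇒ (σ.minus ⇒ σ.minus) ⇒ (σ.minus ⇒ σ.minus))}
    (h₀ : ∀ w, p ≤ Ap σ a a' w ⇨ Ap σ a a' (b ⋆ w))
    (h : ∀ n (e : M.D (σ.minus ⇒ σ.minus)) w, ∀ q ≤ p,
      (∀ w, q ≤ Ap σ (itrAp a f n) (itrAp a' f n) w ⇨ Ap σ a a' (e ⋆ w)) →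
      q ≤ Ap σ (itrAp a f (suc n)) (itrAp a' f (suc n)) w →
      q ≤ Ap σ a a' (c ⋆ n ⋆ e ⋆ w)) (n : M.D .N) (w : M.D σ.minus) :
    p ≤ Ap σ (itrAp a f n) (itrAp a' f n) w ⇨ Ap σ a a' (iter b c n ⋆ w) := by
  refine forces_all (nat_ind (F := fun n => ⨅ w, Ap σ (itrAp a f n) (itrAp a' f n) w ⇨
    Ap σ a a' (iter b c n ⋆ w)) ⟨_, .all σ.minus
      ((apart σ).app (cl (itr σ) ⬝ v6 ⬝ v4 ⬝ v1) (cl (itr σ) ⬝ v5 ⬝ v4 ⬝ v1) v0 ⇛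
        (apart σ).app v6 v5 (recN v3 v2 v1 ⬝ v0)),
      ((((Env.nil.cons a).cons a').cons f).cons b).cons c, fun d => by simp⟩ ?_ ?_ n) w
  · refine le_iInf fun w => ?_
    rw [itrAp_zro, itrAp_zro, IsModel.iter_zro]
    exact h₀ w
  · intro n q hq ih
    refine le_iInf fun w => forces_himp fun r hr hw => ?_
    rw [IsModel.iter_suc]
    exact h n _ w r (hr.trans hq) (fun w => hr.trans (forces_all ih w)) hw

/-- For the step function, stage `n + 1` is compared at the value of `f'` on the stage built with
`f`. Either `f` and `f'` are apart there, or `f'` reflects the difference to stage `n` and the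
induction hypothesis applies. For the initial value each step reflects the difference down to stage
zero. For the number argument inequality is all that is asked. -/
theorem dm_iter : p ≤ Dm (σ ⇒ (.N ⇒ σ ⇒ σ) ⇒ .N ⇒ σ) (M.val (Con.iter σ).plus) := by
  refine dm_mor (fun a p₁ _ ha => dm_mor (fun f p₂ h₂ hf => dm_mor (fun n p₃ h₃ _ => ?_) ?_) ?_) ?_
  · simpa using dm_itrAp (h₃.trans (h₂.trans ha)) (h₃.trans hf) n
  · intro n m w q _ _ _ h
    simp only [eval_app, eval_cl, eval_v0, eval_v1, eval_v2] at h
    rw [ap_nat]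
    refine forces_compl fun r hr e => ?_
    exact ap_absurd (ap_congr (eap (erefl _) e) (erefl _) (erefl _) (hr.trans h))
  · intro f f' w q hq hf hf' h
    obtain ⟨_, h⟩ := ap_mor h
    have ha := hq.trans ha
    simp only [eval_app, eval_cl, eval_v0, eval_v1, eval_v2] at h
    refine forces_mp (itrAp_reflects_fun ?_ (fst w) (snd w)) h
    intro n e u r hr ih hu
    have hf := hr.trans hf
    have hf' := hr.trans hf'
    have hR := dm_itrAp (hr.trans ha) hf n
    have hR' := dm_itrAp (hr.trans ha) hf' n
    have hfn := dm_ap (u := n) hf dm_zro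
    have hfn' := dm_ap (u := n) hf' dm_zro
    rw [itrAp_suc, itrAp_suc] at hu
    have hs := (le_inf hu (dm_ap hfn' hR)).trans ap_tr
    simp only [lam_ap, eval_cases, eval_cl, eval_app, eval_ap, eval_v0, eval_v2, eval_v4,
      eval_v5, eval_v6]
    refine split_case (by fun_prop) hs (fun u s hs h => ?_) (fun u s hs h => ?_)
    · simp only [lam_ap, eval_cl, eval_app, eval_pr, eval_v0, eval_v3, eval_v6, eval_v7]
      refine ap_arr_intro (hs.trans hf) (hs.trans hf') dm_zro ?_
      exact ap_arr_intro (hs.trans hfn) (hs.trans hfn') (hs.trans hR) h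
    · simp only [lam_ap, eval_cl, eval_app, eval_rf, eval_ap, eval_v0, eval_v2, eval_v3, eval_v5,
        eval_v6, eval_v7]
      exact forces_mp (hs.trans (ih _))
        ((ap_rf (hs.trans hfn') (hs.trans hR') (hs.trans hR) h).trans ap_sy)
  · intro a a' w q hq ha ha' h
    obtain ⟨hf, h⟩ := ap_mor h
    obtain ⟨_, h⟩ := ap_mor h
    simp only [eval_app, eval_cl, eval_v0, eval_v1, eval_v2] at h
    refine forces_mp (itrAp_reflects_init (fun u => ?_) ?_ (fst (snd w)) (snd (snd w))) h
    · simp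
    · intro n e u r hr ih hu
      have hf := hr.trans hf
      have hR := dm_itrAp (hr.trans ha) hf n
      have hR' := dm_itrAp (hr.trans ha') hf n
      rw [itrAp_suc, itrAp_suc] at hu
      simp only [lam_ap, eval_cl, eval_app, eval_rf, eval_ap, eval_p1, eval_v0, eval_v1, eval_v2,
        eval_v3, eval_v4, eval_v5]
      exact forces_mp (ih _) (ap_rf (dm_ap hf dm_zro) hR hR' hu)

theorem dm_con : {σ : Ty} → (c : Con σ) → p ≤ Dm σ (M.val c.plus)
  | _, .k _ _ => dm_k
  | _, .s _ _ _ => dm_s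
  | _, .pair _ _ => dm_pair
  | _, .fst _ _ => dm_fst
  | _, .snd _ _ => dm_snd
  | _, .inl _ _ => dm_inl_con
  | _, .inr _ _ => dm_inr_con
  | _, .case _ _ _ => dm_case
  | _, .zero => dm_zro
  | _, .succ => dm_suc
  | _, .iter _ => dm_iter

end Str
end EHA

namespace EHA
namespace Str

variable {H : Type} [Order.Frame H] {M : Str H} [IsTotal M] {Γ Δ : List Ty} {σ τ ρ α β : Ty}
  {p q : H}

/-! ### The apartness model -/

section Mor

variable {a b c d l m n k : Ty} (γ : M.Env Γ)

theorem fst_mor₂ (f : Tm (b :: a :: Γ) c) (g : Tm (n :: b :: b :: a :: Γ) m)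
    (h : Tm (l :: a :: a :: Γ) k) (x : M.D a) (y : M.D b) :
    fst (fst (eval γ (mor (mor f g) h)) ⋆ x) ⋆ y = eval ((γ.cons x).cons y) f := by
  rw [fst_mor, fst_mor]

theorem fst_mor₃ {k' l' : Ty} (f : Tm (c :: b :: a :: Γ) d) (g : Tm (n :: c :: c :: b :: a :: Γ) m)
    (h : Tm (l :: b :: b :: a :: Γ) k) (h' : Tm (l' :: a :: a :: Γ) k') (x : M.D a) (y : M.D b)
    (z : M.D c) : fst (fst (fst (eval γ (mor (mor (mor f g) h) h')) ⋆ x) ⋆ y) ⋆ z =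
      eval (((γ.cons x).cons y).cons z) f := by
  rw [fst_mor, fst_mor, fst_mor]

end Mor

/-- The structure whose elements of type `σ` are the elements of `M` of type `σ⁺`, with `dom` as
extent predicate and the negation of apartness as equality. -/
def alpha (M : Str H) : Str H where
  D σ := M.D σ.plus
  ap {σ τ} f a := fst (σ := σ.plus ⇒ τ.plus) (τ := σ.plus ⇒ σ.plus ⇒ τ.minus ⇒ σ.minus) f ⋆ a
  con c := M.val c.plus
  dom {σ} x := Dm σ x
  eq {σ} x y := (⨆ z, Ap σ x y z)ᶜ

theorem alpha_eq_elim {x y : M.alpha.D σ} {z : M.D σ.minus} {c : H} (h : p ≤ M.alpha.eq x y)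
    (hz : p ≤ Ap (M := M) σ x y z) : p ≤ c :=
  forces_absurd h (forces_exists z hz)

theorem alpha_eq_intro {x y : M.alpha.D σ}
    (h : ∀ z, ∀ q ≤ p, q ≤ Ap (M := M) σ x y z → q ≤ ⊥) : p ≤ M.alpha.eq x y :=
  forces_compl fun _ hq hz => forces_ex hz fun z r hr hz => h z r (hr.trans hq) hz

theorem alpha_eq_self (x : M.alpha.D σ) : p ≤ M.alpha.eq x x :=
  alpha_eq_intro fun _ _ _ h => ap_absurd h

theorem alpha_eq_of_eq {x y : M.D σ.plus} (h : p ≤ M.eq x y) : p ≤ M.alpha.eq (σ := σ) x y :=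
  alpha_eq_intro fun _ _ hq hz =>
    ap_absurd (ap_congr (hq.trans h) (erefl _) (erefl _) hz)

/-- Equality in the apartness model is a negation, at `N` the double negation of the original
equality, which decidability removes. -/
theorem alpha_eq_nat (m n : M.D .N) : M.alpha.eq (σ := .N) m n = M.eq m n := by
  refine forces_iff fun q => ⟨fun h => ?_, alpha_eq_of_eq (σ := .N)⟩
  exact forces_or (eq_or_ne m n) (fun _ _ h => h) fun r hr hne =>
    alpha_eq_elim (z := (zro : M.D .N)) (hr.trans h) hne

def Env.plus : {Γ : List Ty} → M.alpha.Env Γ → M.Env (Γ.map Ty.plus)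
  | [], _ => Env.nil
  | σ :: _, γ => Env.cons (Env.plus fun τ x => γ τ x.succ) (γ σ .zero)

theorem Env.plus_var (γ : M.alpha.Env Γ) (x : Var Γ σ) : γ.plus _ x.plus = γ _ x := by
  induction x with
  | zero => rfl
  | succ x ih => exact ih _

theorem eval_plus (γ : M.alpha.Env Γ) (t : Tm Γ σ) : eval γ.plus t.plus = eval γ t := by
  induction t with
  | var x => exact γ.plus_var x
  | con c => exact eval_cl _ _
  | app t s iht ihs =>
    rw [Tm.plus, eval_ap, iht, ihs]
    rfl

/-- The translation is designed to describe `M.alpha` inside `M`: its explicit guards `dom` are the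
semantic relativization of quantifiers there. This turns results about models into results about
translated formulas. -/
theorem sem_alpha (A : Fm Γ) (γ : M.alpha.Env Γ) : sem A.alpha γ.plus = sem A γ := by
  induction A with
  | @eq Γ σ s t =>
    simp only [Fm.alpha, sem_neg, sem_ex, sem_app, eval_wk, eval_plus, IsTotal.dom_eq, top_inf_eq,
      eval_v0, sem_eq]
    rfl
  | bot => rfl
  | and A B ihA ihB => simp only [Fm.alpha, sem_and, ihA, ihB]
  | or A B ihA ihB => simp only [Fm.alpha, sem_or, ihA, ihB]
  | imp A B ihA ihB => simp only [Fm.alpha, sem_imp, ihA, ihB]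
  | all σ A ih =>
    simp only [Fm.alpha, sem_all, IsTotal.dom_eq, top_himp, sem_imp]
    refine iInf_congr fun d => ?_
    rw [sem_dom, eval_v0, ← ih]
    rfl
  | ex σ A ih =>
    simp only [Fm.alpha, sem_ex, IsTotal.dom_eq, top_inf_eq, sem_and]
    refine iSup_congr fun d => ?_
    rw [sem_dom, eval_v0, ← ih]
    rfl

@[simp] theorem alpha_zro : (zro : M.alpha.D .N) = (zro : M.D .N) := rfl

@[simp] theorem alpha_suc (n : M.alpha.D .N) : suc n = suc (M := M) n :=
  fst_mor (M := M) ..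

@[simp] theorem alpha_pair (a : M.alpha.D σ) (b : M.alpha.D τ) :
    pair a b = pair (M := M) (σ := σ.plus) (τ := τ.plus) a b :=
  fst_mor₂ (M := M) ..

@[simp] theorem alpha_fst (x : M.alpha.D (σ ⊠ τ)) :
    fst x = fst (M := M) (σ := σ.plus) (τ := τ.plus) x :=
  fst_mor (M := M) ..

@[simp] theorem alpha_snd (x : M.alpha.D (σ ⊠ τ)) :
    snd x = snd (M := M) (σ := σ.plus) (τ := τ.plus) x :=
  fst_mor (M := M) ..

@[simp] theorem alpha_inl (a : M.alpha.D σ) :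
    inl (τ := τ) a = inl (M := M) (σ := σ.plus) (τ := τ.plus) a :=
  fst_mor (M := M) ..

@[simp] theorem alpha_inr (a : M.alpha.D τ) :
    inr (σ := σ) a = inr (M := M) (σ := σ.plus) (τ := τ.plus) a :=
  fst_mor (M := M) ..

theorem alpha_case (f : M.alpha.D (σ ⇒ ρ)) (g : M.alpha.D (τ ⇒ ρ)) (x : M.alpha.D (σ ⊞ τ)) :
    case f g x = eval (M := M) (((Env.nil.cons (M := M) (σ := (σ ⇒ ρ).plus) f).cons
      (σ := (τ ⇒ ρ).plus) g).cons (σ := (σ ⊞ τ).plus) x) (caseTm σ τ ρ) :=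
  fst_mor₃ (M := M) ..

theorem alpha_iter (a : M.alpha.D σ) (f : M.alpha.D (.N ⇒ σ ⇒ σ)) (n : M.alpha.D .N) :
    iter a f n = itrAp (M := M) a f n := by
  refine (fst_mor₃ (M := M) ..).trans ?_
  rw [eval_app, eval_app, eval_app, eval_cl]
  rfl

/-- The contrapositive of cotransitivity. With `c = b` in place of `b = c` it matches the form of
`ap_tr`. -/
theorem alpha_eq_trans {a b c : M.alpha.D σ} (hb : p ≤ M.alpha.dom b) (h : p ≤ M.alpha.eq a b)
    (h' : p ≤ M.alpha.eq c b) : p ≤ M.alpha.eq a c := by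
  refine alpha_eq_intro fun z q hq hz => ?_
  refine forces_or ((le_inf hz (hq.trans hb)).trans (ap_tr (M := M))) (fun r hr hu => ?_)
    (fun r hr hu => ?_)
  · exact forces_ex hu fun u s hs hu => alpha_eq_elim (hs.trans (hr.trans (hq.trans h)))
      (hu.trans inf_le_right)
  · exact forces_ex hu fun u s hs hu => alpha_eq_elim (hs.trans (hr.trans (hq.trans h')))
      (hu.trans inf_le_right)

theorem alpha_eq_symm {a b : M.alpha.D σ} (h : p ≤ M.alpha.eq a b) : p ≤ M.alpha.eq b a :=
  alpha_eq_intro fun _ _ hq hz => alpha_eq_elim (hq.trans h) (hz.trans (ap_sy (M := M)))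

instance : IsModel M.alpha where
  dom_con c := dm_con (M := M) c
  dom_ap := dm_ap (M := M)
  k _ _ := fst_mor₂ (M := M) ..
  s _ _ _ := fst_mor₃ (M := M) ..
  fst_pair a b := by
    rw [alpha_fst, alpha_pair]; exact IsModel.fst_pair (M := M) ..
  snd_pair a b := by
    rw [alpha_snd, alpha_pair]; exact IsModel.snd_pair (M := M) ..
  case_inl f g a := by
    rw [alpha_case, alpha_inl]; exact eval_caseTm_inl (M := M) ..
  case_inr f g a := by
    rw [alpha_case, alpha_inr]; exact eval_caseTm_inr (M := M) ..
  iter_zro a f := by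
    rw [alpha_iter]; exact itrAp_zro (M := M) ..
  iter_suc a f n := by
    rw [alpha_iter, alpha_iter, alpha_suc]; exact itrAp_suc (M := M) ..
  eq_refl _ := alpha_eq_self _
  eq_symm _ _ := alpha_eq_symm
  eq_trans _ hb _ h h' := alpha_eq_trans hb h (alpha_eq_symm h')
  eq_ap {σ τ f g a b p} hf hg ha hb h h' := by
    -- Argument and function are changed separately. Apart values of `f` would have apart arguments
    -- by the reflecting functional of `f`; apart values of `f` and `g` at `b` would make `f` and
    -- `g` apart.
    refine alpha_eq_trans (b := f ⋆ b) (dm_ap (M := M) hf hb) ?_ ?_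
    · exact alpha_eq_intro fun z q hq hz => alpha_eq_elim (hq.trans h')
        (ap_rf (M := M) (hq.trans hf) (hq.trans ha) (hq.trans hb) hz)
    · exact alpha_eq_intro fun z q hq hz => alpha_eq_elim (hq.trans (alpha_eq_symm h))
        (ap_arr_intro (M := M) (hq.trans hg) (hq.trans hf) (hq.trans hb) hz)
  suc_ne_zro _ h := by
    rw [alpha_suc, alpha_zro, alpha_eq_nat] at h
    exact h.trans_eq (suc_ne (M := M))
  suc_inj _ _ h := by
    rw [alpha_suc, alpha_suc, alpha_eq_nat] at h
    exact (h.trans_eq (eq_suc (M := M))).trans_eq (alpha_eq_nat (M := M) ..).symm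
  ind A γ p hγ h₀ h₁ n hn := by
    -- Induction in `M.alpha` is induction in `M` for the translated formula; the relativization is
    -- harmless because `dom` is trivial at `N`.
    refine nat_ind (M := M) (F := fun n => sem A (γ.cons n)) ⟨_, A.alpha, γ.plus, fun d => ?_⟩ h₀ ?_ n
    · exact sem_alpha A (γ.cons d)
    · intro n q hq h
      exact (h₁ n q hq dm_zro h).trans_eq
        (congrArg (fun d => sem A (γ.cons d)) (alpha_suc (M := M) n))
  ext_arr {σ τ f g p} hf hg h := alpha_eq_intro fun z q hq hz =>
    alpha_eq_elim (h (fst (M := M) z) q hq (hz.trans inf_le_left))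
      (hz.trans (inf_le_right.trans inf_le_left))
  ext_prod {σ τ x p} hx := by
    rw [alpha_pair, alpha_fst, alpha_snd]
    exact alpha_eq_of_eq (IsModel.ext_prod (M := M) (total _))
  ext_sum {σ τ x p} hx := by
    refine forces_or hx (fun q hq h => le_sup_of_le_left ?_) (fun q hq h => le_sup_of_le_right ?_)
    · refine forces_ex h fun u r hr h => forces_exists u (le_inf (h.trans inf_le_right) ?_)
      exact (alpha_eq_of_eq (h.trans inf_le_left)).trans_eq
        (congrArg (M.alpha.eq x) (alpha_inl (M := M) (σ := σ) (τ := τ) u).symm)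
    · refine forces_ex h fun u r hr h => forces_exists u (le_inf (h.trans inf_le_right) ?_)
      exact (alpha_eq_of_eq (h.trans inf_le_left)).trans_eq
        (congrArg (M.alpha.eq x) (alpha_inr (M := M) (σ := σ) (τ := τ) u).symm)

end Str
end EHA

namespace EHA

/-! ### A witness for converse extensionality -/

section Witness

variable {Γ : List Ty} {ρ : Ty}

/-- `a` if the numbers `s` and `t` are equal, and `b` otherwise. -/
def ifEq (s t : Tm Γ .N) (a b : Tm Γ ρ) : Tm Γ ρ :=
  recN a (lam (lam ((b.wk .N).wk ρ))) (cl disc ⬝ s ⬝ t)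

/-- The order of the numbers: `0` if `m ≤ n`, and `1` otherwise. -/
def leTm : Tm [] (.N ⇒ .N ⇒ .N) :=
  .con (.iter _) ⬝ lam zro ⬝ lam (lam (lam (recN (suc zro) (lam (lam (v3 ⬝ v1))) v0)))

/-- The least number below `n` at which two functions differ, or `n`. -/
def search : Tm [] ((.N ⇒ .N) ⇒ (.N ⇒ .N) ⇒ .N ⇒ .N) :=
  lam (lam (.con (.iter _) ⬝ zro ⬝ lam (lam (ifEq (v3 ⬝ v0) (v2 ⬝ v0) (suc v0) v0))))

/-- The least number at which `f` and `g` differ, if `Φ f ≠ Φ g`. -/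
def diffPoint : Tm [] (((.N ⇒ .N) ⇒ .N).plus ⇒ (.N ⇒ .N).plus ⇒ (.N ⇒ .N).plus ⇒ .N) :=
  lam (lam (lam (cl search ⬝ p1 v1 ⬝ p1 v0 ⬝
    ifEq (ap v2 v1) (ap v2 v0) zro (p1 (rf v2 v1 v0 zro)))))

/-- Evidence that `f` and `g` are apart, if they differ at `m` or at `n`. -/
def diffAt : Tm [] ((.N ⇒ .N).plus ⇒ (.N ⇒ .N).plus ⇒ .N ⇒ .N ⇒ (.N ⇒ .N).minus) :=
  lam (lam (lam (lam (ifEq (ap v3 v1) (ap v2 v1) (pr v0 zro) (pr v1 zro)))))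

/-- The element `X` of the apartness model that witnesses `CE 0`. -/
def convExt : Tm [] (((.N ⇒ .N) ⇒ .N) ⇒ (.N ⇒ .N) ⇒ (.N ⇒ .N) ⇒ .N).plus :=
  mor
    (mor
      (mor (cl diffPoint ⬝ v2 ⬝ v1 ⬝ v0)
        (ifEq (ap v4 v2) (ap v4 v1)
          (cl diffAt ⬝ v2 ⬝ v1 ⬝ (cl diffPoint ⬝ v4 ⬝ v3 ⬝ v2) ⬝ (cl diffPoint ⬝ v4 ⬝ v3 ⬝ v1))
          (rf v4 v2 v1 zro)))
      (ifEq (ap v3 v2) (ap v3 v1)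
        (cl diffAt ⬝ v2 ⬝ v1 ⬝ (cl diffPoint ⬝ v3 ⬝ v2 ⬝ p1 v0) ⬝
          (cl diffPoint ⬝ v3 ⬝ v1 ⬝ p1 v0))
        (rf v3 v2 v1 zro)))
    (ifEq (ap v2 (p1 v0)) (ap v1 (p1 v0)) (pr (p1 (p2 v0)) zro) (pr (p1 v0) zro))

end Witness

namespace Str

variable {H : Type} [Order.Frame H] {M : Str H} [IsTotal M] {Γ Δ : List Ty} {σ τ ρ α β : Ty}
  {p q : H}

/-- Equality of numbers is decidable and `disc` computes the decision, so the two outcomes of `ifEq`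
can be verified separately. -/
theorem forces_ifEq {F : M.D ρ → H} {γ : M.Env Γ} {s t : Tm Γ .N} {a b : Tm Γ ρ} (hF : Cong F)
    (h : ∀ q ≤ p, q ≤ M.eq (eval γ s) (eval γ t) → q ≤ F (eval γ a))
    (h' : ∀ q ≤ p, q ≤ (M.eq (eval γ s) (eval γ t))ᶜ → q ≤ F (eval γ b)) :
    p ≤ F (eval γ (ifEq s t a b)) := by
  simp only [ifEq, eval_recN, eval_app, eval_cl]
  have e {m n : M.D .N} {c : M.D (.N ⇒ ρ ⇒ ρ)} : M.eq m n ≤ M.eq (iter (eval γ a) c m)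
      (iter (eval γ a) c n) := eap (erefl _) le_rfl
  refine forces_or (eq_or_ne (eval γ s) (eval γ t)) (fun q hq hst => ?_) (fun q hq hst => ?_)
  · have h₀ : q ≤ M.eq zro (M.val disc ⋆ eval γ s ⋆ eval γ t) := by
      rw [← disc_self (eval γ s)]
      exact eap (erefl _) hst
    refine hF.le (h₀.trans e) ?_
    rw [IsModel.iter_zro]
    exact h q hq hst
  · refine hF.le ((esymm (disc_of_ne hst)).trans e) ?_
    rw [IsModel.iter_suc, lam_ap, lam_ap, eval_wk, eval_wk]
    exact h' q hq hst

/-! #### The order of the numbers -/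

@[simp] theorem leTm_zro (n : M.D .N) : M.val leTm ⋆ zro ⋆ n = zro :=
  (congrArg (· ⋆ n) (IsModel.iter_zro (M := M) _ _)).trans (by simp)

theorem leTm_suc (m n : M.D .N) : M.val leTm ⋆ suc m ⋆ n = iter (suc zro)
    (eval ((((Env.nil.cons m).cons (M.val leTm ⋆ m))).cons n) (lam (lam (v3 ⬝ v1)))) n :=
  (congrArg (· ⋆ n) (IsModel.iter_suc (M := M) _ _ m)).trans (by simp; rfl)

@[simp] theorem leTm_suc_zro (m : M.D .N) : M.val leTm ⋆ suc m ⋆ zro = suc zro := by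
  rw [leTm_suc, IsModel.iter_zro]

@[simp] theorem leTm_suc_suc (m n : M.D .N) :
    M.val leTm ⋆ suc m ⋆ suc n = M.val leTm ⋆ m ⋆ n := by
  rw [leTm_suc, IsModel.iter_suc]
  simp

theorem le_antisymm_nat {m n : M.D .N} (h : p ≤ M.eq (M.val leTm ⋆ m ⋆ n) zro)
    (h' : p ≤ M.eq (M.val leTm ⋆ n ⋆ m) zro) : p ≤ M.eq m n := by
  have key : p ≤ ⨅ n, M.eq (M.val leTm ⋆ m ⋆ n) zro ⇨
      (M.eq (M.val leTm ⋆ n ⋆ m) zro ⇨ M.eq m n) := by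
    refine nat_ind (F := fun m => ⨅ n, M.eq (M.val leTm ⋆ m ⋆ n) zro ⇨
      (M.eq (M.val leTm ⋆ n ⋆ m) zro ⇨ M.eq m n)) ⟨[], .all .N (cl leTm ⬝ v1 ⬝ v0 ≐ EHA.zro ⇛
        cl leTm ⬝ v0 ⬝ v1 ≐ EHA.zro ⇛ v1 ≐ v0), Env.nil, fun d => by simp⟩
        (le_iInf fun n => ?_) (fun m q _ ih => le_iInf fun n => ?_) m
    · refine nat_cases (F := fun n => M.eq (M.val leTm ⋆ zro ⋆ n) zro ⇨
        (M.eq (M.val leTm ⋆ n ⋆ zro) zro ⇨ M.eq zro n)) (by fun_prop) (by simp [eq_self])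
        (fun n => by simp [suc_ne]) n
    · refine nat_cases (F := fun n => M.eq (M.val leTm ⋆ suc m ⋆ n) zro ⇨
        (M.eq (M.val leTm ⋆ n ⋆ suc m) zro ⇨ M.eq (suc m) n)) (by fun_prop) (by simp [suc_ne])
        (fun n => ?_) n
      rw [leTm_suc_suc, leTm_suc_suc, eq_suc]
      exact forces_all ih n
  exact forces_mp (forces_mp (forces_all key n) h) h'

theorem le_suc_of_ne {m n : M.D .N} (h : p ≤ M.eq (M.val leTm ⋆ m ⋆ n) zro)
    (h' : p ≤ (M.eq m n)ᶜ) : p ≤ M.eq (M.val leTm ⋆ suc m ⋆ n) zro := by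
  have key : p ≤ ⨅ n, M.eq (M.val leTm ⋆ m ⋆ n) zro ⇨
      ((M.eq m n)ᶜ ⇨ M.eq (M.val leTm ⋆ suc m ⋆ n) zro) := by
    refine nat_ind (F := fun m => ⨅ n, M.eq (M.val leTm ⋆ m ⋆ n) zro ⇨
      ((M.eq m n)ᶜ ⇨ M.eq (M.val leTm ⋆ suc m ⋆ n) zro)) ⟨[], .all .N (cl leTm ⬝ v1 ⬝ v0 ≐ EHA.zro ⇛
        Fm.neg (v1 ≐ v0) ⇛ cl leTm ⬝ EHA.suc v1 ⬝ v0 ≐ EHA.zro), Env.nil, fun d => by simp⟩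
        (le_iInf fun n => ?_) (fun m q _ ih => le_iInf fun n => ?_) m
    · refine nat_cases (F := fun n => M.eq (M.val leTm ⋆ zro ⋆ n) zro ⇨
        ((M.eq zro n)ᶜ ⇨ M.eq (M.val leTm ⋆ suc zro ⋆ n) zro)) (by fun_prop) (by simp [eq_self])
        (fun n => by simp [eq_self]) n
    · refine nat_cases (F := fun n => M.eq (M.val leTm ⋆ suc m ⋆ n) zro ⇨
        ((M.eq (suc m) n)ᶜ ⇨ M.eq (M.val leTm ⋆ suc (suc m) ⋆ n) zro)) (by fun_prop)
        (by simp [suc_ne]) (fun n => ?_) n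
      rw [leTm_suc_suc, leTm_suc_suc, eq_suc]
      exact forces_all ih n
  exact forces_mp (forces_mp (forces_all key n) h) h'

/-! #### Bounded search -/

section Search

variable {a b a' b' : M.D (.N ⇒ .N)} {n n' k : M.D .N}

@[simp] theorem search_zro : M.val search ⋆ a ⋆ b ⋆ zro = zro := by
  simp only [val, search, lam_ap, eval_app, eval_con]
  exact IsModel.iter_zro ..

theorem search_suc : M.val search ⋆ a ⋆ b ⋆ suc n =
    eval ((((Env.nil.cons a).cons b).cons n).cons (M.val search ⋆ a ⋆ b ⋆ n))
      (ifEq (v3 ⬝ v0) (v2 ⬝ v0) (EHA.suc v0) v0) := by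
  simp only [val, search, lam_ap, eval_app, eval_con]
  refine (IsModel.iter_suc ..).trans ?_
  rw [lam_ap, lam_ap]
  rfl

/-- Either the search has succeeded, or its value is the bound. -/
theorem search_spec : p ≤ (M.eq (a ⋆ (M.val search ⋆ a ⋆ b ⋆ n)) (b ⋆ (M.val search ⋆ a ⋆ b ⋆ n)))ᶜ ⊔
    M.eq (M.val search ⋆ a ⋆ b ⋆ n) n := by
  refine nat_ind (F := fun n => (M.eq (a ⋆ (M.val search ⋆ a ⋆ b ⋆ n))
    (b ⋆ (M.val search ⋆ a ⋆ b ⋆ n)))ᶜ ⊔ M.eq (M.val search ⋆ a ⋆ b ⋆ n) n)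
    ⟨_, Fm.neg (v2 ⬝ (cl search ⬝ v2 ⬝ v1 ⬝ v0) ≐ v1 ⬝ (cl search ⬝ v2 ⬝ v1 ⬝ v0)) ⋎
      cl search ⬝ v2 ⬝ v1 ⬝ v0 ≐ v0, (Env.nil.cons a).cons b, fun d => by simp⟩ ?_ ?_ n
  · rw [search_zro]
    exact le_sup_of_le_right (erefl _)
  · intro n q _ ih
    rw [search_suc]
    refine forces_ifEq (F := fun m => (M.eq (a ⋆ m) (b ⋆ m))ᶜ ⊔ M.eq m (suc n)) (by fun_prop)
      (fun r hr h => ?_) (fun r hr h => le_sup_of_le_left h)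
    refine forces_or (hr.trans ih) (fun s hs h' => forces_absurd h' (hs.trans h)) fun s hs h' => ?_
    exact le_sup_of_le_right (by rwa [eval_suc, eq_suc])

theorem search_ne (h : p ≤ (M.eq (a ⋆ n) (b ⋆ n))ᶜ) :
    p ≤ (M.eq (a ⋆ (M.val search ⋆ a ⋆ b ⋆ n)) (b ⋆ (M.val search ⋆ a ⋆ b ⋆ n)))ᶜ :=
  forces_or search_spec (fun _ _ h => h) fun _ hq h' =>
    Cong.le (F := fun m => (M.eq (a ⋆ m) (b ⋆ m))ᶜ) (by fun_prop) (esymm h') (hq.trans h)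

/-- The search advances only past a point of agreement. Such a point is not `k`, so a value at most
`k` stays at most `k`, whatever the bound `n` is. -/
theorem search_le (h : p ≤ (M.eq (a ⋆ k) (b ⋆ k))ᶜ) :
    p ≤ M.eq (M.val leTm ⋆ (M.val search ⋆ a ⋆ b ⋆ n) ⋆ k) zro := by
  refine nat_ind (F := fun n => M.eq (M.val leTm ⋆ (M.val search ⋆ a ⋆ b ⋆ n) ⋆ k) zro)
    ⟨_, cl leTm ⬝ (cl search ⬝ v3 ⬝ v2 ⬝ v0) ⬝ v1 ≐ EHA.zro,
      ((Env.nil.cons a).cons b).cons k, fun d => by simp⟩ ?_ ?_ n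
  · simp [eq_self]
  · intro n q hq ih
    rw [search_suc]
    refine forces_ifEq (F := fun m => M.eq (M.val leTm ⋆ m ⋆ k) zro) (by fun_prop)
      (fun r hr h' => ?_) (fun r hr _ => hr.trans ih)
    refine le_suc_of_ne (hr.trans ih) (forces_compl fun s hs e => ?_)
    refine forces_absurd (hs.trans (hr.trans (hq.trans h))) ?_
    exact Cong.le (F := fun m => M.eq (a ⋆ m) (b ⋆ m)) (by fun_prop) e (hs.trans h')

end Search

/-! #### The element `X` -/

section DiffPoint

variable {Φ Φ' : M.D ((.N ⇒ .N) ⇒ .N).plus} {f f' g g' : M.D (.N ⇒ .N).plus}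

/-- The point at which `f` and `g` are compared. -/
abbrev diffAp (Φ : M.D ((.N ⇒ .N) ⇒ .N).plus) (f g : M.D (.N ⇒ .N).plus) : M.D .N :=
  M.val diffPoint ⋆ Φ ⋆ f ⋆ g

theorem diffAp_eq : diffAp Φ f g = M.val search ⋆ fst f ⋆ fst g ⋆
    eval (((Env.nil.cons Φ).cons f).cons g)
      (ifEq (EHA.ap v2 v1) (EHA.ap v2 v0) EHA.zro (p1 (rf v2 v1 v0 EHA.zro))) := by
  simp only [diffAp, val, diffPoint, lam_ap, eval_app, eval_cl, eval_p1, eval_v0, eval_v1]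

theorem diffAp_ne (hΦ : p ≤ Dm ((.N ⇒ .N) ⇒ .N) Φ) (hf : p ≤ Dm (.N ⇒ .N) f)
    (hg : p ≤ Dm (.N ⇒ .N) g) (h : p ≤ (M.eq (fst Φ ⋆ f) (fst Φ ⋆ g))ᶜ) :
    p ≤ (M.eq (fst f ⋆ diffAp Φ f g) (fst g ⋆ diffAp Φ f g))ᶜ := by
  rw [diffAp_eq]
  refine search_ne (forces_ifEq (F := fun m => (M.eq (fst f ⋆ m) (fst g ⋆ m))ᶜ) (by fun_prop)
    (fun q hq h' => forces_absurd (hq.trans h) h') fun q hq h' => ?_)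
  -- Evidence at type `N` is irrelevant, so `zro` is supplied. The first component of the reflected
  -- evidence is a point where `f` and `g` differ.
  have := ap_rf (w := zro) (hq.trans hΦ) (hq.trans hf) (hq.trans hg) h'
  exact this.trans (inf_le_right.trans inf_le_left)

theorem diffAp_zro (h : p ≤ M.eq (fst Φ ⋆ f) (fst Φ ⋆ g)) : p ≤ M.eq (diffAp Φ f g) zro := by
  rw [diffAp_eq]
  refine forces_ifEq (F := fun m => M.eq (M.val search ⋆ fst f ⋆ fst g ⋆ m) zro) (by fun_prop)
    (fun q hq h' => ?_) (fun q hq h' => forces_absurd h' (hq.trans h))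
  rw [eval_zro, search_zro]
  exact erefl _

theorem eq_of_ne_of_ne {a b c d : M.D .N} (h : p ≤ (M.eq a b)ᶜ) (hac : p ≤ M.eq a c)
    (hbd : p ≤ M.eq b d) : p ≤ (M.eq c d)ᶜ :=
  forces_compl fun _ hq e => forces_absurd (hq.trans h)
    (etrans (hq.trans hac) (etrans e (esymm (hq.trans hbd))))

/-- If `Φ f = Φ g`, then both points are zero. Otherwise each point is a difference for the other
pair of functions as well, and minimality gives the two inequalities. Agreement is needed at just
the two points in question, which allows a failure to be located by checking finitely many
equations. -/
theorem diffAp_congr (hΦ : p ≤ Dm ((.N ⇒ .N) ⇒ .N) Φ) (hΦ' : p ≤ Dm ((.N ⇒ .N) ⇒ .N) Φ')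
    (hf : p ≤ Dm (.N ⇒ .N) f) (hf' : p ≤ Dm (.N ⇒ .N) f') (hg : p ≤ Dm (.N ⇒ .N) g)
    (hg' : p ≤ Dm (.N ⇒ .N) g') (h₁ : p ≤ M.eq (fst Φ ⋆ f) (fst Φ' ⋆ f'))
    (h₂ : p ≤ M.eq (fst Φ ⋆ g) (fst Φ' ⋆ g'))
    (h : ∀ m, m = diffAp Φ f g ∨ m = diffAp Φ' f' g' →
      p ≤ M.eq (fst f ⋆ m) (fst f' ⋆ m) ⊓ M.eq (fst g ⋆ m) (fst g' ⋆ m)) :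
    p ≤ M.eq (diffAp Φ f g) (diffAp Φ' f' g') := by
  have e := le_inf_iff.1 (h _ (.inl rfl))
  have e' := le_inf_iff.1 (h _ (.inr rfl))
  refine forces_or (eq_or_ne (fst Φ ⋆ f) (fst Φ ⋆ g)) (fun q hq hΦfg => ?_) fun q hq hΦfg => ?_
  · refine etrans (diffAp_zro hΦfg) (esymm (diffAp_zro ?_))
    exact etrans (esymm (hq.trans h₁)) (etrans hΦfg (hq.trans h₂))
  · have d := diffAp_ne (hq.trans hΦ) (hq.trans hf) (hq.trans hg) hΦfg
    have d' := diffAp_ne (hq.trans hΦ') (hq.trans hf') (hq.trans hg')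
      (eq_of_ne_of_ne hΦfg (hq.trans h₁) (hq.trans h₂))
    have c := eq_of_ne_of_ne d (hq.trans e.1) (hq.trans e.2)
    have c' := eq_of_ne_of_ne d' (esymm (hq.trans e'.1)) (esymm (hq.trans e'.2))
    refine le_antisymm_nat ?_ ?_
    · rw [diffAp_eq]
      exact search_le c'
    · rw [diffAp_eq (Φ := Φ')]
      exact search_le c

theorem ap_diffAt {m n : M.D .N} (hf : p ≤ Dm (.N ⇒ .N) f) (hg : p ≤ Dm (.N ⇒ .N) g)
    (h : p ≤ (M.eq (fst f ⋆ m) (fst g ⋆ m) ⊓ M.eq (fst f ⋆ n) (fst g ⋆ n))ᶜ) :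
    p ≤ Ap (.N ⇒ .N) f g (M.val diffAt ⋆ f ⋆ g ⋆ m ⋆ n) := by
  simp only [val, diffAt, lam_ap]
  refine forces_ifEq (F := fun e => Ap (.N ⇒ .N) f g e) (by fun_prop) (fun q hq h' => ?_)
    (fun q hq h' => ?_)
  · exact ap_arr_intro (hq.trans hf) (hq.trans hg) dm_zro (forces_compl fun r hr h'' =>
      forces_absurd (hr.trans (hq.trans h)) (le_inf (hr.trans h') h''))
  · exact ap_arr_intro (hq.trans hf) (hq.trans hg) dm_zro h'

/-- By `diffAp_congr`, different outputs refute one of finitely many equations between numbers. When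
`f` or `g` varies, either the values of `Φ` differ, and `Φ` reflects this, or the varying function
changes at one of the two points. When `Φ` varies, its value changes at `f` or at `g`. -/
theorem dm_convExt : p ≤ Dm (((.N ⇒ .N) ⇒ .N) ⇒ (.N ⇒ .N) ⇒ (.N ⇒ .N) ⇒ .N) (M.val convExt) := by
  refine dm_mor (fun Φ p₁ _ hΦ => dm_mor (fun f p₂ h₂ hf => dm_mor (fun g p₃ h₃ _ => dm_zro) ?_) ?_) ?_
  · intro g g' w q hq hg hg' h
    simp only [eval_app, eval_cl, eval_v0, eval_v1, eval_v2, ap_nat] at h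
    have hΦ := hq.trans (h₂.trans hΦ)
    have hf := hq.trans hf
    refine forces_ifEq (F := fun e => Ap (.N ⇒ .N) g g' e) (by fun_prop) (fun r hr e => ?_)
      (fun r hr h' => ap_rf (hr.trans hΦ) (hr.trans hg) (hr.trans hg') h')
    simp only [eval_ap, eval_v1, eval_v2, eval_v4] at e
    simp only [eval_app, eval_cl, eval_v1, eval_v2, eval_v3, eval_v4]
    refine ap_diffAt (hr.trans hg) (hr.trans hg') (forces_compl fun s hs e' => ?_)
    have hsq := hs.trans hr
    refine forces_absurd (hsq.trans h) (diffAp_congr (hsq.trans hΦ) (hsq.trans hΦ) (hsq.trans hf)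
      (hsq.trans hf) (hsq.trans hg) (hsq.trans hg') (erefl _) (hs.trans e) ?_)
    rintro _ (rfl | rfl)
    · exact le_inf (erefl _) (e'.trans inf_le_left)
    · exact le_inf (erefl _) (e'.trans inf_le_right)
  · intro f f' w q hq hf hf' h
    obtain ⟨hg, h⟩ := ap_mor h
    simp only [eval_app, eval_cl, eval_v0, eval_v1, eval_v2, ap_nat] at h
    have hΦ := hq.trans hΦ
    refine forces_ifEq (F := fun e => Ap (.N ⇒ .N) f f' e) (by fun_prop) (fun r hr e => ?_)
      (fun r hr h' => ap_rf (hr.trans hΦ) (hr.trans hf) (hr.trans hf') h')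
    simp only [eval_ap, eval_v1, eval_v2, eval_v3] at e
    simp only [eval_app, eval_cl, eval_p1, eval_v0, eval_v1, eval_v2, eval_v3]
    refine ap_diffAt (hr.trans hf) (hr.trans hf') (forces_compl fun s hs e' => ?_)
    have hsq := hs.trans hr
    refine forces_absurd (hsq.trans h) (diffAp_congr (hsq.trans hΦ) (hsq.trans hΦ) (hsq.trans hf)
      (hsq.trans hf') (hsq.trans hg) (hsq.trans hg) (hs.trans e) (erefl _) ?_)
    rintro _ (rfl | rfl)
    · exact le_inf (e'.trans inf_le_left) (erefl _)
    · exact le_inf (e'.trans inf_le_right) (erefl _)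
  · intro Φ Φ' w q hq hΦ hΦ' h
    obtain ⟨hf, h⟩ := ap_mor h
    obtain ⟨hg, h⟩ := ap_mor h
    simp only [eval_app, eval_cl, eval_v0, eval_v1, eval_v2, ap_nat] at h
    refine forces_ifEq (F := fun e => Ap ((.N ⇒ .N) ⇒ .N) Φ Φ' e) (by fun_prop)
      (fun r hr e => ?_) (fun r hr h' => ?_)
    · simp only [eval_ap, eval_p1, eval_v0, eval_v1, eval_v2] at e
      refine ap_arr_intro (hr.trans hΦ) (hr.trans hΦ') (hr.trans hg) ?_
      refine forces_compl fun s hs e' => ?_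
      have hsq := hs.trans hr
      refine forces_absurd (hsq.trans h) (diffAp_congr (hsq.trans hΦ) (hsq.trans hΦ')
        (hsq.trans hf) (hsq.trans hf) (hsq.trans hg) (hsq.trans hg) (hs.trans e) e' ?_)
      exact fun _ _ => le_inf (erefl _) (erefl _)
    · exact ap_arr_intro (hr.trans hΦ) (hr.trans hΦ') (hr.trans hf) h'

theorem fst_convExt : fst (fst (fst (M.val convExt) ⋆ Φ) ⋆ f) ⋆ g = diffAp Φ f g := by
  rw [val, convExt, fst_mor₃, eval_app, eval_app, eval_app, eval_cl]
  rfl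

theorem isWitness_convExt : IsWitness (M := M.alpha) 0 (M.val convExt) where
  dom := dm_convExt (M := M)
  reflects {p Φ f g} hΦ hf hg h := by
    have e : (M.alpha.ap (M.alpha.ap (M.alpha.ap (M.val convExt) Φ) f) g : M.D .N) =
      diffAp (M := M) Φ f g := fst_convExt (M := M)
    have h₁ := h.trans_eq (congrArg (·ᶜ) (alpha_eq_nat (M := M) _ _))
    refine (diffAp_ne (M := M) hΦ hf hg h₁).trans_eq ?_
    rw [← e]
    exact (congrArg (·ᶜ) (alpha_eq_nat (M := M) _ _)).symm

end DiffPoint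

end Str
end EHA

namespace EHA
namespace Str

/-! ### Soundness of the interpretation -/

theorem rel_eq_sem {H : Type} [Order.Frame H] {M : Str H} {Γ : List Ty} (A : Fm Γ) (γ : M.Env Γ)
    (r : M.D A.rty) : rel A γ r = sem A.mrOpen (γ.cons r) := by
  rw [Fm.mrOpen, sem_mr]; rfl

section Realizers

variable {H : Type} [Order.Frame H] {M : Str H} [IsTotal M] {α : Ty}

/-- The assignment of an element `X` to a single variable. -/
def Situation.single {N : Str H} [IsModel N] (X : N.D α) (hX : ⊤ ≤ N.dom X) : Situation X [α] where
  holds ω _ := ω = Env.nil.cons X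
  mono h _ := h
  dom := by
    rintro ω p rfl
    exact dom_cons (fun _ x => by cases x) (le_top.trans hX)
  wit := v0
  wit_eq := by
    rintro ω p rfl
    rfl

/-- Realizability is applied inside `M.alpha`. There `X` enters as the value of a variable, since it
is given as a closed term of the type with `plus` and not as the translation of a term. -/
theorem exists_realizer {X : Tm [] (pure 2 ⇒ pure 1 ⇒ pure 1 ⇒ pure 0).plus}
    (hX : IsWitness (M := M.alpha) 0 (M.val X)) {A : Fm []} (hA : Prov AxPlus [] A) :
    ∃ t : Tm [] A.rty.plus, ⊤ ≤ Dm A.rty (M.val t) ∧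
      ⊤ ≤ sem A.mrOpen.alpha (Env.nil.cons (M.val t)) := by
  obtain ⟨t, ht⟩ := Situation.realizes_of_prov hX hA (Situation.single _ hX.dom)
    (Sub.nil _) (by simp)
  let ω : M.alpha.Env [pure 2 ⇒ pure 1 ⇒ pure 1 ⇒ pure 0] :=
    Env.nil.cons (M := M.alpha) (M.val X)
  -- Translating the realizer and then substituting `X` yields a closed term over `M` whose value is
  -- the value of the realizer in `M.alpha`.
  have e : M.val (t.plus.subst ((Sub.id []).cons X)) = eval ω t := by
    rw [← eval_plus, val, eval_subst, evalSub_cons]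
    rfl
  have h := ht ω ⊤ rfl
  have hd : ⊤ ≤ M.alpha.dom (eval ω t) :=
    Situation.dom_eval (C := Situation.single _ hX.dom) rfl t
  rw [rel_eq_sem, ← sem_alpha] at h
  refine ⟨t.plus.subst ((Sub.id []).cons X), ?_, ?_⟩
  · rw [e]
    exact hd
  · rw [e]
    exact h

end Realizers

end Str
end EHA

-- Transfer from the generic model to derivability

theorem mainTheorem11 (A : EHA.Fm []) (hA : EHA.Prov EHA.AxPlus [] A) :
    EHA.Prov EHA.Ax [] A.mrInt.alpha ∧
      ∃ t : EHA.Tm [] A.rty.plus,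
        EHA.Prov EHA.Ax [] ((EHA.apart A.rty).dom t) ∧
          EHA.Prov EHA.Ax [] (EHA.Fm.inst (Γ := []) A.mrOpen.alpha t) := by
  obtain ⟨t, hd, hs⟩ := EHA.Str.exists_realizer (M := EHA.generic) EHA.Str.isWitness_convExt hA
  refine ⟨EHA.generic.prov_of_sem (γ := EHA.Str.Env.nil) ?_, t,
    EHA.generic.prov_of_sem (γ := EHA.Str.Env.nil) ?_,
    EHA.generic.prov_of_sem (γ := EHA.Str.Env.nil) ?_⟩
  -- The value of `t` witnesses the translated existential quantifier. Its first guard is the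
  -- trivial extent of the generic model, its second the formula `dom`.
  · refine EHA.forces_exists (EHA.generic.val t) (le_inf le_top (le_inf ?_ hs))
    rw [EHA.Str.sem_dom]
    exact hd
  · rw [EHA.Str.sem_dom]
    exact hd
  · rw [EHA.Str.sem_inst]
    exact hs
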